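/- A proper vertex coloring of a finite simple graph $G$ with colors $1,\dots,k$ is equitable if the sizes of any two of its $k$ color classes (empty classes included) differ by at most one. The equitable chromatic threshold $\chi^*_{eq}(G)$ is the smallest integer $m$ such that $G$ has an equitable proper $n$-coloring for every integer $n\ge m$. Theorem. If $G$ is a finite simple planar graph with minimum degree at least $2$ and girth at least $14$, then $\chi^*_{eq}(G)\le 3$; that is, $G$ has an equitable proper $n$-coloring for every $n\ge 3$. -/

import Mathlib

/-! ### Plane drawings of graphs -/

/-- The Euclidean plane. -/
abbrev Plane : Type := EuclideanSpace ℝ (Fin 2)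

/-- `IsPolygonalArc S a b`: the set `S` is a (simple) polygonal arc in the plane with ends `a` and
`b`, that is, the union of the segments `[p 0, p 1], …, [p (n - 1), p n]` of a polygonal line from
`a = p 0` to `b = p n` that does not touch itself: consecutive segments have only their common
breakpoint in common, and non-consecutive segments are disjoint. -/
def IsPolygonalArc (S : Set Plane) (a b : Plane) : Prop :=
  ∃ (n : ℕ) (p : ℕ → Plane), 0 < n ∧ p 0 = a ∧ p n = b ∧
    (∀ i < n, p i ≠ p (i + 1)) ∧
    (∀ i j, i < j → j < n → ∀ x ∈ segment ℝ (p i) (p (i + 1)),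
      x ∈ segment ℝ (p j) (p (j + 1)) → j = i + 1 ∧ x = p j) ∧
    S = ⋃ i ∈ Set.Iio n, segment ℝ (p i) (p (i + 1))

/-- A drawing of the graph `G` in the plane without crossings: distinct vertices are distinct
points, every edge is an arc between its two ends, an edge contains no vertex besides its ends, and
two different edges meet only in common ends. -/
structure PlaneDrawing {V : Type*} (G : SimpleGraph V) where
  /-- the point that represents a vertex -/
  point : V → Plane
  /-- the arc that represents an edge -/
  arc : Sym2 V → Set Plane
  point_injective : Function.Injective point
  isPolygonalArc_arc : ∀ u v, G.Adj u v → IsPolygonalArc (arc s(u, v)) (point u) (point v)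
  mem_of_point_mem_arc : ∀ e ∈ G.edgeSet, ∀ w, point w ∈ arc e → w ∈ e
  arc_inter_arc : ∀ e ∈ G.edgeSet, ∀ e' ∈ G.edgeSet, e ≠ e' →
    ∀ x ∈ arc e, x ∈ arc e' → ∃ w, w ∈ e ∧ w ∈ e' ∧ x = point w

/-- A graph is planar if it can be drawn in the plane without crossings. -/
def IsPlanar {V : Type*} (G : SimpleGraph V) : Prop := Nonempty (PlaneDrawing G)

/-! ### Equitable colorings -/

/-- `G` is equitably `k`-colorable: it has a proper vertex coloring with `k` colors, not all of
which have to occur, such that the sizes of any two of the `k` color classes differ by at most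
one. -/
def EquitablyColorable {V : Type*} [Fintype V] (G : SimpleGraph V) (k : ℕ) : Prop :=
  ∃ f : G.Coloring (Fin k), ∀ i j : Fin k,
    (Finset.univ.filter fun v => f v = i).card ≤ (Finset.univ.filter fun v => f v = j).card + 1

/-- The equitable chromatic threshold of `G`: the smallest `m` such that `G` is equitably
`n`-colorable for all `n ≥ m` (as for `SimpleGraph.chromaticNumber`, the value is in `ℕ∞`, so that
it would be `⊤`, and not `0`, if there were no such `m`). -/
noncomputable def equitableChromaticThreshold {V : Type*} [Fintype V] (G : SimpleGraph V) : ℕ∞ :=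
  ⨅ m ∈ {m : ℕ | ∀ n, m ≤ n → EquitablyColorable G n}, (m : ℕ∞)

/-! ### Systems of segments in general position -/

open Filter Topology

/-! Two independent bounds on the average degree collide. Colorings come from peeling: if a batch of
at most three vertices is removed, the `i`-th of which has at most `i - 1` neighbors outside the
batch, then an equitable coloring of the rest with at least three colors extends, the batch
receiving distinct colors from the smallest classes (`Peel.exists_equitableOn`). So it suffices to
peel off all vertices. The induction runs over `Tame` sets, a weakening of minimum degree 2 that
survives suitable deletions; a minimal tame set that cannot be peeled off is `Irreducible`.

An irreducible set has minimum degree at least 2, and its threads (paths of vertices of degree 2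
that start at a vertex of degree at least 3) have 1, 2 or 4 vertices. A vertex with too many long
threads can be removed together with all its branches. These stay within distance 6, so by girth 14
an outside vertex loses at most one neighbor, up to one controlled exception, and tameness persists
(`Irreducible.peel_branches`). What remains is bounded by discharging with charge `6 deg - 14`. A
vertex of degree 2 has charge `-2` and receives 1 from each end of its thread. A vertex of degree 3
with threads of 1, 1 and 4 vertices owns 4 but pays 6, so it receives 1 along each of its 1-threads.
By `Irreducible.charge_le` no vertex of degree at least 3 is overdrawn, and `Irreducible.card_le`
follows: the average degree is at least `7 / 3`.

Planarity gives `14 (|E| - |V| + 1) ≤ 2 |E|`, hence average degree below `7 / 3`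
(`PlaneDrawing.girth_mul_le`). The proof uses neither Euler's formula nor the Jordan curve theorem.
For an element `Z` of the cycle space, label a side of an edge by the parity of the number of edges
of `Z` above it. Labels are constant along face boundaries, and the two sides of `e` differ by `Z
e`. So the labels, as functions of `Z`, separate the cycle space, and at least `|E| - |V| + 1` of
them are different; each occurs on at least 14 darts, because a nonbacktracking boundary walk does
not return to a vertex in fewer than 14 steps. -/

/-- A family of segments `{(t, c i + s i * t) | left i ≤ t ≤ right i}` in which any two end points
with the same abscissa coincide and any two segments meet only in common end points. -/
structure SegmentSystem (ι : Type*) where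
  left : ι → ℝ
  right : ι → ℝ
  slope : ι → ℝ
  icpt : ι → ℝ
  left_lt_right : ∀ i, left i < right i
  left_left : ∀ i j, left i = left j →
    icpt i + slope i * left i = icpt j + slope j * left i
  right_right : ∀ i j, right i = right j →
    icpt i + slope i * right i = icpt j + slope j * right i
  left_right : ∀ i j, left i = right j →
    icpt i + slope i * left i = icpt j + slope j * left i
  crossing : ∀ i j, i ≠ j → ∀ t, left i ≤ t → t ≤ right i → left j ≤ t → t ≤ right j →
    icpt i + slope i * t = icpt j + slope j * t → t = left i ∨ t = right i

namespace SegmentSystem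

variable {ι : Type*} (S : SegmentSystem ι)

/-- The height of the line through the segment `i` above the abscissa `t`. -/
def height (i : ι) (t : ℝ) : ℝ := S.icpt i + S.slope i * t

lemma height_left_left {i j : ι} (h : S.left i = S.left j) :
    S.height i (S.left i) = S.height j (S.left i) := S.left_left i j h

lemma height_right_right {i j : ι} (h : S.right i = S.right j) :
    S.height i (S.right i) = S.height j (S.right i) := S.right_right i j h

lemma height_left_right {i j : ι} (h : S.left i = S.right j) :
    S.height i (S.left i) = S.height j (S.left i) := S.left_right i j h

lemma eq_end_of_height_eq {i j : ι} (hij : i ≠ j) {t : ℝ} (h1 : S.left i ≤ t) (h2 : t ≤ S.right i)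
    (h3 : S.left j ≤ t) (h4 : t ≤ S.right j) (h : S.height i t = S.height j t) :
    (t = S.left i ∨ t = S.right i) ∧ (t = S.left j ∨ t = S.right j) :=
  ⟨S.crossing i j hij t h1 h2 h3 h4 h, S.crossing j i hij.symm t h3 h4 h1 h2 h.symm⟩

lemma continuous_height (i : ι) : Continuous (S.height i) := by
  unfold height; fun_prop

lemma height_sub (i j : ι) (t u : ℝ) :
    S.height j t - S.height i t = S.height j u - S.height i u
      + (S.slope j - S.slope i) * (t - u) := by
  unfold height; ring

/-- Just to the left of a common point the segment of smaller slope lies higher; so the order around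
an end point is read off from slopes. -/
lemma eventually_lt_left (i j : ι) (u : ℝ) :
    ∀ᶠ t in 𝓝[<] u, (S.height i t < S.height j t ↔
      S.height i u < S.height j u ∨ (S.height i u = S.height j u ∧ S.slope j < S.slope i)) := by
  rcases lt_trichotomy (S.height i u) (S.height j u) with h | h | h
  · have := (S.continuous_height i).continuousAt.eventually_lt
      (S.continuous_height j).continuousAt h
    filter_upwards [nhdsWithin_le_nhds this] with t ht
    simp [ht, h]
  · filter_upwards [self_mem_nhdsWithin] with t ht
    have h1 := S.height_sub i j t u
    have ht' : t - u < 0 := sub_neg.2 ht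
    simp only [h, lt_irrefl, true_and, false_or]
    constructor
    · intro h2; nlinarith
    · intro h2; nlinarith
  · have := (S.continuous_height j).continuousAt.eventually_lt
      (S.continuous_height i).continuousAt h
    filter_upwards [nhdsWithin_le_nhds this] with t ht
    simp [ht.not_gt, h.not_gt, h.ne']

lemma eventually_lt_right (i j : ι) (u : ℝ) :
    ∀ᶠ t in 𝓝[>] u, (S.height i t < S.height j t ↔
      S.height i u < S.height j u ∨ (S.height i u = S.height j u ∧ S.slope i < S.slope j)) := by
  rcases lt_trichotomy (S.height i u) (S.height j u) with h | h | h
  · have := (S.continuous_height i).continuousAt.eventually_lt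
      (S.continuous_height j).continuousAt h
    filter_upwards [nhdsWithin_le_nhds this] with t ht
    simp [ht, h]
  · filter_upwards [self_mem_nhdsWithin] with t ht
    have h1 := S.height_sub i j t u
    have ht' : 0 < t - u := sub_pos.2 ht
    simp only [h, lt_irrefl, true_and, false_or]
    constructor
    · intro h2; nlinarith
    · intro h2; nlinarith
  · have := (S.continuous_height j).continuousAt.eventually_lt
      (S.continuous_height i).continuousAt h
    filter_upwards [nhdsWithin_le_nhds this] with t ht
    simp [ht.not_gt, h.not_gt, h.ne']

/-- Spans are half-open: at an end abscissa the segments that start there are counted, and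
immediately to its left those that end there. -/
lemma eventually_span_left (j : ι) (u : ℝ) :
    ∀ᶠ t in 𝓝[<] u, (S.left j ≤ t ∧ t < S.right j ↔ S.left j < u ∧ u ≤ S.right j) := by
  have h0 : ∀ᶠ t in 𝓝[<] u, t < u := self_mem_nhdsWithin
  rcases lt_or_ge (S.left j) u with h1 | h1
  · have e1 := nhdsWithin_le_nhds (s := Set.Iio u) (eventually_gt_nhds h1)
    rcases le_or_gt u (S.right j) with h2 | h2
    · filter_upwards [h0, e1] with t h3 h4
      exact ⟨fun _ => ⟨h1, h2⟩, fun _ => ⟨h4.le, by linarith⟩⟩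
    · have e2 := nhdsWithin_le_nhds (s := Set.Iio u) (eventually_gt_nhds h2)
      filter_upwards [e2] with t h4
      exact ⟨fun h => absurd h.2 h4.not_gt, fun h => absurd h.2 h2.not_ge⟩
  · filter_upwards [h0] with t h3
    exact ⟨fun h => by linarith [h.1], fun h => by linarith [h.1]⟩

lemma eventually_span_right (j : ι) (u : ℝ) :
    ∀ᶠ t in 𝓝[>] u, (S.left j ≤ t ∧ t < S.right j ↔ S.left j ≤ u ∧ u < S.right j) := by
  have h0 : ∀ᶠ t in 𝓝[>] u, u < t := self_mem_nhdsWithin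
  rcases le_or_gt (S.left j) u with h1 | h1
  · rcases lt_or_ge u (S.right j) with h2 | h2
    · have e1 := nhdsWithin_le_nhds (s := Set.Ioi u) (eventually_lt_nhds h2)
      filter_upwards [h0, e1] with t h3 h4
      exact ⟨fun _ => ⟨h1, h2⟩, fun _ => ⟨by linarith, h4⟩⟩
    · filter_upwards [h0] with t h3
      exact ⟨fun h => by linarith [h.2], fun h => by linarith [h.2]⟩
  · have e1 := nhdsWithin_le_nhds (s := Set.Ioi u) (eventually_lt_nhds h1)
    filter_upwards [e1] with t h4
    exact ⟨fun h => by linarith [h.1], fun h => by linarith [h.1]⟩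

lemma height_ne_of_mem_Ioo {i j : ι} {u : ℝ} (hij : i ≠ j) (hu : u ∈ Set.Ioo (S.left i) (S.right i))
    (h1 : S.left j ≤ u) (h2 : u ≤ S.right j) : S.height i u ≠ S.height j u := by
  intro h
  rcases (S.eq_end_of_height_eq hij hu.1.le hu.2.le h1 h2 h).1 with h | h
  · exact hu.1.ne' h
  · exact hu.2.ne h

/-- Equal slopes would make the two segments overlap just before their common end. -/
lemma slope_ne_of_right_eq {j k : ι} (hjk : j ≠ k) (h : S.right j = S.right k) :
    S.slope j ≠ S.slope k := by
  intro hs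
  have h1 := S.left_lt_right j
  have h2 := S.left_lt_right k
  obtain ⟨t, ht, ht'⟩ := exists_between (max_lt h1 (h ▸ h2))
  have h3 := (le_max_left _ _).trans_lt ht
  have h4 := (le_max_right _ _).trans_lt ht
  refine S.height_ne_of_mem_Ioo hjk ⟨h3, ht'⟩ h4.le (h ▸ ht'.le) ?_
  have e1 := S.height_right_right h
  have e2 := S.height_sub j k t (S.right j)
  rw [hs] at e2
  linarith

lemma slope_ne_of_left_eq {j k : ι} (hjk : j ≠ k) (h : S.left j = S.left k) :
    S.slope j ≠ S.slope k := by
  intro hs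
  have h1 := S.left_lt_right j
  have h2 := S.left_lt_right k
  obtain ⟨t, ht', ht⟩ := exists_between (lt_min h1 (h ▸ h2))
  have h3 := ht.trans_le (min_le_left _ _)
  have h4 := ht.trans_le (min_le_right _ _)
  refine S.height_ne_of_mem_Ioo hjk ⟨ht', h3⟩ (h ▸ ht'.le) h4.le ?_
  have e1 := S.height_left_left h
  have e2 := S.height_sub j k t (S.left j)
  rw [hs] at e2
  linarith

/-! ### Parity of an even family above a segment -/

variable [Fintype ι]

/-- `Z` has even degree at every end point. -/
def IsEven (Z : ι → ZMod 2) : Prop :=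
  ∀ t, ∑ i, ((if S.left i = t then Z i else 0) + (if S.right i = t then Z i else 0)) = 0

open Classical in
/-- The number modulo 2 of the segments of `Z` strictly above the segment `i` at abscissa `t`. -/
noncomputable def above (Z : ι → ZMod 2) (i : ι) (t : ℝ) : ZMod 2 :=
  ∑ j, if S.left j ≤ t ∧ t < S.right j ∧ S.height i t < S.height j t then Z j else 0

open Classical in
lemma eventually_above_left (Z : ι → ZMod 2) (i : ι) (u : ℝ) :
    ∀ᶠ t in 𝓝[<] u, S.above Z i t = ∑ j, if S.left j < u ∧ u ≤ S.right j ∧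
      (S.height i u < S.height j u ∨ (S.height i u = S.height j u ∧ S.slope j < S.slope i))
      then Z j else 0 := by
  filter_upwards [eventually_all.2 fun j => S.eventually_lt_left i j u,
    eventually_all.2 fun j => S.eventually_span_left j u] with t h1 h2
  refine Finset.sum_congr rfl fun j _ => if_congr ?_ rfl rfl
  rw [← and_assoc, h2 j, h1 j, and_assoc]

open Classical in
lemma eventually_above_right (Z : ι → ZMod 2) (i : ι) (u : ℝ) :
    ∀ᶠ t in 𝓝[>] u, S.above Z i t = ∑ j, if S.left j ≤ u ∧ u < S.right j ∧
      (S.height i u < S.height j u ∨ (S.height i u = S.height j u ∧ S.slope i < S.slope j))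
      then Z j else 0 := by
  filter_upwards [eventually_all.2 fun j => S.eventually_lt_right i j u,
    eventually_all.2 fun j => S.eventually_span_right j u] with t h1 h2
  refine Finset.sum_congr rfl fun j _ => if_congr ?_ rfl rfl
  rw [← and_assoc, h2 j, h1 j, and_assoc]

/-- Nothing crosses the inside of `i`, so the count can change at `u` only through segments that
start or end there. They all share one end point. If it lies above `i`, the change is the degree of
`Z` at that point, which is even; otherwise nothing changes. -/
lemma eventually_above_eq {Z : ι → ZMod 2} (hZ : S.IsEven Z) {i : ι} {u : ℝ}
    (hu : u ∈ Set.Ioo (S.left i) (S.right i)) :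
    ∀ᶠ t in 𝓝 u, S.above Z i t = S.above Z i u := by
  classical
  have hR : S.above Z i u = ∑ j, if S.left j ≤ u ∧ u < S.right j ∧
      (S.height i u < S.height j u ∨ (S.height i u = S.height j u ∧ S.slope i < S.slope j))
      then Z j else 0 := by
    refine Finset.sum_congr rfl fun j _ => if_congr ?_ rfl rfl
    constructor
    · rintro ⟨h1, h2, h3⟩; exact ⟨h1, h2, Or.inl h3⟩
    · rintro ⟨h1, h2, h3 | ⟨h3, h4⟩⟩
      · exact ⟨h1, h2, h3⟩
      · by_cases hij : i = j
        · subst hij; exact absurd h4 (lt_irrefl _)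
        · exact absurd h3 (S.height_ne_of_mem_Ioo hij hu h1 h2.le)
  have hL : (∑ j, if S.left j < u ∧ u ≤ S.right j ∧
      (S.height i u < S.height j u ∨ (S.height i u = S.height j u ∧ S.slope j < S.slope i))
      then Z j else 0) = S.above Z i u := by
    rw [← sub_eq_zero, above, ← Finset.sum_sub_distrib]
    by_cases hv : ∃ k, (S.left k = u ∨ S.right k = u) ∧ S.height i u < S.height k u
    · obtain ⟨k, hk, hik⟩ := hv
      -- In characteristic 2 the left count minus the right count is the sum of `Z` over all segment
      -- ends at abscissa `u`.
      refine Eq.trans ?_ (hZ u)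
      refine Finset.sum_congr rfl fun j _ => ?_
      have hlr := S.left_lt_right j
      by_cases hij : i = j
      · subst hij
        simp [hu.1.ne, hu.2.ne']
      have key : S.left j = u ∨ S.right j = u → S.height i u < S.height j u := by
        intro hj
        have : S.height k u = S.height j u := by
          rcases hk with hk | hk <;> rcases hj with hj | hj
          · rw [← hk]; exact S.height_left_left (hk.trans hj.symm)
          · rw [← hk]; exact S.height_left_right (hk.trans hj.symm)
          · rw [← hj]; exact (S.height_left_right (hj.trans hk.symm)).symm
          · rw [← hk]; exact S.height_right_right (hk.trans hj.symm)
        linarith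
      by_cases hl : S.left j = u
      · have h5 := key (Or.inl hl)
        have h7 : u < S.right j := by linarith
        have h8 : S.right j ≠ u := h7.ne'
        simp [h5, hl, h7, h8, CharTwo.neg_eq]
      by_cases hr : S.right j = u
      · have h5 := key (Or.inr hr)
        have h6 : S.left j < u := by linarith
        simp [h5, hl, hr, h6]
      · have e1 : (S.left j < u ∧ u ≤ S.right j ∧ (S.height i u < S.height j u ∨
            (S.height i u = S.height j u ∧ S.slope j < S.slope i))) ↔
            (S.left j ≤ u ∧ u < S.right j ∧ S.height i u < S.height j u) := by
          constructor
          · rintro ⟨h1, h2, h3 | ⟨h3, h4⟩⟩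
            · exact ⟨h1.le, lt_of_le_of_ne h2 (Ne.symm hr), h3⟩
            · exact absurd h3 (S.height_ne_of_mem_Ioo hij hu h1.le h2)
          · rintro ⟨h1, h2, h3⟩
            exact ⟨lt_of_le_of_ne h1 hl, h2.le, Or.inl h3⟩
        simp [e1, hl, hr]
    · refine Finset.sum_eq_zero fun j _ => ?_
      rw [sub_eq_zero]
      refine if_congr ?_ rfl rfl
      have hlr := S.left_lt_right j
      by_cases hij : i = j
      · subst hij; simp
      constructor
      · rintro ⟨h1, h2, h3 | ⟨h3, h4⟩⟩
        · refine ⟨h1.le, lt_of_le_of_ne h2 fun h => hv ⟨j, Or.inr h.symm, h3⟩, h3⟩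
        · exact absurd h3 (S.height_ne_of_mem_Ioo hij hu h1.le h2)
      · rintro ⟨h1, h2, h3⟩
        exact ⟨lt_of_le_of_ne h1 fun h => hv ⟨j, Or.inl h, h3⟩, h2.le, Or.inl h3⟩
  have e1 := S.eventually_above_left Z i u
  have e2 := S.eventually_above_right Z i u
  rw [hL] at e1
  rw [← hR] at e2
  rw [← nhdsNE_sup_pure, ← nhdsLT_sup_nhdsGT, eventually_sup, eventually_sup]
  exact ⟨⟨e1, e2⟩, by simp⟩

lemma above_eq_above {Z : ι → ZMod 2} (hZ : S.IsEven Z) {i : ι} {t u : ℝ}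
    (ht : t ∈ Set.Ioo (S.left i) (S.right i)) (hu : u ∈ Set.Ioo (S.left i) (S.right i)) :
    S.above Z i t = S.above Z i u := by
  -- In the discrete topology local constancy is continuity, and an open interval is connected.
  let : TopologicalSpace (ZMod 2) := ⊥
  have : DiscreteTopology (ZMod 2) := ⟨rfl⟩
  refine isPreconnected_Ioo.constant (f := S.above Z i) (fun x hx => ?_) ht hu
  have h := S.eventually_above_eq hZ hx
  exact ((continuousAt_const (y := S.above Z i x)).congr
    (h.mono fun _ h => h.symm)).continuousWithinAt

/-- The parity of the number of segments of `Z` above the segment `i`. -/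
noncomputable def upper (Z : ι → ZMod 2) (i : ι) : ZMod 2 :=
  S.above Z i ((S.left i + S.right i) / 2)

lemma above_eq_upper {Z : ι → ZMod 2} (hZ : S.IsEven Z) {i : ι} {t : ℝ}
    (ht : t ∈ Set.Ioo (S.left i) (S.right i)) : S.above Z i t = S.upper Z i := by
  have := S.left_lt_right i
  exact S.above_eq_above hZ ht ⟨by linarith, by linarith⟩

open Classical in
/-- The parity of the number of segments of `Z` that pass strictly above the point `(u, y)`. -/
noncomputable def passing (Z : ι → ZMod 2) (u y : ℝ) : ZMod 2 :=
  ∑ j, if S.left j < u ∧ u < S.right j ∧ y < S.height j u then Z j else 0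

-- Evaluate just before the right end of `i`: segments passing over that point count in full, and of
-- those ending there exactly the ones of smaller slope lie above `i`.
open Classical in
lemma upper_eq_right {Z : ι → ZMod 2} (hZ : S.IsEven Z) (i : ι) :
    S.upper Z i = S.passing Z (S.right i) (S.height i (S.right i)) +
      ∑ j, if S.right j = S.right i ∧ S.slope j < S.slope i then Z j else 0 := by
  have hi := S.left_lt_right i
  have e1 := S.eventually_above_left Z i (S.right i)
  have e2 : ∀ᶠ t in 𝓝[<] (S.right i), t ∈ Set.Ioo (S.left i) (S.right i) := Ioo_mem_nhdsLT hi
  obtain ⟨t, h1, h2⟩ := (e1.and e2).exists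
  rw [← S.above_eq_upper hZ h2, h1, passing, ← Finset.sum_add_distrib]
  refine Finset.sum_congr rfl fun j _ => ?_
  have hj := S.left_lt_right j
  by_cases hr : S.right j = S.right i
  · have hh : S.height j (S.right i) = S.height i (S.right i) := by
      rw [← hr]; exact S.height_right_right hr
    have : S.left j < S.right i := by linarith
    simp [hr, hh, this]
  · by_cases hij : i = j
    · subst hij; simp at hr
    have e : (S.left j < S.right i ∧ S.right i ≤ S.right j ∧
        (S.height i (S.right i) < S.height j (S.right i) ∨
        S.height i (S.right i) = S.height j (S.right i) ∧ S.slope j < S.slope i)) ↔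
        (S.left j < S.right i ∧ S.right i < S.right j ∧
          S.height i (S.right i) < S.height j (S.right i)) := by
      constructor
      · rintro ⟨h1, h2, h3⟩
        refine ⟨h1, lt_of_le_of_ne h2 (Ne.symm hr), ?_⟩
        rcases h3 with h3 | ⟨h3, h4⟩
        · exact h3
        · rcases (S.eq_end_of_height_eq hij hi.le le_rfl h1.le h2 h3).2 with h | h
          · linarith
          · exact absurd h.symm hr
      · rintro ⟨h1, h2, h3⟩
        exact ⟨h1, h2.le, Or.inl h3⟩
    simp [hr, e]

open Classical in
lemma upper_eq_left {Z : ι → ZMod 2} (hZ : S.IsEven Z) (i : ι) :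
    S.upper Z i = S.passing Z (S.left i) (S.height i (S.left i)) +
      ∑ j, if S.left j = S.left i ∧ S.slope i < S.slope j then Z j else 0 := by
  have hi := S.left_lt_right i
  have e1 := S.eventually_above_right Z i (S.left i)
  have e2 : ∀ᶠ t in 𝓝[>] (S.left i), t ∈ Set.Ioo (S.left i) (S.right i) := Ioo_mem_nhdsGT hi
  obtain ⟨t, h1, h2⟩ := (e1.and e2).exists
  rw [← S.above_eq_upper hZ h2, h1, passing, ← Finset.sum_add_distrib]
  refine Finset.sum_congr rfl fun j _ => ?_
  have hj := S.left_lt_right j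
  by_cases hr : S.left j = S.left i
  · have hh : S.height j (S.left i) = S.height i (S.left i) := by
      rw [← hr]; exact S.height_left_left hr
    have : S.left i < S.right j := by linarith
    simp [hr, hh, this]
  · by_cases hij : i = j
    · subst hij; simp at hr
    have e : (S.left j ≤ S.left i ∧ S.left i < S.right j ∧
        (S.height i (S.left i) < S.height j (S.left i) ∨
        S.height i (S.left i) = S.height j (S.left i) ∧ S.slope i < S.slope j)) ↔
        (S.left j < S.left i ∧ S.left i < S.right j ∧
          S.height i (S.left i) < S.height j (S.left i)) := by
      constructor
      · rintro ⟨h1, h2, h3⟩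
        refine ⟨lt_of_le_of_ne h1 hr, h2, ?_⟩
        rcases h3 with h3 | ⟨h3, h4⟩
        · exact h3
        · rcases (S.eq_end_of_height_eq hij le_rfl hi.le h1 h2.le h3).2 with h | h
          · exact absurd h.symm hr
          · linarith
      · rintro ⟨h1, h2, h3⟩
        exact ⟨h1.le, h2, Or.inl h3⟩
    simp [hr, e]

/-- The abscissa of the first end of the segment `i`, traversed rightwards if `b` holds. -/
def tail (i : ι) (b : Bool) : ℝ := if b then S.left i else S.right i

/-- The abscissa of the last end of the segment `i`, traversed rightwards if `b` holds. -/
def head (i : ι) (b : Bool) : ℝ := if b then S.right i else S.left i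

/-- The label of the left-hand side of the segment `i`, traversed rightwards if `b` holds. -/
noncomputable def label (Z : ι → ZMod 2) (i : ι) (b : Bool) : ZMod 2 :=
  if b then S.upper Z i else S.upper Z i + Z i

/-- The lower side of a segment sees everything that the upper side sees, and the segment itself. -/
lemma label_add_label (Z : ι → ZMod 2) (i : ι) (b : Bool) :
    S.label Z i b + S.label Z i (!b) = Z i := by
  have := CharTwo.add_self_eq_zero (S.upper Z i)
  cases b <;> simp only [label, Bool.not_false, Bool.not_true, if_true, Bool.false_eq_true, if_false]
  · linear_combination this
  · linear_combination this

open Classical in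
lemma IsEven.sum_left_eq {S : SegmentSystem ι} {Z : ι → ZMod 2} (hZ : S.IsEven Z) (t : ℝ) :
    (∑ i, if S.left i = t then Z i else 0) = ∑ i, if S.right i = t then Z i else 0 := by
  have := hZ t
  rw [Finset.sum_add_distrib] at this
  exact CharTwo.add_eq_zero.1 this

-- Counting `i` itself turns the strict comparison of slopes into a weak one.
open Classical in
lemma label_false_right {Z : ι → ZMod 2} (hZ : S.IsEven Z) (i : ι) :
    S.label Z i false = S.passing Z (S.right i) (S.height i (S.right i)) +
      ∑ j, if S.right j = S.right i ∧ S.slope j ≤ S.slope i then Z j else 0 := by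
  simp only [label, Bool.false_eq_true, if_false]
  rw [S.upper_eq_right hZ, add_assoc]
  congr 1
  have : Z i = ∑ j, if j = i then Z j else 0 := by simp
  rw [this, ← Finset.sum_add_distrib]
  refine Finset.sum_congr rfl fun j _ => ?_
  by_cases hj : j = i
  · subst hj; simp
  · by_cases hr : S.right j = S.right i
    · simp [hj, hr, (S.slope_ne_of_right_eq hj hr).le_iff_lt]
    · simp [hj, hr]

open Classical in
lemma label_false_left {Z : ι → ZMod 2} (hZ : S.IsEven Z) (i : ι) :
    S.label Z i false = S.passing Z (S.left i) (S.height i (S.left i)) +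
      ∑ j, if S.left j = S.left i ∧ S.slope i ≤ S.slope j then Z j else 0 := by
  simp only [label, Bool.false_eq_true, if_false]
  rw [S.upper_eq_left hZ, add_assoc]
  congr 1
  have : Z i = ∑ j, if j = i then Z j else 0 := by simp
  rw [this, ← Finset.sum_add_distrib]
  refine Finset.sum_congr rfl fun j _ => ?_
  by_cases hj : j = i
  · subst hj; simp
  · by_cases hr : S.left j = S.left i
    · simp [hj, hr, (S.slope_ne_of_left_eq hj hr).symm.le_iff_lt]
    · simp [hj, hr]

open Classical in
/-- Around the right end of `i`, turn clockwise from the upper side of `i`. -/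
lemma exists_label_eq_true (i : ι) (hdeg : ∃ j, j ≠ i ∧ (S.left j = S.right i ∨ S.right j = S.right i)) :
    ∃ j b, S.tail j b = S.right i ∧ j ≠ i ∧
      ∀ Z, S.IsEven Z → S.label Z j b = S.label Z i true := by
  -- The next segment above `i` has the largest slope among the smaller ones; nothing lies between,
  -- so both sides count the same segments.
  by_cases h1 : ∃ j, S.right j = S.right i ∧ S.slope j < S.slope i
  · obtain ⟨j, hj, hmax⟩ := (Finset.univ.filter fun j => S.right j = S.right i ∧
      S.slope j < S.slope i).exists_max_image S.slope (by simpa [Finset.Nonempty] using h1)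
    simp only [Finset.mem_filter, Finset.mem_univ, true_and] at hj hmax
    refine ⟨j, false, by simp [tail, hj.1], fun h => by simp [h] at hj, fun Z hZ => ?_⟩
    rw [S.label_false_right hZ j, label, if_pos rfl, S.upper_eq_right hZ i, hj.1,
      S.height_right_right hj.1.symm]
    congr 1
    refine Finset.sum_congr rfl fun k _ => if_congr ?_ rfl rfl
    exact ⟨fun h => ⟨h.1, h.2.trans_lt hj.2⟩, fun h => ⟨h.1, hmax k h⟩⟩
  push Not at h1
  have e1 : ∀ Z, S.IsEven Z →
      S.label Z i true = S.passing Z (S.right i) (S.height i (S.right i)) := by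
    intro Z hZ
    rw [label, if_pos rfl, S.upper_eq_right hZ i, add_eq_left]
    refine Finset.sum_eq_zero fun k _ => if_neg fun h => absurd h.2 (h1 k h.1).not_gt
  -- If `i` is topmost on the left, the turn reaches the topmost segment on the right.
  by_cases h2 : ∃ j, S.left j = S.right i
  · obtain ⟨j, hj, hmax⟩ := (Finset.univ.filter fun j => S.left j = S.right i).exists_max_image
      S.slope (by simpa [Finset.Nonempty] using h2)
    simp only [Finset.mem_filter, Finset.mem_univ, true_and] at hj hmax
    refine ⟨j, true, by simp [tail, hj], fun h => ?_, fun Z hZ => ?_⟩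
    · rw [h] at hj; exact absurd hj (S.left_lt_right i).ne
    · rw [e1 Z hZ, label, if_pos rfl, S.upper_eq_left hZ j, S.height_left_right hj, hj, add_eq_left]
      refine Finset.sum_eq_zero fun k _ => if_neg fun h => absurd h.2 (hmax k h.1).not_gt
  push Not at h2
  -- With nothing on the right, the turn wraps around to the lowest segment on the left. Its lower
  -- side also sees every segment that ends here, and these sum to zero because `Z` is even.
  obtain ⟨j, hj, hmax⟩ := (Finset.univ.filter fun j => S.right j = S.right i).exists_max_image
    S.slope ⟨i, by simp⟩
  simp only [Finset.mem_filter, Finset.mem_univ, true_and] at hj hmax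
  refine ⟨j, false, by simp [tail, hj], fun h => ?_, fun Z hZ => ?_⟩
  · obtain ⟨k, hk, h3 | h3⟩ := hdeg
    · exact h2 k h3
    · exact S.slope_ne_of_right_eq hk h3 (le_antisymm (h ▸ hmax k h3) (h1 k h3))
  · rw [e1 Z hZ, S.label_false_right hZ j, hj, S.height_right_right hj.symm, add_eq_left]
    have e2 := hZ.sum_left_eq (S.right i)
    rw [Finset.sum_eq_zero fun k _ => if_neg (h2 k)] at e2
    refine Eq.trans ?_ e2.symm
    exact Finset.sum_congr rfl fun k _ => if_congr ⟨fun h => h.1, fun h => ⟨h, hmax k h⟩⟩ rfl rfl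

open Classical in
/-- Around the left end of `i`, turn clockwise from the lower side of `i`. -/
lemma exists_label_eq_false (i : ι)
    (hdeg : ∃ j, j ≠ i ∧ (S.left j = S.left i ∨ S.right j = S.left i)) :
    ∃ j b, S.tail j b = S.left i ∧ j ≠ i ∧
      ∀ Z, S.IsEven Z → S.label Z j b = S.label Z i false := by
  by_cases h1 : ∃ j, S.left j = S.left i ∧ S.slope j < S.slope i
  · obtain ⟨j, hj, hmax⟩ := (Finset.univ.filter fun j => S.left j = S.left i ∧
      S.slope j < S.slope i).exists_max_image S.slope (by simpa [Finset.Nonempty] using h1)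
    simp only [Finset.mem_filter, Finset.mem_univ, true_and] at hj hmax
    refine ⟨j, true, by simp [tail, hj.1], fun h => by simp [h] at hj, fun Z hZ => ?_⟩
    rw [S.label_false_left hZ i, label, if_pos rfl, S.upper_eq_left hZ j, hj.1,
      S.height_left_left hj.1.symm]
    congr 1
    refine Finset.sum_congr rfl fun k _ => if_congr ?_ rfl rfl
    refine ⟨fun h => ⟨h.1, le_of_not_gt fun h' => ?_⟩, fun h => ⟨h.1, hj.2.trans_le h.2⟩⟩
    exact absurd h.2 (hmax k ⟨h.1, h'⟩).not_gt
  push Not at h1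
  have e1 : ∀ Z, S.IsEven Z →
      S.label Z i false = S.passing Z (S.left i) (S.height i (S.left i)) +
        ∑ k, if S.left k = S.left i then Z k else 0 := by
    intro Z hZ
    rw [S.label_false_left hZ i]
    congr 1
    exact Finset.sum_congr rfl fun k _ => if_congr ⟨fun h => h.1, fun h => ⟨h, h1 k h⟩⟩ rfl rfl
  by_cases h2 : ∃ j, S.right j = S.left i
  · obtain ⟨j, hj, hmax⟩ := (Finset.univ.filter fun j => S.right j = S.left i).exists_max_image
      S.slope (by simpa [Finset.Nonempty] using h2)
    simp only [Finset.mem_filter, Finset.mem_univ, true_and] at hj hmax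
    refine ⟨j, false, by simp [tail, hj], fun h => ?_, fun Z hZ => ?_⟩
    · rw [h] at hj; exact absurd hj (S.left_lt_right i).ne'
    · rw [e1 Z hZ, S.label_false_right hZ j, hj, S.height_left_right hj.symm,
        hZ.sum_left_eq]
      congr 1
      exact Finset.sum_congr rfl fun k _ =>
        if_congr ⟨fun h => h.1, fun h => ⟨h, hmax k h⟩⟩ rfl rfl
  push Not at h2
  obtain ⟨j, hj, hmax⟩ := (Finset.univ.filter fun j => S.left j = S.left i).exists_max_image
    S.slope ⟨i, by simp⟩
  simp only [Finset.mem_filter, Finset.mem_univ, true_and] at hj hmax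
  refine ⟨j, true, by simp [tail, hj], fun h => ?_, fun Z hZ => ?_⟩
  · obtain ⟨k, hk, h3 | h3⟩ := hdeg
    · exact S.slope_ne_of_left_eq hk h3 (le_antisymm (h ▸ hmax k h3) (h1 k h3))
    · exact h2 k h3
  · rw [e1 Z hZ, label, if_pos rfl, S.upper_eq_left hZ j, hj, S.height_left_left hj.symm,
      hZ.sum_left_eq, Finset.sum_eq_zero fun k _ => if_neg (h2 k)]
    congr 1
    refine Finset.sum_eq_zero fun k _ => if_neg fun h => absurd h.2 (hmax k h.1).not_gt

/-- Every side of a segment continues, at its head, along the side of another segment. -/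
lemma exists_label_eq (i : ι) (b : Bool)
    (hdeg : ∃ j, j ≠ i ∧ (S.left j = S.head i b ∨ S.right j = S.head i b)) :
    ∃ j c, S.tail j c = S.head i b ∧ j ≠ i ∧
      ∀ Z, S.IsEven Z → S.label Z j c = S.label Z i b := by
  cases b
  · exact S.exists_label_eq_false i hdeg
  · exact S.exists_label_eq_true i hdeg

end SegmentSystem

/-! ### Polygonal arcs and their segments -/

/-- The breakpoints of all arcs of a plane drawing, together with a direction `dir` in which no two
breakpoints are aligned. -/
structure PlaneDrawing.Subdivision {V : Type*} {G : SimpleGraph V} (D : PlaneDrawing G) where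
  src : G.edgeSet → V
  tgt : G.edgeSet → V
  num : G.edgeSet → ℕ
  pt : G.edgeSet → ℕ → Plane
  dir : ℝ
  edge_eq : ∀ e, e.1 = s(src e, tgt e)
  num_pos : ∀ e, 0 < num e
  pt_zero : ∀ e, pt e 0 = D.point (src e)
  pt_num : ∀ e, pt e (num e) = D.point (tgt e)
  pt_ne_succ : ∀ e, ∀ i < num e, pt e i ≠ pt e (i + 1)
  eq_of_mem : ∀ e, ∀ i j, i < j → j < num e → ∀ x ∈ segment ℝ (pt e i) (pt e (i + 1)),
    x ∈ segment ℝ (pt e j) (pt e (j + 1)) → j = i + 1 ∧ x = pt e j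
  arc_eq : ∀ e, D.arc e.1 = ⋃ i ∈ Set.Iio (num e), segment ℝ (pt e i) (pt e (i + 1))
  generic : ∀ e e' i i', i ≤ num e → i' ≤ num e' →
    pt e i 0 + dir * pt e i 1 = pt e' i' 0 + dir * pt e' i' 1 → pt e i = pt e' i'

/-- A pair of points with different second coordinates excludes a single value of `c`. -/
lemma exists_generic_direction {F : Set Plane} (hF : F.Finite) :
    ∃ c : ℝ, ∀ x ∈ F, ∀ y ∈ F, x 0 + c * x 1 = y 0 + c * y 1 → x = y := by
  have hB : (((F ×ˢ F).image fun q => -(q.1 0 - q.2 0) / (q.1 1 - q.2 1))).Finite :=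
    (hF.prod hF).image _
  obtain ⟨c, hc⟩ := hB.infinite_compl.nonempty
  refine ⟨c, fun x hx y hy h => ?_⟩
  by_cases h1 : x 1 = y 1
  · ext i
    fin_cases i
    · simpa [h1] using h
    · exact h1
  · refine absurd ⟨(x, y), ⟨hx, hy⟩, ?_⟩ hc
    have : x 1 - y 1 ≠ 0 := sub_ne_zero.2 h1
    simp only
    field_simp
    linear_combination -h

lemma PlaneDrawing.nonempty_subdivision {V : Type*} [Finite V] {G : SimpleGraph V}
    (D : PlaneDrawing G) : Nonempty D.Subdivision := by
  have h : ∀ e : G.edgeSet, ∃ (u v : V) (n : ℕ) (p : ℕ → Plane), e.1 = s(u, v) ∧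
      0 < n ∧ p 0 = D.point u ∧ p n = D.point v ∧
      (∀ i < n, p i ≠ p (i + 1)) ∧
      (∀ i j, i < j → j < n → ∀ x ∈ segment ℝ (p i) (p (i + 1)),
        x ∈ segment ℝ (p j) (p (j + 1)) → j = i + 1 ∧ x = p j) ∧
      D.arc e.1 = ⋃ i ∈ Set.Iio n, segment ℝ (p i) (p (i + 1)) := by
    rintro ⟨e, he⟩
    induction e with
    | _ u v =>
      obtain ⟨n, p, h⟩ := D.isPolygonalArc_arc u v he
      exact ⟨u, v, n, p, rfl, h⟩
  choose u v n p h1 h2 h3 h4 h5 h6 h7 using h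
  have hF : (⋃ e, (fun i => p e i) '' Set.Iic (n e)).Finite :=
    Set.finite_iUnion fun e => (Set.finite_Iic _).image _
  obtain ⟨c, hc⟩ := exists_generic_direction hF
  exact ⟨⟨u, v, n, p, c, h1, h2, h3, h4, h5, h6, h7, fun e e' i i' hi hi' h =>
    hc _ (Set.mem_iUnion.2 ⟨e, i, hi, rfl⟩) _ (Set.mem_iUnion.2 ⟨e', i', hi', rfl⟩) h⟩⟩

/-! ### The linear coordinate in a generic direction -/

section Coordinates

variable (c : ℝ)

/-- The linear coordinate of the plane in a generic direction. -/
def abscissa (x : Plane) : ℝ := x 0 + c * x 1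

lemma eq_of_abscissa_eq {x y : Plane} (h0 : abscissa c x = abscissa c y) (h1 : x 1 = y 1) :
    x = y := by
  unfold abscissa at h0
  ext i
  fin_cases i
  · simpa [h1] using h0
  · exact h1

lemma abscissa_mem_of_mem_segment {a b x : Plane} (hab : abscissa c a ≠ abscissa c b)
    (hx : x ∈ segment ℝ a b) :
    min (abscissa c a) (abscissa c b) ≤ abscissa c x ∧
      abscissa c x ≤ max (abscissa c a) (abscissa c b) ∧
      x 1 = (a 1 - (b 1 - a 1) / (abscissa c b - abscissa c a) * abscissa c a) +
        (b 1 - a 1) / (abscissa c b - abscissa c a) * abscissa c x := by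
  obtain ⟨r, s, hr, hs, hrs, rfl⟩ := hx
  have hA : abscissa c (r • a + s • b) = r * abscissa c a + s * abscissa c b := by
    simp [abscissa]; ring
  have hr' : r = 1 - s := by linarith
  have h1 := min_le_left (abscissa c a) (abscissa c b)
  have h2 := min_le_right (abscissa c a) (abscissa c b)
  have h3 := le_max_left (abscissa c a) (abscissa c b)
  have h4 := le_max_right (abscissa c a) (abscissa c b)
  refine ⟨?_, ?_, ?_⟩
  · rw [hA]
    have h5 := mul_le_mul_of_nonneg_left h1 hr
    have h6 := mul_le_mul_of_nonneg_left h2 hs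
    rw [hr'] at h5 ⊢
    linarith
  · rw [hA]
    have h5 := mul_le_mul_of_nonneg_left h3 hr
    have h6 := mul_le_mul_of_nonneg_left h4 hs
    rw [hr'] at h5 ⊢
    linarith
  · have h5 : abscissa c b - abscissa c a ≠ 0 := sub_ne_zero.2 hab.symm
    rw [hA, hr']
    simp only [PiLp.add_apply, PiLp.smul_apply, smul_eq_mul]
    field_simp
    ring

lemma exists_mem_segment_abscissa_eq {a b : Plane} {t : ℝ}
    (h1 : min (abscissa c a) (abscissa c b) ≤ t) (h2 : t ≤ max (abscissa c a) (abscissa c b)) :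
    ∃ x ∈ segment ℝ a b, abscissa c x = t := by
  have hcont : Continuous (abscissa c) := by unfold abscissa; fun_prop
  have hc : IsPreconnected (abscissa c '' segment ℝ a b) :=
    (convex_segment a b).isPreconnected.image _ hcont.continuousOn
  have ha : abscissa c a ∈ abscissa c '' segment ℝ a b := ⟨a, left_mem_segment ℝ a b, rfl⟩
  have hb : abscissa c b ∈ abscissa c '' segment ℝ a b := ⟨b, right_mem_segment ℝ a b, rfl⟩
  have : t ∈ abscissa c '' segment ℝ a b := by
    rcases le_total (abscissa c a) (abscissa c b) with h | h
    · rw [min_eq_left h] at h1; rw [max_eq_right h] at h2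
      exact hc.Icc_subset ha hb ⟨h1, h2⟩
    · rw [min_eq_right h] at h1; rw [max_eq_left h] at h2
      exact hc.Icc_subset hb ha ⟨h1, h2⟩
  exact this

end Coordinates

/-! ### The segments of a plane drawing -/

namespace PlaneDrawing.Subdivision

variable {V : Type*} {G : SimpleGraph V} {D : PlaneDrawing G} (T : D.Subdivision)

lemma pt_inj {e : G.edgeSet} {i j : ℕ} (hi : i ≤ T.num e) (hj : j ≤ T.num e)
    (h : T.pt e i = T.pt e j) : i = j := by
  wlog hij : i ≤ j generalizing i j
  · exact (this hj hi h.symm (by omega)).symm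
  by_contra hne
  have hlt : i < j := by omega
  have hi' := left_mem_segment ℝ (T.pt e i) (T.pt e (i + 1))
  rcases hj.lt_or_eq with hj | hj
  · obtain ⟨h1, -⟩ := T.eq_of_mem e i j hlt hj (T.pt e i) hi'
      (h ▸ left_mem_segment ℝ (T.pt e j) (T.pt e (j + 1)))
    subst h1
    exact T.pt_ne_succ e i (by omega) h
  · obtain ⟨k, rfl⟩ : ∃ k, j = k + 1 := ⟨j - 1, by omega⟩
    rcases (show i ≤ k by omega).lt_or_eq with hik | hik
    · obtain ⟨h1, h2⟩ := T.eq_of_mem e i k hik (by omega) (T.pt e i) hi'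
        (h ▸ right_mem_segment ℝ (T.pt e k) (T.pt e (k + 1)))
      subst h1
      exact T.pt_ne_succ e i (by omega) h2
    · subst hik
      exact T.pt_ne_succ e i (by omega) h

lemma eq_or_eq_of_pt_mem {e : G.edgeSet} {j k : ℕ} (hj : j ≤ T.num e) (hk : k < T.num e)
    (h : T.pt e j ∈ segment ℝ (T.pt e k) (T.pt e (k + 1))) : j = k ∨ j = k + 1 := by
  rcases hj.lt_or_eq with hj' | hj'
  · rcases lt_trichotomy j k with h1 | h1 | h1
    · exact Or.inl (T.pt_inj hj hk.le
        (T.eq_of_mem e j k h1 hk _ (left_mem_segment ℝ _ _) h).2)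
    · exact Or.inl h1
    · exact Or.inr (T.eq_of_mem e k j h1 hj' _ h (left_mem_segment ℝ _ _)).1
  · obtain ⟨m, rfl⟩ : ∃ m, j = m + 1 := ⟨j - 1, by have := T.num_pos e; omega⟩
    rcases (show k ≤ m by omega).lt_or_eq with h1 | h1
    · have := T.pt_inj hj (by omega)
        (T.eq_of_mem e k m h1 (by omega) _ h (right_mem_segment ℝ _ _)).2
      omega
    · exact Or.inr (by omega)

lemma segment_subset_arc {e : G.edgeSet} {k : ℕ} (hk : k < T.num e) :
    segment ℝ (T.pt e k) (T.pt e (k + 1)) ⊆ D.arc e.1 := by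
  rw [T.arc_eq]
  exact Set.subset_iUnion₂_of_subset k hk subset_rfl

lemma mem_edge_iff {e : G.edgeSet} {w : V} : w ∈ e.1 ↔ w = T.src e ∨ w = T.tgt e := by
  rw [T.edge_eq e, Sym2.mem_iff]

lemma adj (e : G.edgeSet) : G.Adj (T.src e) (T.tgt e) := by
  have := e.2
  rwa [T.edge_eq e] at this

/-- Two different segments meet only in common end points. -/
lemma end_of_mem_of_mem {e e' : G.edgeSet} {k k' : ℕ} (hk : k < T.num e) (hk' : k' < T.num e')
    (hne : ¬ (e = e' ∧ k = k')) {x : Plane} (hx : x ∈ segment ℝ (T.pt e k) (T.pt e (k + 1)))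
    (hx' : x ∈ segment ℝ (T.pt e' k') (T.pt e' (k' + 1))) :
    x = T.pt e k ∨ x = T.pt e (k + 1) := by
  by_cases he : e = e'
  · subst he
    rcases lt_trichotomy k k' with h | h | h
    · obtain ⟨h1, h2⟩ := T.eq_of_mem e k k' h hk' x hx hx'
      subst h1; exact Or.inr h2
    · exact absurd ⟨rfl, h⟩ hne
    · exact Or.inl (T.eq_of_mem e k' k h hk x hx' hx).2
  · obtain ⟨w, hw, -, rfl⟩ := D.arc_inter_arc e.1 e.2 e'.1 e'.2 (fun h => he (Subtype.ext h)) x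
      (T.segment_subset_arc hk hx) (T.segment_subset_arc hk' hx')
    rcases T.mem_edge_iff.1 hw with rfl | rfl
    · rw [← T.pt_zero] at hx ⊢
      rcases T.eq_or_eq_of_pt_mem (Nat.zero_le _) hk hx with h | h <;> simp [h]
    · rw [← T.pt_num] at hx ⊢
      rcases T.eq_or_eq_of_pt_mem le_rfl hk hx with h | h <;> simp [h]

/-- The index type of all segments of the drawing. -/
abbrev Idx : Type _ := Σ e : G.edgeSet, Fin (T.num e)

/-- The abscissa of a breakpoint. -/
def absc (e : G.edgeSet) (k : ℕ) : ℝ := abscissa T.dir (T.pt e k)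

lemma absc_eq_iff {e e' : G.edgeSet} {k k' : ℕ} (hk : k ≤ T.num e) (hk' : k' ≤ T.num e') :
    T.absc e k = T.absc e' k' ↔ T.pt e k = T.pt e' k' :=
  ⟨T.generic e e' k k' hk hk', fun h => by rw [absc, h, absc]⟩

lemma absc_ne {e : G.edgeSet} {k : ℕ} (hk : k < T.num e) : T.absc e k ≠ T.absc e (k + 1) :=
  fun h => T.pt_ne_succ e k hk (T.generic e e k (k + 1) hk.le hk h)

/-- The slope of a segment. -/
noncomputable def slope (i : T.Idx) : ℝ :=
  (T.pt i.1 (i.2 + 1) 1 - T.pt i.1 i.2 1) / (T.absc i.1 (i.2 + 1) - T.absc i.1 i.2)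

lemma height_eq (i : T.Idx) {x : Plane}
    (hx : x ∈ segment ℝ (T.pt i.1 i.2) (T.pt i.1 (i.2 + 1))) :
    T.pt i.1 i.2 1 - T.slope i * T.absc i.1 i.2 + T.slope i * abscissa T.dir x = x 1 :=
  (abscissa_mem_of_mem_segment T.dir (T.absc_ne i.2.2) hx).2.2.symm

lemma exists_end_left (i : T.Idx) : ∃ k, k ≤ T.num i.1 ∧
    T.pt i.1 k ∈ segment ℝ (T.pt i.1 i.2) (T.pt i.1 (i.2 + 1)) ∧
    min (T.absc i.1 i.2) (T.absc i.1 (i.2 + 1)) = T.absc i.1 k := by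
  rcases min_choice (T.absc i.1 i.2) (T.absc i.1 (i.2 + 1)) with h | h
  · exact ⟨i.2, i.2.2.le, left_mem_segment ℝ _ _, h⟩
  · exact ⟨i.2 + 1, i.2.2, right_mem_segment ℝ _ _, h⟩

lemma exists_end_right (i : T.Idx) : ∃ k, k ≤ T.num i.1 ∧
    T.pt i.1 k ∈ segment ℝ (T.pt i.1 i.2) (T.pt i.1 (i.2 + 1)) ∧
    max (T.absc i.1 i.2) (T.absc i.1 (i.2 + 1)) = T.absc i.1 k := by
  rcases max_choice (T.absc i.1 i.2) (T.absc i.1 (i.2 + 1)) with h | h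
  · exact ⟨i.2, i.2.2.le, left_mem_segment ℝ _ _, h⟩
  · exact ⟨i.2 + 1, i.2.2, right_mem_segment ℝ _ _, h⟩

lemma height_eq_of_absc_eq {i j : T.Idx} {k k' : ℕ} (hk : k ≤ T.num i.1) (hk' : k' ≤ T.num j.1)
    (hi : T.pt i.1 k ∈ segment ℝ (T.pt i.1 i.2) (T.pt i.1 (i.2 + 1)))
    (hj : T.pt j.1 k' ∈ segment ℝ (T.pt j.1 j.2) (T.pt j.1 (j.2 + 1)))
    (h : T.absc i.1 k = T.absc j.1 k') :
    T.pt i.1 i.2 1 - T.slope i * T.absc i.1 i.2 + T.slope i * T.absc i.1 k =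
      T.pt j.1 j.2 1 - T.slope j * T.absc j.1 j.2 + T.slope j * T.absc i.1 k := by
  have h1 := T.height_eq i hi
  have h2 := T.height_eq j hj
  rw [show abscissa T.dir (T.pt i.1 k) = T.absc i.1 k from rfl] at h1
  rw [show abscissa T.dir (T.pt j.1 k') = T.absc j.1 k' from rfl, ← h] at h2
  rw [h1, h2, (T.absc_eq_iff hk hk').1 h]

/-- The segments of the drawing as a system of segments. -/
noncomputable def segments : SegmentSystem T.Idx where
  left i := min (T.absc i.1 i.2) (T.absc i.1 (i.2 + 1))
  right i := max (T.absc i.1 i.2) (T.absc i.1 (i.2 + 1))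
  slope := T.slope
  icpt i := T.pt i.1 i.2 1 - T.slope i * T.absc i.1 i.2
  left_lt_right i := min_lt_max.2 (T.absc_ne i.2.2)
  left_left i j h := by
    obtain ⟨k, hk, h1, h2⟩ := T.exists_end_left i
    obtain ⟨k', hk', h1', h2'⟩ := T.exists_end_left j
    rw [h2, h2'] at h
    rw [h2]
    exact T.height_eq_of_absc_eq hk hk' h1 h1' h
  right_right i j h := by
    obtain ⟨k, hk, h1, h2⟩ := T.exists_end_right i
    obtain ⟨k', hk', h1', h2'⟩ := T.exists_end_right j
    rw [h2, h2'] at h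
    rw [h2]
    exact T.height_eq_of_absc_eq hk hk' h1 h1' h
  left_right i j h := by
    obtain ⟨k, hk, h1, h2⟩ := T.exists_end_left i
    obtain ⟨k', hk', h1', h2'⟩ := T.exists_end_right j
    rw [h2, h2'] at h
    rw [h2]
    exact T.height_eq_of_absc_eq hk hk' h1 h1' h
  crossing i j hij t h1 h2 h3 h4 h5 := by
    -- Abscissa and second coordinate determine a point, so equal heights over one abscissa yield a
    -- true common point of the two segments.
    obtain ⟨x, hx, rfl⟩ := exists_mem_segment_abscissa_eq T.dir h1 h2
    obtain ⟨y, hy, hxy⟩ := exists_mem_segment_abscissa_eq T.dir h3 h4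
    have e1 := T.height_eq i hx
    have e2 := T.height_eq j hy
    rw [hxy] at e2
    have e3 : x = y := eq_of_abscissa_eq T.dir hxy.symm (by rw [← e1, ← e2, h5])
    subst e3
    have hne : ¬ (i.1 = j.1 ∧ (i.2 : ℕ) = j.2) := by
      rintro ⟨h, h'⟩
      obtain ⟨e, k⟩ := i
      obtain ⟨e', k'⟩ := j
      subst h
      exact hij (by simpa [Fin.ext_iff] using h')
    have h6 : abscissa T.dir x = T.absc i.1 i.2 ∨ abscissa T.dir x = T.absc i.1 (i.2 + 1) := by
      rcases T.end_of_mem_of_mem i.2.2 j.2.2 hne hx hy with h | h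
      · exact Or.inl (by rw [h, absc])
      · exact Or.inr (by rw [h, absc])
    rcases le_total (T.absc i.1 i.2) (T.absc i.1 (i.2 + 1)) with h7 | h7
    · rw [min_eq_left h7, max_eq_right h7]; exact h6
    · rw [min_eq_right h7, max_eq_left h7]; exact h6.symm

end PlaneDrawing.Subdivision

/-! ### Labels of darts by the cycle space -/

namespace PlaneDrawing.Subdivision

variable {V : Type*} {G : SimpleGraph V} {D : PlaneDrawing G} (T : D.Subdivision)

/-- `Z` is an element of the cycle space of `G` over the field with two elements. -/
def _root_.SimpleGraph.IsEvenEdgeSet {V : Type*} (G : SimpleGraph V) [Fintype G.edgeSet]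
    (Z : G.edgeSet → ZMod 2) : Prop := by
  classical exact ∀ v, ∑ e, (if v ∈ e.1 then Z e else 0) = 0

-- Modulo 2 the contributions of consecutive segments of an arc telescope to those of its two ends.
-- By genericity only one vertex can lie over a given abscissa, so the condition reduces to evenness
-- at that vertex.
open Classical in
lemma isEven_segments [Fintype G.edgeSet] {Z : G.edgeSet → ZMod 2} (hZ : G.IsEvenEdgeSet Z) :
    T.segments.IsEven fun i => Z i.1 := by
  intro t
  have h1 : ∀ e, (∑ k : Fin (T.num e), ((if T.segments.left ⟨e, k⟩ = t then Z e else 0) +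
      (if T.segments.right ⟨e, k⟩ = t then Z e else 0))) =
      (if T.absc e 0 = t then Z e else 0) + (if T.absc e (T.num e) = t then Z e else 0) := by
    intro e
    have h2 : ∀ k : Fin (T.num e), ((if T.segments.left ⟨e, k⟩ = t then Z e else 0) +
      (if T.segments.right ⟨e, k⟩ = t then Z e else 0)) =
      (fun k : ℕ => (if T.absc e (k + 1) = t then Z e else 0) -
        (if T.absc e k = t then Z e else 0)) k := by
      intro k
      have hl : T.segments.left ⟨e, k⟩ = min (T.absc e k) (T.absc e (k + 1)) := rfl
      have hr : T.segments.right ⟨e, k⟩ = max (T.absc e k) (T.absc e (k + 1)) := rfl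
      rcases le_total (T.absc e k) (T.absc e (k + 1)) with h | h
      · simp only [CharTwo.sub_eq_add, hl, hr, min_eq_left h, max_eq_right h, add_comm]
      · simp only [CharTwo.sub_eq_add, hl, hr, min_eq_right h, max_eq_left h]
    rw [Finset.sum_congr rfl fun k _ => h2 k,
      Fin.sum_univ_eq_sum_range (fun k : ℕ => (if T.absc e (k + 1) = t then Z e else 0) -
        (if T.absc e k = t then Z e else 0)), Finset.sum_range_sub
        (fun k : ℕ => if T.absc e k = t then Z e else 0), CharTwo.sub_eq_add, add_comm]
  rw [Fintype.sum_sigma, Finset.sum_congr rfl fun e _ => h1 e]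
  by_cases ht : ∃ e k, (k = 0 ∨ k = T.num e) ∧ T.absc e k = t
  · obtain ⟨e₀, k₀, hk₀, rfl⟩ := ht
    have hle : k₀ ≤ T.num e₀ := by rcases hk₀ with h | h <;> omega
    obtain ⟨v, hv⟩ : ∃ v, T.pt e₀ k₀ = D.point v := by
      rcases hk₀ with rfl | rfl
      · exact ⟨_, T.pt_zero _⟩
      · exact ⟨_, T.pt_num _⟩
    refine Eq.trans (Finset.sum_congr rfl fun e _ => ?_) (hZ v)
    have hne : T.src e ≠ T.tgt e := (T.adj e).ne
    simp only [T.absc_eq_iff (Nat.zero_le _) hle, T.absc_eq_iff le_rfl hle, hv, T.pt_zero,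
      T.pt_num, D.point_injective.eq_iff, T.mem_edge_iff]
    by_cases h2 : T.src e = v
    · have : T.tgt e ≠ v := fun h => hne (h2.trans h.symm)
      simp [h2, this]
    · by_cases h3 : T.tgt e = v
      · simp [h2, h3]
      · simp [h2, h3, Ne.symm h2, Ne.symm h3]
  · push Not at ht
    refine Finset.sum_eq_zero fun e _ => ?_
    rw [if_neg (ht e 0 (Or.inl rfl)), if_neg (ht e _ (Or.inr rfl)), add_zero]

/-- The sense of traversal of a segment that agrees with the arc. -/
noncomputable def sense (i : T.Idx) : Bool := decide (T.absc i.1 i.2 < T.absc i.1 (i.2 + 1))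

lemma tail_sense (i : T.Idx) : T.segments.tail i (T.sense i) = T.absc i.1 i.2 := by
  rcases (T.absc_ne i.2.2).lt_or_gt with h | h
  · simp [SegmentSystem.tail, sense, segments, h, h.le]
  · simp [SegmentSystem.tail, sense, segments, h.le, h.not_gt]

lemma head_sense (i : T.Idx) : T.segments.head i (T.sense i) = T.absc i.1 (i.2 + 1) := by
  rcases (T.absc_ne i.2.2).lt_or_gt with h | h
  · simp [SegmentSystem.head, sense, segments, h, h.le]
  · simp [SegmentSystem.head, sense, segments, h.le, h.not_gt]

lemma tail_not_sense (i : T.Idx) : T.segments.tail i (!T.sense i) = T.absc i.1 (i.2 + 1) := by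
  rw [← head_sense]; cases T.sense i <;> rfl

lemma head_not_sense (i : T.Idx) : T.segments.head i (!T.sense i) = T.absc i.1 i.2 := by
  rw [← tail_sense]; cases T.sense i <;> rfl

lemma left_or_right_eq (i : T.Idx) (t : ℝ)
    (h : T.absc i.1 i.2 = t ∨ T.absc i.1 (i.2 + 1) = t) :
    T.segments.left i = t ∨ T.segments.right i = t := by
  rw [← tail_sense, ← head_sense] at h
  cases hs : T.sense i
  · rw [hs] at h; exact h.symm
  · rw [hs] at h; exact h

/-- The segments at an inner breakpoint of an arc. -/
lemma eq_of_pt_eq {e e' : G.edgeSet} {k k' : ℕ} (hk0 : 0 < k) (hk : k < T.num e)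
    (hk' : k' ≤ T.num e') (h : T.pt e k = T.pt e' k') : e = e' ∧ k = k' := by
  by_cases he : e = e'
  · subst he; exact ⟨rfl, T.pt_inj hk.le hk' h⟩
  · exfalso
    have h1 : T.pt e k ∈ D.arc e.1 := T.segment_subset_arc hk (left_mem_segment ℝ _ _)
    have h2 : T.pt e k ∈ D.arc e'.1 := by
      rw [h]
      rcases hk'.lt_or_eq with h3 | h3
      · exact T.segment_subset_arc h3 (left_mem_segment ℝ _ _)
      · obtain ⟨m, rfl⟩ : ∃ m, k' = m + 1 := ⟨k' - 1, by have := T.num_pos e'; omega⟩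
        exact T.segment_subset_arc (k := m) (by omega) (right_mem_segment ℝ _ _)
    obtain ⟨w, hw, -, hx⟩ := D.arc_inter_arc e.1 e.2 e'.1 e'.2 (fun h => he (Subtype.ext h)) _ h1 h2
    rcases T.mem_edge_iff.1 hw with rfl | rfl
    · rw [← T.pt_zero] at hx
      exact hk0.ne' (T.pt_inj hk.le (Nat.zero_le _) hx)
    · rw [← T.pt_num] at hx
      exact hk.ne (T.pt_inj hk.le le_rfl hx)

/-- The ends of an arc are its only breakpoints that are vertices. -/
lemma eq_of_pt_eq_point {e : G.edgeSet} {k : ℕ} {v : V} (hk : k ≤ T.num e)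
    (h : T.pt e k = D.point v) : (k = 0 ∧ v = T.src e) ∨ (k = T.num e ∧ v = T.tgt e) := by
  have h1 : D.point v ∈ D.arc e.1 := by
    rw [← h]
    rcases hk.lt_or_eq with h3 | h3
    · exact T.segment_subset_arc h3 (left_mem_segment ℝ _ _)
    · obtain ⟨m, rfl⟩ : ∃ m, k = m + 1 := ⟨k - 1, by have := T.num_pos e; omega⟩
      exact T.segment_subset_arc (k := m) (by omega) (right_mem_segment ℝ _ _)
  rcases T.mem_edge_iff.1 (D.mem_of_point_mem_arc e.1 e.2 v h1) with hv | hv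
  · rw [hv, ← T.pt_zero] at h
    exact Or.inl ⟨T.pt_inj hk (Nat.zero_le _) h, hv⟩
  · rw [hv, ← T.pt_num] at h
    exact Or.inr ⟨T.pt_inj hk le_rfl h, hv⟩

/-- If a directed segment starts at the breakpoint `k` of `e`, then it is the next segment of some
arc in the sense of the arc, or the previous one in the opposite sense. -/
lemma tail_eq {j : T.Idx} {c : Bool} {t : ℝ} (h : T.segments.tail j c = t) :
    (c = T.sense j ∧ T.absc j.1 j.2 = t) ∨ (c = !T.sense j ∧ T.absc j.1 (j.2 + 1) = t) := by
  rcases Bool.eq_or_eq_not c (T.sense j) with hc | hc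
  · subst hc; exact Or.inl ⟨rfl, by rw [← h, tail_sense]⟩
  · subst hc; exact Or.inr ⟨rfl, by rw [← h, tail_not_sense]⟩

/-- The label of the left-hand side of an arc, seen from its start. -/
noncomputable def startLabel [Fintype G.edgeSet] (Z : G.edgeSet → ZMod 2) (e : G.edgeSet) : ZMod 2 :=
  T.segments.label (fun i => Z i.1) ⟨e, ⟨0, T.num_pos e⟩⟩ (T.sense ⟨e, ⟨0, T.num_pos e⟩⟩)

/-- Only two segments meet at an inner breakpoint, so the continuation from
`SegmentSystem.exists_label_eq` must be the next segment of the same arc. -/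
lemma label_sense [Fintype G.edgeSet] {Z : G.edgeSet → ZMod 2} (hZ : G.IsEvenEdgeSet Z)
    (e : G.edgeSet) (k : ℕ) (hk : k < T.num e) :
    T.segments.label (fun i => Z i.1) ⟨e, ⟨k, hk⟩⟩ (T.sense ⟨e, ⟨k, hk⟩⟩) = T.startLabel Z e := by
  induction k with
  | zero => rfl
  | succ k ih =>
    rw [← ih (by omega)]
    set i : T.Idx := ⟨e, ⟨k, by omega⟩⟩ with hi
    set i' : T.Idx := ⟨e, ⟨k + 1, hk⟩⟩ with hi'
    obtain ⟨j, c, h1, h2, h3⟩ := T.segments.exists_label_eq i (T.sense i) ⟨i', by simp [hi, hi'],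
      T.left_or_right_eq _ _ (Or.inl (by rw [head_sense]))⟩
    rw [head_sense] at h1
    have key : j = i' ∧ c = T.sense j := by
      rcases T.tail_eq h1 with ⟨hc, h4⟩ | ⟨hc, h4⟩
      · refine ⟨?_, hc⟩
        obtain ⟨h5, h6⟩ := T.eq_of_pt_eq (Nat.succ_pos k) hk j.2.2.le
          ((T.absc_eq_iff j.2.2.le hk.le).1 h4).symm
        obtain ⟨e', k'⟩ := j
        subst h5
        simp only [hi', Sigma.mk.injEq, heq_eq_eq, true_and, Fin.ext_iff]
        exact h6.symm
      · obtain ⟨h5, h6⟩ := T.eq_of_pt_eq (Nat.succ_pos k) hk j.2.2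
          ((T.absc_eq_iff j.2.2 hk.le).1 h4).symm
        refine absurd ?_ h2
        obtain ⟨e', k'⟩ := j
        subst h5
        simp only [hi, Sigma.mk.injEq, heq_eq_eq, true_and, Fin.ext_iff]
        exact (Nat.succ_injective h6).symm
    obtain ⟨rfl, rfl⟩ := key
    exact h3 _ (T.isEven_segments hZ)

lemma label_not_sense [Fintype G.edgeSet] {Z : G.edgeSet → ZMod 2} (hZ : G.IsEvenEdgeSet Z)
    (e : G.edgeSet) (k : ℕ) (hk : k < T.num e) :
    T.segments.label (fun i => Z i.1) ⟨e, ⟨k, hk⟩⟩ (!T.sense ⟨e, ⟨k, hk⟩⟩) =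
      T.startLabel Z e + Z e := by
  have h := T.segments.label_add_label (fun i => Z i.1) ⟨e, ⟨k, hk⟩⟩ (T.sense ⟨e, ⟨k, hk⟩⟩)
  rw [T.label_sense hZ] at h
  rw [← h, ← add_assoc, CharTwo.add_self_eq_zero, zero_add]

open Classical in
/-- The label of the left-hand side of a dart. -/
noncomputable def dartLabel [Fintype G.edgeSet] (Z : G.edgeSet → ZMod 2) (d : G.Dart) : ZMod 2 :=
  if d.fst = T.src ⟨d.edge, d.edge_mem⟩ then T.startLabel Z ⟨d.edge, d.edge_mem⟩
  else T.startLabel Z ⟨d.edge, d.edge_mem⟩ + Z ⟨d.edge, d.edge_mem⟩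

lemma dart_cases (d : G.Dart) :
    (d.fst = T.src ⟨d.edge, d.edge_mem⟩ ∧ d.snd = T.tgt ⟨d.edge, d.edge_mem⟩) ∨
    (d.fst = T.tgt ⟨d.edge, d.edge_mem⟩ ∧ d.snd = T.src ⟨d.edge, d.edge_mem⟩) := by
  have h := T.edge_eq ⟨d.edge, d.edge_mem⟩
  have h2 : d.edge = s(d.fst, d.snd) := rfl
  simp only [h2] at h ⊢
  exact Sym2.eq_iff.1 h

/-- The reverse dart sees the edge from its other side. This is what lets the labels recover `Z`. -/
lemma dartLabel_add_symm [Fintype G.edgeSet] (Z : G.edgeSet → ZMod 2) (d : G.Dart) :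
    T.dartLabel Z d + T.dartLabel Z d.symm = Z ⟨d.edge, d.edge_mem⟩ := by
  have hsymm : (⟨d.symm.edge, d.symm.edge_mem⟩ : G.edgeSet) = ⟨d.edge, d.edge_mem⟩ :=
    Subtype.ext d.edge_symm
  have hne := (T.adj ⟨d.edge, d.edge_mem⟩).ne
  have h0 := CharTwo.add_self_eq_zero (T.startLabel Z ⟨d.edge, d.edge_mem⟩)
  unfold dartLabel
  rw [hsymm]
  rcases T.dart_cases d with ⟨h1, h2⟩ | ⟨h1, h2⟩
  · rw [if_pos h1, if_neg (by rw [show d.symm.fst = d.snd from rfl, h2]; exact hne.symm)]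
    linear_combination h0
  · rw [if_neg (by rw [h1]; exact hne.symm), if_pos (by rw [show d.symm.fst = d.snd from rfl, h2])]
    linear_combination h0

/-- The segment at the head of a dart, and its sense of traversal. -/
lemma exists_last_segment [Fintype G.edgeSet] (d : G.Dart) : ∃ (i : T.Idx) (b : Bool),
    i.1 = ⟨d.edge, d.edge_mem⟩ ∧ (∃ k, k ≤ T.num i.1 ∧ T.pt i.1 k = D.point d.snd ∧
      T.segments.head i b = T.absc i.1 k ∧
      (T.absc i.1 i.2 = T.absc i.1 k ∨ T.absc i.1 (i.2 + 1) = T.absc i.1 k)) ∧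
    (∀ Z, G.IsEvenEdgeSet Z → T.segments.label (fun i => Z i.1) i b = T.dartLabel Z d) ∧
    (∀ j : T.Idx, j.1 = i.1 → ((j.2 : ℕ) = 0 ∧ d.snd = T.src i.1 ∨
      (j.2 : ℕ) + 1 = T.num i.1 ∧ d.snd = T.tgt i.1) → j = i) := by
  have hpos := T.num_pos ⟨d.edge, d.edge_mem⟩
  have hne := (T.adj ⟨d.edge, d.edge_mem⟩).ne
  rcases T.dart_cases d with ⟨h1, h2⟩ | ⟨h1, h2⟩
  · have hlt : T.num ⟨d.edge, d.edge_mem⟩ - 1 < T.num ⟨d.edge, d.edge_mem⟩ := by omega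
    have hk : T.num ⟨d.edge, d.edge_mem⟩ - 1 + 1 = T.num ⟨d.edge, d.edge_mem⟩ := by omega
    refine ⟨⟨⟨d.edge, d.edge_mem⟩, ⟨_, hlt⟩⟩, T.sense ⟨⟨d.edge, d.edge_mem⟩, ⟨_, hlt⟩⟩, rfl,
      ⟨_, le_rfl, ?_, ?_, ?_⟩, ?_, ?_⟩
    · rw [T.pt_num, h2]
    · rw [head_sense]; simp only [hk]
    · simp only [hk, or_true]
    · intro Z hZ
      rw [T.label_sense hZ, dartLabel, if_pos h1]
    · rintro ⟨e', k'⟩ rfl (⟨-, h⟩ | ⟨h, -⟩)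
      · exact absurd (h.symm.trans h2) hne
      · simp only [Sigma.mk.injEq, heq_eq_eq, true_and, Fin.ext_iff]
        simp only at h
        omega
  · refine ⟨⟨⟨d.edge, d.edge_mem⟩, ⟨0, hpos⟩⟩, !T.sense ⟨⟨d.edge, d.edge_mem⟩, ⟨0, hpos⟩⟩, rfl,
      ⟨0, Nat.zero_le _, ?_, ?_, ?_⟩,
      ?_, ?_⟩
    · rw [T.pt_zero, h2]
    · rw [head_not_sense]
    · exact Or.inl rfl
    · intro Z hZ
      rw [T.label_not_sense hZ, dartLabel, if_neg (by rw [h1]; exact hne.symm)]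
    · rintro ⟨e', k'⟩ rfl (⟨h, -⟩ | ⟨-, h⟩)
      · simp only [Sigma.mk.injEq, heq_eq_eq, true_and, Fin.ext_iff]
        exact h
      · exact absurd (h.symm.trans h2) hne.symm

/-- Walking along the boundary of a face: the left-hand side of a dart continues along a dart that
starts at its head. -/
lemma exists_next_dart [Fintype G.edgeSet] (d : G.Dart)
    (hd : ∃ w, G.Adj d.snd w ∧ w ≠ d.fst) :
    ∃ d' : G.Dart, d'.fst = d.snd ∧ d' ≠ d.symm ∧
      ∀ Z, G.IsEvenEdgeSet Z → T.dartLabel Z d' = T.dartLabel Z d := by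
  obtain ⟨i, b, hi, ⟨k, hk, hpt, hhead, -⟩, hlab, huniq⟩ := T.exists_last_segment d
  obtain ⟨w, hw, hwd⟩ := hd
  -- The second edge at the head supplies another segment there, so the boundary can go on without
  -- turning back.
  have hdeg : ∃ j, j ≠ i ∧ (T.segments.left j = T.segments.head i b ∨
      T.segments.right j = T.segments.head i b) := by
    let d₁ : G.Dart := ⟨(w, d.snd), hw.symm⟩
    obtain ⟨j, c, hj, ⟨k', hk', hpt', -, hk''⟩, -, -⟩ := T.exists_last_segment d₁
    refine ⟨j, ?_, T.left_or_right_eq j _ ?_⟩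
    · rintro rfl
      have : d₁.edge = d.edge := congrArg Subtype.val (hj.symm.trans hi)
      have h3 : s(w, d.snd) = s(d.fst, d.snd) := this
      rw [Sym2.eq_iff] at h3
      rcases h3 with ⟨h3, -⟩ | ⟨h3, -⟩
      · exact hwd h3
      · exact hw.ne h3.symm
    · have : T.absc j.1 k' = T.absc i.1 k := by
        rw [T.absc_eq_iff hk' hk, hpt', hpt]
      rw [hhead, ← this]
      exact hk''
  obtain ⟨j, c, h1, h2, h3⟩ := T.segments.exists_label_eq i b hdeg
  rw [hhead] at h1
  rcases T.tail_eq h1 with ⟨rfl, h4⟩ | ⟨rfl, h4⟩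
  · have h5 := (T.absc_eq_iff j.2.2.le hk).1 h4
    rw [hpt] at h5
    rcases T.eq_of_pt_eq_point j.2.2.le h5 with ⟨h6, h7⟩ | ⟨h6, -⟩
    swap
    · exact absurd h6 j.2.2.ne
    have hadj := T.adj j.1
    rw [← h7] at hadj
    let d' : G.Dart := ⟨(d.snd, T.tgt j.1), hadj⟩
    have he : (⟨d'.edge, d'.edge_mem⟩ : G.edgeSet) = j.1 := by
      apply Subtype.ext
      rw [T.edge_eq j.1, ← h7]
      rfl
    -- If `d'` were the reverse of `d`, then `j` would be the segment of the arc of `d` at its head,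
    -- which is `i`.
    refine ⟨d', rfl, fun h => ?_, fun Z hZ => ?_⟩
    · have h8 : j.1 = i.1 := by
        rw [hi, ← he]
        exact Subtype.ext (by rw [h]; exact d.edge_symm)
      exact h2 (huniq j h8 (Or.inl ⟨h6, h8 ▸ h7⟩))
    · rw [← hlab Z hZ, ← h3 _ (T.isEven_segments hZ)]
      have := T.label_sense hZ j.1 j.2 j.2.2
      rw [dartLabel, he, if_pos (show d'.fst = _ from h7)]
      exact this.symm
  · have h5 := (T.absc_eq_iff j.2.2 hk).1 h4
    rw [hpt] at h5
    rcases T.eq_of_pt_eq_point j.2.2 h5 with ⟨h6, -⟩ | ⟨h6, h7⟩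
    · exact absurd h6 (Nat.succ_ne_zero _)
    have hadj := (T.adj j.1).symm
    rw [← h7] at hadj
    let d' : G.Dart := ⟨(d.snd, T.src j.1), hadj⟩
    have he : (⟨d'.edge, d'.edge_mem⟩ : G.edgeSet) = j.1 := by
      apply Subtype.ext
      rw [T.edge_eq j.1, ← h7, Sym2.eq_swap]
      rfl
    refine ⟨d', rfl, fun h => ?_, fun Z hZ => ?_⟩
    · have h8 : j.1 = i.1 := by
        rw [hi, ← he]
        exact Subtype.ext (by rw [h]; exact d.edge_symm)
      exact h2 (huniq j h8 (Or.inr ⟨h8 ▸ h6, h8 ▸ h7⟩))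
    · rw [← hlab Z hZ, ← h3 _ (T.isEven_segments hZ)]
      have := T.label_not_sense hZ j.1 j.2 j.2.2
      rw [dartLabel, he, if_neg (show ¬ d'.fst = _ from fun h => (T.adj j.1).ne (h.symm.trans h7))]
      exact this.symm

end PlaneDrawing.Subdivision

/-! ### Nonbacktracking walks and the dimension of the cycle space -/

namespace SimpleGraph

variable {V : Type*} {G : SimpleGraph V}

lemma exists_walk_getVert {x : ℕ → V} {n : ℕ} (hadj : ∀ i < n, G.Adj (x i) (x (i + 1)))
    (k : ℕ) : ∀ i j, j = i + k → j ≤ n →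
      ∃ p : G.Walk (x i) (x j), p.length = k ∧ ∀ t ≤ k, p.getVert t = x (i + t) := by
  induction k with
  | zero =>
    rintro i j rfl -
    refine ⟨Walk.nil, rfl, fun t ht => ?_⟩
    obtain rfl : t = 0 := by omega
    rfl
  | succ k ih =>
    intro i j hj hn
    obtain ⟨p, hp, hv⟩ := ih (i + 1) j (by omega) hn
    refine ⟨Walk.cons (hadj i (by omega)) p, by simp [hp], fun t ht => ?_⟩
    cases t with
    | zero => simp
    | succ t =>
      rw [Walk.getVert_cons_succ, hv t (by omega)]
      congr 1; omega

/-- A nonbacktracking walk that visits a vertex twice contains a cycle. -/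
lemma egirth_le_of_nonbacktracking {x : ℕ → V} {n : ℕ} (hadj : ∀ i < n, G.Adj (x i) (x (i + 1)))
    (hnb : ∀ i, i + 2 ≤ n → x i ≠ x (i + 2)) {i j : ℕ} (hij : i < j) (hj : j ≤ n)
    (h : x i = x j) : G.egirth ≤ (j - i : ℕ) := by
  obtain ⟨k, hk⟩ : ∃ k, k = j - i := ⟨_, rfl⟩
  induction k using Nat.strong_induction_on generalizing i j with
  | _ k ih =>
    subst hk
    -- If there is no shorter return inside `[i, j]`, the vertices from `i + 1` to `j` form a path,
    -- and the edge between `x i = x j` and `x (i + 1)` closes it to a cycle.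
    by_cases hshort : ∃ i' j', i ≤ i' ∧ i' < j' ∧ j' ≤ j ∧ j' - i' < j - i ∧ x i' = x j'
    · obtain ⟨i', j', h1, h2, h3, h4, h5⟩ := hshort
      exact (ih _ h4 h2 (h3.trans hj) h5 rfl).trans (by exact_mod_cast h4.le)
    · push Not at hshort
      obtain ⟨p, hp, hv⟩ := exists_walk_getVert hadj (j - i - 1) (i + 1) j (by omega) hj
      have hpath : p.IsPath := by
        rw [← Walk.IsPath.getVert_injOn_iff, hp]
        intro s hs t ht hst
        simp only [Set.mem_ofPred_eq] at hs ht
        rw [hv s hs, hv t ht] at hst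
        rcases lt_trichotomy s t with h6 | h6 | h6
        · exact absurd hst (hshort _ _ (by omega) (by omega) (by omega) (by omega))
        · exact h6
        · exact absurd hst.symm (hshort _ _ (by omega) (by omega) (by omega) (by omega))
      have hij1 : j ≠ i + 1 := by
        rintro rfl
        exact (hadj i (by omega)).ne h
      have hij2 : j ≠ i + 2 := by
        rintro rfl
        exact hnb i hj h
      have hadj' : G.Adj (x j) (x (i + 1)) := h ▸ hadj i (by omega)
      have hc : (Walk.cons hadj' p).IsCycle := by
        rw [Walk.cons_isCycle_iff]
        refine ⟨hpath, fun he => ?_⟩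
        rw [Sym2.eq_swap] at he
        have := hpath.length_eq_one_of_mem_edges he
        omega
      refine (egirth_le_length hc).trans ?_
      rw [Walk.length_cons, hp]
      exact_mod_cast (by omega)

/-- The boundary map from edge sets to vertex sets over the field with two elements. -/
noncomputable def boundary (G : SimpleGraph V) [Fintype G.edgeSet] :
    (G.edgeSet → ZMod 2) →ₗ[ZMod 2] (V → ZMod 2) := by
  classical exact
  { toFun := fun Z v => ∑ e, if v ∈ e.1 then Z e else 0
    map_add' := fun Z W => by
      ext v
      simp only [Pi.add_apply, ← Finset.sum_add_distrib]
      exact Finset.sum_congr rfl fun e _ => by split_ifs <;> simp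
    map_smul' := fun c Z => by
      ext v
      simp only [Pi.smul_apply, smul_eq_mul, Finset.mul_sum, RingHom.id_apply]
      exact Finset.sum_congr rfl fun e _ => by split_ifs <;> simp }

lemma mem_ker_boundary [Fintype G.edgeSet] {Z : G.edgeSet → ZMod 2} :
    Z ∈ LinearMap.ker G.boundary ↔ G.IsEvenEdgeSet Z := by
  rw [LinearMap.mem_ker, funext_iff]
  rfl

open Classical in
lemma sum_boundary [Fintype V] [Fintype G.edgeSet] (Z : G.edgeSet → ZMod 2) :
    ∑ v, G.boundary Z v = 0 := by
  change ∑ v, ∑ e : G.edgeSet, (if v ∈ e.1 then Z e else 0) = 0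
  rw [Finset.sum_comm]
  refine Finset.sum_eq_zero fun e _ => ?_
  obtain ⟨e, he⟩ := e
  induction e with
  | _ u v =>
    have hne : u ≠ v := G.ne_of_adj he
    rw [Finset.sum_ite, Finset.sum_const_zero, add_zero, Finset.sum_const]
    have : (Finset.univ.filter fun w => w ∈ s(u, v)) = {u, v} := by
      ext w; simp [Sym2.mem_iff]
    rw [this, Finset.card_pair hne, two_nsmul, CharTwo.add_self_eq_zero]

/-- Rank-nullity for the boundary map. Every edge has two ends, so the image lies in the vectors of
sum zero and the rank is less than the number of vertices. -/
lemma card_edges_lt [Fintype V] [Nonempty V] [Fintype G.edgeSet] :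
    Fintype.card G.edgeSet < Module.finrank (ZMod 2) (LinearMap.ker G.boundary) + Fintype.card V := by
  have h1 := G.boundary.finrank_range_add_finrank_ker
  rw [Module.finrank_fintype_fun_eq_card] at h1
  have h2 : Module.finrank (ZMod 2) (LinearMap.range G.boundary) < Fintype.card V := by
    rw [← Module.finrank_fintype_fun_eq_card (ZMod 2) (η := V)]
    refine Submodule.finrank_lt fun h => ?_
    classical
    obtain ⟨v⟩ := ‹Nonempty V›
    obtain ⟨Z, hZ⟩ := LinearMap.range_eq_top.1 h (Pi.single v 1)
    have := G.sum_boundary Z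
    rw [hZ, Finset.sum_pi_single'] at this
    simp at this
  omega

end SimpleGraph

open Classical in
/-- A plane graph of minimum degree at least 2 and girth at least `g` satisfies
`g (|E| - |V| + 1) ≤ 2 |E|`. -/
theorem PlaneDrawing.girth_mul_le {V : Type*} [Fintype V] [Nonempty V] {G : SimpleGraph V}
    (D : PlaneDrawing G) (hdeg : ∀ u v, G.Adj u v → ∃ w, G.Adj v w ∧ w ≠ u) {g : ℕ}
    (hg : (g : ℕ∞) ≤ G.egirth) :
    g * (G.edgeFinset.card + 1) ≤ 2 * G.edgeFinset.card + g * Fintype.card V := by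
  obtain ⟨T⟩ := D.nonempty_subdivision
  let K := LinearMap.ker G.boundary
  -- A dart gives a function on the cycle space; the different functions that occur play the role of
  -- faces.
  let lab : G.Dart → K → ZMod 2 := fun d Z => T.dartLabel Z.1 d
  let R : Finset (K → ZMod 2) := Finset.univ.image lab
  have hnext : ∀ d : G.Dart, ∃ d' : G.Dart, d'.fst = d.snd ∧ d' ≠ d.symm ∧ lab d' = lab d := by
    intro d
    obtain ⟨d', h1, h2, h3⟩ := T.exists_next_dart d (hdeg _ _ d.adj)
    exact ⟨d', h1, h2, funext fun Z => h3 _ (SimpleGraph.mem_ker_boundary.1 Z.2)⟩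
  choose φ hφ1 hφ2 hφ3 using hnext
  -- Iterating `φ` follows a face boundary without turning back. By the girth the first `g` darts
  -- start at different vertices, and they all have the same label.
  have hfib : ∀ r ∈ R, g ≤ (Finset.univ.filter fun d => lab d = r).card := by
    intro r hr
    obtain ⟨d, -, rfl⟩ := Finset.mem_image.1 hr
    let seq : ℕ → G.Dart := fun k => φ^[k] d
    have hseq : ∀ k, seq (k + 1) = φ (seq k) := fun k => Function.iterate_succ_apply' φ k d
    have hx : ∀ k, (seq k).snd = (seq (k + 1)).fst := fun k => by rw [hseq, hφ1]
    have hadj : ∀ k, G.Adj (seq k).fst (seq (k + 1)).fst := fun k => hx k ▸ (seq k).adj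
    have hnb : ∀ k, (seq k).fst ≠ (seq (k + 2)).fst := by
      intro k h
      refine hφ2 (seq k) ?_
      rw [← hseq]
      apply SimpleGraph.Dart.ext
      refine Prod.ext ?_ ?_
      · exact (hx k).symm
      · exact (hx (k + 1)).trans h.symm
    have hlab : ∀ k, lab (seq k) = lab d := by
      intro k
      induction k with
      | zero => rfl
      | succ k ih => rw [hseq, hφ3, ih]
    have hinj : Set.InjOn seq (Finset.range g) := by
      have key : ∀ i j, i < j → j < g → seq i ≠ seq j := by
        intro i j hij hj h
        have := hg.trans (SimpleGraph.egirth_le_of_nonbacktracking (n := j)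
          (x := fun k => (seq k).fst) (fun i _ => hadj i) (fun i _ => hnb i) hij le_rfl
          (congrArg (fun d : G.Dart => d.fst) h))
        have : g ≤ j - i := by exact_mod_cast this
        omega
      intro i hi j hj h
      simp only [Finset.coe_range, Set.mem_Iio] at hi hj
      rcases lt_trichotomy i j with h1 | h1 | h1
      · exact absurd h (key i j h1 hj)
      · exact h1
      · exact absurd h.symm (key j i h1 hi)
    calc g = ((Finset.range g).image seq).card := by
          rw [Finset.card_image_of_injOn hinj, Finset.card_range]
      _ ≤ _ := Finset.card_le_card fun d' hd' => by
          obtain ⟨k, -, rfl⟩ := Finset.mem_image.1 hd'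
          simp [hlab]
  have hR : g * R.card ≤ 2 * G.edgeFinset.card := by
    rw [← G.dart_card_eq_twice_card_edges, ← Finset.card_univ,
      Finset.card_eq_sum_card_image lab Finset.univ, mul_comm, ← smul_eq_mul]
    exact Finset.card_nsmul_le_sum _ _ _ hfib
  -- The value of `Z` at an edge is the sum of the labels of its two darts, so `Z` is determined by
  -- its values under `R`; compare cardinalities `2 ^ dim` and `2 ^ |R|`.
  have hK : Module.finrank (ZMod 2) K ≤ R.card := by
    have hinj : Function.Injective fun (Z : K) (r : R) => r.1 Z := by
      intro Z W h
      have h' : ∀ d, T.dartLabel Z.1 d = T.dartLabel W.1 d := fun d =>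
        congrFun h ⟨lab d, Finset.mem_image_of_mem _ (Finset.mem_univ _)⟩
      ext e
      obtain ⟨e, he⟩ := e
      induction e with
      | _ u v =>
        have h1 := T.dartLabel_add_symm Z.1 ⟨(u, v), he⟩
        have h2 := T.dartLabel_add_symm W.1 ⟨(u, v), he⟩
        rw [h', h', h2] at h1
        exact h1.symm
    have h1 := Fintype.card_le_of_injective _ hinj
    rw [Module.card_eq_pow_finrank (K := ZMod 2), Fintype.card_fun, ZMod.card,
      Fintype.card_coe] at h1
    exact (Nat.pow_le_pow_iff_right (by norm_num)).1 h1
  have h3 := G.card_edges_lt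
  rw [← SimpleGraph.edgeFinset_card] at h3
  have h4 : g * (G.edgeFinset.card + 1) ≤ g * (R.card + Fintype.card V) :=
    Nat.mul_le_mul_left _ (by change _ < Module.finrank (ZMod 2) K + _ at h3; omega)
  rw [mul_add g R.card] at h4
  omega

/-! ### Peeling off small batches of vertices -/

namespace SimpleGraph

variable {V : Type*} [DecidableEq V] (G : SimpleGraph V)

/-- `G.Peel A`: the vertices in `A` can be removed in batches of one, two or three vertices, such
that the `i`-th vertex of a batch has at most `i - 1` neighbors outside of the batch among the
vertices that are still there. -/
inductive Peel : Finset V → Prop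
  | empty : Peel ∅
  | one (A : Finset V) (x : V) : x ∈ A → (∀ u ∈ A, ¬ G.Adj x u) → Peel (A \ {x}) → Peel A
  | two (A : Finset V) (x y p : V) : x ∈ A → y ∈ A → x ≠ y →
      (∀ u ∈ A, G.Adj x u → u = y) → (∀ u ∈ A, G.Adj y u → u = x ∨ u = p) →
      Peel (A \ {x, y}) → Peel A
  | three (A : Finset V) (x y z p q r : V) : x ∈ A → y ∈ A → z ∈ A → x ≠ y → x ≠ z → y ≠ z →
      (∀ u ∈ A, G.Adj x u → u = y ∨ u = z) →
      (∀ u ∈ A, G.Adj y u → u = x ∨ u = z ∨ u = p) →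
      (∀ u ∈ A, G.Adj z u → u = x ∨ u = y ∨ u = q ∨ u = r) →
      Peel (A \ {x, y, z}) → Peel A

/-- `c` is an equitable proper coloring of the subgraph induced by `A`. -/
def EquitableOn {m : ℕ} (A : Finset V) (c : V → Fin m) : Prop :=
  (∀ u ∈ A, ∀ v ∈ A, G.Adj u v → c u ≠ c v) ∧
    ∀ i j, (A.filter fun v => c v = i).card ≤ (A.filter fun v => c v = j).card + 1

omit [DecidableEq V] in
lemma exists_smallest {m : ℕ} (f : Fin m → ℕ) (k : ℕ) (hk : k ≤ m) :
    ∃ C : Finset (Fin m), C.card = k ∧ ∀ i ∈ C, ∀ j ∉ C, f i ≤ f j := by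
  induction k with
  | zero => exact ⟨∅, rfl, by simp⟩
  | succ k ih =>
    obtain ⟨C, hC, h⟩ := ih (by omega)
    have hne : (Finset.univ \ C).Nonempty := by
      rw [← Finset.card_pos, Finset.card_sdiff_of_subset (Finset.subset_univ _)]
      simp; omega
    obtain ⟨i, hi, hmin⟩ := (Finset.univ \ C).exists_min_image f hne
    simp only [Finset.mem_sdiff, Finset.mem_univ, true_and] at hi hmin
    refine ⟨insert i C, by rw [Finset.card_insert_of_notMem hi, hC], fun a ha b hb => ?_⟩
    rw [Finset.mem_insert, not_or] at hb
    rcases Finset.mem_insert.1 ha with rfl | ha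
    · exact hmin b hb.2
    · exact h a ha b hb.2

variable {G}

/-- A class that gains a vertex was no larger than any class that gains none, so sizes still differ
by at most one. -/
lemma EquitableOn.extend {m : ℕ} {A S : Finset V} {c c' : V → Fin m}
    (hc : G.EquitableOn (A \ S) c) (hS : S ⊆ A) (hcc : ∀ v ∉ S, c' v = c v)
    (hinj : Set.InjOn c' S)
    (hmin : ∀ i ∈ S.image c', ∀ j ∉ S.image c',
      ((A \ S).filter fun v => c v = i).card ≤ ((A \ S).filter fun v => c v = j).card)
    (hprop : ∀ u ∈ S, ∀ v ∈ A, v ∉ S → G.Adj u v → c' u ≠ c v) :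
    G.EquitableOn A c' := by
  refine ⟨fun u hu v hv huv => ?_, fun i j => ?_⟩
  · by_cases hu' : u ∈ S
    · by_cases hv' : v ∈ S
      · exact fun h => huv.ne (hinj hu' hv' h)
      · rw [hcc v hv']; exact hprop u hu' v hv hv' huv
    · by_cases hv' : v ∈ S
      · rw [hcc u hu']; exact (hprop v hv' u hu hu' huv.symm).symm
      · rw [hcc u hu', hcc v hv']
        exact hc.1 u (by simp [hu, hu']) v (by simp [hv, hv']) huv
  · have key : ∀ i, (A.filter fun v => c' v = i).card =
        ((A \ S).filter fun v => c v = i).card + if i ∈ S.image c' then 1 else 0 := by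
      intro i
      have h1 : (A.filter fun v => c' v = i) =
          ((A \ S).filter fun v => c v = i) ∪ (S.filter fun v => c' v = i) := by
        ext v
        simp only [Finset.mem_filter, Finset.mem_union, Finset.mem_sdiff]
        by_cases hv : v ∈ S
        · simp [hv, hS hv]
        · simp [hv, hcc v hv]
      rw [h1, Finset.card_union_of_disjoint]
      · congr 1
        split_ifs with h2
        · obtain ⟨v, hv, rfl⟩ := Finset.mem_image.1 h2
          rw [Finset.card_eq_one]
          refine ⟨v, ?_⟩
          ext w
          simp only [Finset.mem_filter, Finset.mem_singleton]
          exact ⟨fun h => hinj h.1 hv h.2, fun h => by rw [h]; exact ⟨hv, rfl⟩⟩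
        · rw [Finset.card_eq_zero, Finset.filter_eq_empty_iff]
          exact fun v hv h => h2 (Finset.mem_image.2 ⟨v, hv, h⟩)
      · rw [Finset.disjoint_left]
        intro v hv hv'
        simp only [Finset.mem_filter, Finset.mem_sdiff] at hv hv'
        exact hv.1.2 hv'.1
    rw [key, key]
    have h1 := hc.2 i j
    have h2 := hmin i
    split_ifs with h3 h4 h4
    · omega
    · have := hmin i h3 j h4; omega
    · omega
    · omega

/-- A batch of `k` vertices takes the `k` smallest classes, one vertex each. Colors are chosen from
the last vertex to the first: the `i`-th has `i` colors left and at most `i - 1` forbidden by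
neighbors outside the batch. -/
theorem Peel.exists_equitableOn {A : Finset V} (h : G.Peel A) {m : ℕ} (hm : 3 ≤ m) :
    ∃ c : V → Fin m, G.EquitableOn A c := by
  induction h with
  | empty => exact ⟨fun _ => ⟨0, by omega⟩, by simp, by simp⟩
  | one A x hx hx' _ ih =>
    obtain ⟨c, hc⟩ := ih
    obtain ⟨C, hC, hmin⟩ := exists_smallest
      (fun i => ((A \ {x}).filter fun v => c v = i).card) 1 (by omega)
    obtain ⟨a, rfl⟩ := Finset.card_eq_one.1 hC
    refine ⟨Function.update c x a, hc.extend (by simpa using hx) ?_ ?_ ?_ ?_⟩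
    · intro v hv
      rw [Function.update_of_ne (by simpa using hv)]
    · simp
    · simpa using hmin
    · simp only [Finset.mem_singleton]
      rintro u rfl v hv - huv
      exact absurd huv (hx' v hv)
  | two A x y p hx hy hxy hx' hy' _ ih =>
    obtain ⟨c, hc⟩ := ih
    obtain ⟨C, hC, hmin⟩ := exists_smallest
      (fun i => ((A \ {x, y}).filter fun v => c v = i).card) 2 (by omega)
    obtain ⟨b, hb, hb'⟩ := Finset.exists_mem_notMem_of_card_lt_card (s := {c p}) (t := C) (by simp [hC])
    obtain ⟨a, ha, ha'⟩ := Finset.exists_mem_notMem_of_card_lt_card (s := {b}) (t := C) (by simp [hC])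
    simp only [Finset.mem_singleton] at ha' hb'
    have hCC : C = {a, b} := by
      refine (Finset.eq_of_subset_of_card_le ?_ ?_).symm
      · intro i; simp only [Finset.mem_insert, Finset.mem_singleton]
        rintro (rfl | rfl) <;> assumption
      · rw [hC, Finset.card_pair ha']
    let c' := Function.update (Function.update c x a) y b
    have hcx : c' x = a := by simp [c', hxy]
    have hcy : c' y = b := by simp [c']
    have himg : ({x, y} : Finset V).image c' = C := by simp [hcx, hcy, hCC]
    refine ⟨c', hc.extend ?_ ?_ ?_ ?_ ?_⟩
    · intro v; simp only [Finset.mem_insert, Finset.mem_singleton]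
      rintro (rfl | rfl) <;> assumption
    · intro v hv
      simp only [Finset.mem_insert, Finset.mem_singleton, not_or] at hv
      simp [c', hv]
    · rw [← Finset.card_image_iff, himg, hC, Finset.card_pair hxy]
    · rw [himg]; exact hmin
    · simp only [Finset.mem_insert, Finset.mem_singleton]
      rintro u (rfl | rfl) v hv hv' huv
      · exact absurd (Or.inr (hx' v hv huv)) hv'
      · rcases hy' v hv huv with h | h
        · exact absurd (Or.inl h) hv'
        · rw [hcy, h]; exact hb'
  | three A x y z p q r hx hy hz hxy hxz hyz hx' hy' hz' _ ih =>
    obtain ⟨c, hc⟩ := ih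
    obtain ⟨C, hC, hmin⟩ := exists_smallest
      (fun i => ((A \ {x, y, z}).filter fun v => c v = i).card) 3 (by omega)
    obtain ⟨d, hd, hd'⟩ := Finset.exists_mem_notMem_of_card_lt_card (s := {c q, c r}) (t := C)
      (by rw [hC]; exact Finset.card_le_two.trans_lt (by norm_num))
    obtain ⟨b, hb, hb'⟩ := Finset.exists_mem_notMem_of_card_lt_card (s := {c p, d}) (t := C)
      (by rw [hC]; exact Finset.card_le_two.trans_lt (by norm_num))
    obtain ⟨a, ha, ha'⟩ := Finset.exists_mem_notMem_of_card_lt_card (s := {b, d}) (t := C)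
      (by rw [hC]; exact Finset.card_le_two.trans_lt (by norm_num))
    simp only [Finset.mem_insert, Finset.mem_singleton, not_or] at ha' hb' hd'
    have hcard : ({a, b, d} : Finset (Fin m)).card = 3 :=
      Finset.card_eq_three.2 ⟨a, b, d, ha'.1, ha'.2, hb'.2, rfl⟩
    have hCC : C = {a, b, d} := by
      refine (Finset.eq_of_subset_of_card_le ?_ ?_).symm
      · intro i; simp only [Finset.mem_insert, Finset.mem_singleton]
        rintro (rfl | rfl | rfl) <;> assumption
      · rw [hC, hcard]
    let c' := Function.update (Function.update (Function.update c x a) y b) z d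
    have hcx : c' x = a := by simp [c', hxy, hxz]
    have hcy : c' y = b := by simp [c', hyz]
    have hcz : c' z = d := by simp [c']
    have himg : ({x, y, z} : Finset V).image c' = C := by simp [hcx, hcy, hcz, hCC]
    refine ⟨c', hc.extend ?_ ?_ ?_ ?_ ?_⟩
    · intro v; simp only [Finset.mem_insert, Finset.mem_singleton]
      rintro (rfl | rfl | rfl) <;> assumption
    · intro v hv
      simp only [Finset.mem_insert, Finset.mem_singleton, not_or] at hv
      simp [c', hv]
    · rw [← Finset.card_image_iff, himg, hC]
      exact (Finset.card_eq_three.2 ⟨x, y, z, hxy, hxz, hyz, rfl⟩).symm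
    · rw [himg]; exact hmin
    · simp only [Finset.mem_insert, Finset.mem_singleton]
      rintro u (rfl | rfl | rfl) v hv hv' huv
      · exact absurd (Or.inr (hx' v hv huv)) hv'
      · rcases hy' v hv huv with h | h | h
        · exact absurd (Or.inl h) hv'
        · exact absurd (Or.inr (Or.inr h)) hv'
        · rw [hcy, h]; exact hb'.1
      · rcases hz' v hv huv with h | h | h | h
        · exact absurd (Or.inl h) hv'
        · exact absurd (Or.inr (Or.inl h)) hv'
        · rw [hcz, h]; exact hd'.1
        · rw [hcz, h]; exact hd'.2

lemma Peel.equitablyColorable [Fintype V] (h : G.Peel Finset.univ) {m : ℕ} (hm : 3 ≤ m) :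
    EquitablyColorable G m := by
  obtain ⟨c, hc, hc'⟩ := h.exists_equitableOn hm
  exact ⟨Coloring.mk c fun {u v} huv => hc u (Finset.mem_univ _) v (Finset.mem_univ _) huv, hc'⟩

end SimpleGraph

/-! ### Reduced lists and girth -/

set_option linter.unusedSectionVars false

namespace SimpleGraph

variable {V : Type*} (G : SimpleGraph V)

/-- The vertices of a walk that never turns back on the spot, listed from its end. -/
inductive Reduced : List V → Prop
  | single (x : V) : Reduced [x]
  | pair {x y : V} : G.Adj x y → Reduced [x, y]
  | cons {x y z : V} {l : List V} : Reduced (y :: z :: l) → G.Adj x y → x ≠ z →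
      Reduced (x :: y :: z :: l)

variable {G}

lemma Reduced.adj {x y : V} {l : List V} (h : G.Reduced (x :: y :: l)) : G.Adj x y := by
  cases h <;> assumption

lemma Reduced.ne {x y z : V} {l : List V} (h : G.Reduced (x :: y :: z :: l)) : x ≠ z := by
  cases h; assumption

lemma Reduced.tail {x y : V} {l : List V} (h : G.Reduced (x :: y :: l)) : G.Reduced (y :: l) := by
  cases h
  · exact .single _
  · assumption

lemma Reduced.extend {x y : V} {l : List V} (h : G.Reduced (y :: l)) (hxy : G.Adj x y)
    (hx : x ∉ l) : G.Reduced (x :: y :: l) := by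
  cases l with
  | nil => exact .pair hxy
  | cons z l => exact .cons h hxy (by rintro rfl; simp at hx)

lemma Reduced.getElem {l : List V} (h : G.Reduced l) :
    (∀ i (hi : i + 1 < l.length), G.Adj l[i] l[i + 1]) ∧
      ∀ i (hi : i + 2 < l.length), l[i] ≠ l[i + 2] := by
  induction h with
  | single x => simp
  | pair h =>
    refine ⟨fun i hi => ?_, fun i hi => by simp at hi⟩
    obtain rfl : i = 0 := by simp at hi; omega
    exact h
  | cons h hadj hne ih =>
    refine ⟨fun i hi => ?_, fun i hi => ?_⟩
    · cases i with
      | zero => exact hadj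
      | succ i => exact ih.1 i (by simpa using hi)
    · cases i with
      | zero => exact hne
      | succ i => exact ih.2 i (by simpa using hi)

/-- A repetition would close a nonbacktracking walk in fewer steps than the girth. -/
lemma Reduced.nodup {l : List V} (h : G.Reduced l) (hl : (l.length : ℕ∞) ≤ G.egirth) :
    l.Nodup := by
  obtain ⟨h1, h2⟩ := h.getElem
  rw [List.nodup_iff_getElem?_ne_getElem?]
  intro i j hij hj heq
  have hpos : 0 < l.length := by omega
  let x : ℕ → V := fun k => l.getD k (l[0])
  have hx : ∀ k (hk : k < l.length), x k = l[k] := fun k hk => by simp [x, hk]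
  have := egirth_le_of_nonbacktracking (G := G) (x := x) (n := l.length - 1)
    (fun k hk => by rw [hx k (by omega), hx (k + 1) (by omega)]; exact h1 k (by omega))
    (fun k hk => by rw [hx k (by omega), hx (k + 2) (by omega)]; exact h2 k (by omega))
    hij (by omega)
    (by
      rw [hx i (by omega), hx j hj]
      simpa [List.getElem?_eq_getElem hj, List.getElem?_eq_getElem (hij.trans hj)] using heq)
  have := hl.trans this
  have : l.length ≤ j - i := by exact_mod_cast this
  omega

lemma Reduced.join {x y z : V} {l m : List V} (h : G.Reduced (x :: y :: l))
    (h' : G.Reduced (x :: z :: m)) (hyz : y ≠ z) : G.Reduced (l.reverse ++ y :: x :: z :: m) := by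
  induction l generalizing x y z m with
  | nil => exact .cons h' h.adj.symm hyz
  | cons y' l ih =>
    rw [List.reverse_cons, List.append_assoc]
    exact ih h.tail (.cons h' h.adj.symm hyz) h.ne.symm

/-- Short reduced lists are determined by their ends. -/
lemma Reduced.eq_of_ends {w x : V} {l m : List V} (h : G.Reduced (x :: l))
    (h' : G.Reduced (x :: m)) (hl : (x :: l).getLast? = some w) (hm : (x :: m).getLast? = some w)
    (hg : ((l.length + m.length + 1 : ℕ) : ℕ∞) ≤ G.egirth) : l = m := by
  have aux : ∀ {x z : V} {m : List V}, G.Reduced (x :: z :: m) →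
      (x :: z :: m).getLast? = some x → ((x :: z :: m).length : ℕ∞) ≤ G.egirth → False := by
    intro x z m h1 h2 h3
    have h4 := h1.nodup h3
    rw [List.getLast?_cons_cons] at h2
    exact (List.nodup_cons.1 h4).1 (List.mem_of_getLast? h2)
  induction l generalizing x m with
  | nil =>
    cases m with
    | nil => rfl
    | cons z m =>
      simp only [List.getLast?_singleton, Option.some.injEq] at hl
      subst hl
      exact (aux h' hm (by simpa using hg)).elim
  | cons y l ih =>
    cases m with
    | nil =>
      simp only [List.getLast?_singleton, Option.some.injEq] at hm
      subst hm
      exact (aux h hl (by simpa using hg)).elim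
    | cons z m =>
      -- If the lists part at `x`, reversing one and joining it to the other gives a reduced list
      -- that contains `w` twice, although it is too short for a repetition.
      by_cases hyz : y = z
      · subst hyz
        rw [List.getLast?_cons_cons] at hl hm
        congr 1
        refine ih h.tail h'.tail hl hm (le_trans ?_ hg)
        exact_mod_cast (by simp only [List.length_cons]; omega)
      · exfalso
        have hj := (h.join h' hyz).nodup (le_trans (by
          exact_mod_cast (by simp only [List.length_append, List.length_reverse,
            List.length_cons]; omega)) hg)
        have hwl : w ∈ y :: l := by
          rw [List.getLast?_cons_cons] at hl; exact List.mem_of_getLast? hl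
        have hwm : w ∈ z :: m := by
          rw [List.getLast?_cons_cons] at hm; exact List.mem_of_getLast? hm
        rw [show l.reverse ++ y :: x :: z :: m = (y :: l).reverse ++ (x :: z :: m) by simp] at hj
        exact (List.nodup_append.1 hj).2.2 w (List.mem_reverse.2 hwl) w
          (List.mem_cons_of_mem _ hwm) rfl

open Classical in
/-- The vertices on the short reduced walk from the root `w` to `x`. -/
noncomputable def track (G : SimpleGraph V) (w x : V) : List V :=
  if h : ∃ l, G.Reduced (x :: l) ∧ (x :: l).getLast? = some w ∧ l.length ≤ 6 then h.choose else []

/-- Since `6 + 6 + 1 ≤ 14`, any two admissible lists agree, so the arbitrary choice in `track` can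
be computed. -/
lemma track_eq {w x : V} {l : List V} (hg : 14 ≤ G.egirth) (h : G.Reduced (x :: l))
    (hl : (x :: l).getLast? = some w) (hlen : l.length ≤ 6) : G.track w x = l := by
  have hex : ∃ l, G.Reduced (x :: l) ∧ (x :: l).getLast? = some w ∧ l.length ≤ 6 :=
    ⟨l, h, hl, hlen⟩
  rw [track, dif_pos hex]
  obtain ⟨h1, h2, h3⟩ := hex.choose_spec
  refine h1.eq_of_ends h h2 hl (le_trans ?_ hg)
  exact_mod_cast (by omega)

end SimpleGraph

/-! ### Irreducible sets of vertices -/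

namespace SimpleGraph

variable {V : Type*} [DecidableEq V] (G : SimpleGraph V) [DecidableRel G.Adj]

/-- The number of neighbors of `x` in `A`. -/
def degOn (A : Finset V) (x : V) : ℕ := (A.filter (G.Adj x)).card

/-- Every vertex of degree 1 has a neighbor of degree at most 2. -/
def Tame (A : Finset V) : Prop :=
  ∀ x ∈ A, G.degOn A x = 1 → ∀ y ∈ A, G.Adj x y → G.degOn A y ≤ 2

/-- The degree of `y` in `A` is 2, and `x`, `z` are its neighbors. -/
structure Mid (A : Finset V) (x y z : V) : Prop where
  left_mem : x ∈ A
  mem : y ∈ A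
  right_mem : z ∈ A
  adj_left : G.Adj y x
  adj_right : G.Adj y z
  ne : x ≠ z
  eq_or_eq : ∀ u ∈ A, G.Adj y u → u = x ∨ u = z

/-- A minimal tame set that cannot be peeled off. -/
structure Irreducible (A : Finset V) : Prop where
  girth : 14 ≤ G.egirth
  tame : G.Tame A
  not_peel : ¬ G.Peel A
  peel_of_ssubset : ∀ B, B ⊂ A → G.Tame B → G.Peel B

variable {G} {A S : Finset V}

lemma Mid.symm {x y z : V} (h : G.Mid A x y z) : G.Mid A z y x :=
  ⟨h.right_mem, h.mem, h.left_mem, h.adj_right, h.adj_left, h.ne.symm,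
    fun u hu hyu => (h.eq_or_eq u hu hyu).symm⟩

lemma Mid.degOn_eq {x y z : V} (h : G.Mid A x y z) : G.degOn A y = 2 := by
  rw [degOn, ← Finset.card_pair h.ne]
  congr 1
  ext u
  simp only [Finset.mem_filter, Finset.mem_insert, Finset.mem_singleton]
  constructor
  · exact fun hu => h.eq_or_eq u hu.1 hu.2
  · rintro (rfl | rfl)
    · exact ⟨h.left_mem, h.adj_left⟩
    · exact ⟨h.right_mem, h.adj_right⟩

lemma exists_mid {x y : V} (hx : x ∈ A) (hy : y ∈ A) (hxy : G.Adj x y) (h : G.degOn A y = 2) :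
    ∃ z, G.Mid A x y z := by
  have hmem : x ∈ A.filter (G.Adj y) := by simp [hx, hxy.symm]
  obtain ⟨z, hz⟩ := Finset.card_eq_one.1
    (show ((A.filter (G.Adj y)).erase x).card = 1 by
      rw [Finset.card_erase_of_mem hmem]; unfold degOn at h; omega)
  have hz' : ∀ u, (u ≠ x ∧ u ∈ A ∧ G.Adj y u) ↔ u = z := fun u => by
    have := Finset.ext_iff.1 hz u
    simpa using this
  have h1 := (hz' z).2 rfl
  exact ⟨z, hx, hy, h1.2.1, hxy.symm, h1.2.2, h1.1.symm, fun u hu hyu => by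
    by_cases hux : u = x
    · exact Or.inl hux
    · exact Or.inr ((hz' u).1 ⟨hux, hu, hyu⟩)⟩

lemma degOn_mono {B : Finset V} (h : B ⊆ A) (x : V) : G.degOn B x ≤ G.degOn A x :=
  Finset.card_le_card (Finset.filter_subset_filter _ h)

lemma degOn_sdiff_eq {x : V} (h : ∀ s ∈ S, ¬ G.Adj x s) : G.degOn (A \ S) x = G.degOn A x := by
  unfold degOn
  congr 1
  ext u
  simp only [Finset.mem_filter, Finset.mem_sdiff]
  exact ⟨fun hu => ⟨hu.1.1, hu.2⟩, fun hu => ⟨⟨hu.1, fun hs => h u hs hu.2⟩, hu.2⟩⟩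

lemma degOn_le_add_card {x : V} {S' : Finset V} (h : ∀ s ∈ S, G.Adj x s → s ∈ S') :
    G.degOn A x ≤ G.degOn (A \ S) x + S'.card := by
  unfold degOn
  refine (Finset.card_le_card ?_).trans (Finset.card_union_le _ _)
  intro u hu
  simp only [Finset.mem_filter, Finset.mem_union, Finset.mem_sdiff] at hu ⊢
  by_cases hs : u ∈ S
  · exact Or.inr (h u hs hu.2)
  · exact Or.inl ⟨⟨hu.1, hs⟩, hu.2⟩

lemma degOn_le_add_one {x : V} (h : ∀ s ∈ S, ∀ s' ∈ S, G.Adj x s → G.Adj x s' → s = s') :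
    G.degOn A x ≤ G.degOn (A \ S) x + 1 := by
  by_cases hex : ∃ s ∈ S, G.Adj x s
  · obtain ⟨s, hs, hxs⟩ := hex
    exact degOn_le_add_card (S' := {s}) fun s' hs' h' => by simpa using h s' hs' s hs h' hxs
  · push Not at hex
    rw [degOn_sdiff_eq hex]; omega

/-- Only neighbors of `S` can become new leaves, and degrees never grow. -/
lemma Tame.sdiff (hA : G.Tame A) (h : ∀ v ∈ A, v ∉ S → (∃ s ∈ S, G.Adj v s) →
    G.degOn (A \ S) v = 1 → ∀ y ∈ A, y ∉ S → G.Adj v y → G.degOn (A \ S) y ≤ 2) :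
    G.Tame (A \ S) := by
  intro v hv hv1 y hy hvy
  rw [Finset.mem_sdiff] at hv hy
  by_cases hs : ∃ s ∈ S, G.Adj v s
  · exact h v hv.1 hv.2 hs hv1 y hy.1 hy.2 hvy
  · push Not at hs
    rw [degOn_sdiff_eq hs] at hv1
    exact (degOn_mono Finset.sdiff_subset y).trans (hA v hv.1 hv1 y hy.1 hvy)

/-! ### Minimum degree of an irreducible set -/

namespace Irreducible

lemma peel_sdiff (hA : G.Irreducible A) (hS : ∃ s ∈ S, s ∈ A) (h : ∀ v ∈ A, v ∉ S →
    (∃ s ∈ S, G.Adj v s) → G.degOn (A \ S) v = 1 →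
    ∀ y ∈ A, y ∉ S → G.Adj v y → G.degOn (A \ S) y ≤ 2) : G.Peel (A \ S) := by
  obtain ⟨s, hs, hsA⟩ := hS
  refine hA.peel_of_ssubset _ ?_ (hA.tame.sdiff h)
  exact Finset.ssubset_iff_subset_ne.2 ⟨Finset.sdiff_subset, fun he => by
    have := he ▸ hsA
    simp [hs] at this⟩

lemma degOn_ne_zero (hA : G.Irreducible A) {x : V} (hx : x ∈ A) : G.degOn A x ≠ 0 := by
  intro h
  have h' : ∀ u ∈ A, ¬ G.Adj x u := by
    simpa [degOn, Finset.filter_eq_empty_iff] using h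
  refine hA.not_peel (.one A x hx h' (hA.peel_sdiff ⟨x, by simp, hx⟩ ?_))
  rintro v hv - ⟨s, hs, hvs⟩
  simp only [Finset.mem_singleton] at hs
  subst hs
  exact absurd hvs.symm (h' v hv)

/-- A leaf `x` and its neighbor `y`, of degree at most 2 by tameness, form a batch of two. Only the
other neighbor `z` of `y` can spoil tameness. If it becomes a leaf next to a vertex of degree at
least 3, it joins the batch, and that vertex keeps degree at least 2. -/
lemma degOn_ne_one (hA : G.Irreducible A) {x : V} (hx : x ∈ A) : G.degOn A x ≠ 1 := by
  intro h
  obtain ⟨y, hy⟩ := Finset.card_eq_one.1 h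
  have hxN : ∀ u, (u ∈ A ∧ G.Adj x u) ↔ u = y := fun u => by
    simpa using Finset.ext_iff.1 hy u
  obtain ⟨hyA, hxy⟩ := (hxN y).2 rfl
  have hxN' : ∀ u ∈ A, G.Adj x u → u = y := fun u hu hxu => (hxN u).1 ⟨hu, hxu⟩
  have hdy := hA.tame x hx h y hyA hxy
  have hyN : ∃ z, ∀ u ∈ A, G.Adj y u → u = x ∨ u = z := by
    by_cases h2 : G.degOn A y = 2
    · obtain ⟨z, hz⟩ := exists_mid hx hyA hxy h2
      exact ⟨z, hz.eq_or_eq⟩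
    · have h1 : G.degOn A y = 1 := by
        have := hA.degOn_ne_zero hyA; omega
      obtain ⟨z, hz⟩ := Finset.card_eq_one.1 h1
      refine ⟨z, fun u hu hyu => Or.inr ?_⟩
      have : u ∈ A.filter (G.Adj y) := by simp [hu, hyu]
      rw [hz] at this
      simpa using this
  obtain ⟨z, hyz⟩ := hyN
  have hnb : ∀ v ∈ A, v ∉ ({x, y} : Finset V) → (∃ s ∈ ({x, y} : Finset V), G.Adj v s) → v = z := by
    rintro v hv hvS ⟨s, hs, hvs⟩
    simp only [Finset.mem_insert, Finset.mem_singleton, not_or] at hs hvS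
    rcases hs with rfl | rfl
    · exact absurd (hxN' v hv hvs.symm) hvS.2
    · exact (hyz v hv hvs.symm).resolve_left hvS.1
  by_cases hz : z ∈ A ∧ z ∉ ({x, y} : Finset V) ∧ G.degOn (A \ {x, y}) z = 1 ∧
      ∃ u ∈ A, u ∉ ({x, y} : Finset V) ∧ G.Adj z u ∧ 2 < G.degOn (A \ {x, y}) u
  · obtain ⟨hzA, hzS, hz1, u, hu, huS, hzu, hdu⟩ := hz
    simp only [Finset.mem_insert, Finset.mem_singleton, not_or] at hzS huS
    have hzN : ∀ v ∈ A, G.Adj z v → v = x ∨ v = y ∨ v = u := by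
      intro v hv hzv
      obtain ⟨u', hu'⟩ := Finset.card_eq_one.1 hz1
      have h3 : ∀ v, ((v ∈ A ∧ v ≠ x ∧ v ≠ y) ∧ G.Adj z v) ↔ v = u' := fun v => by
        simpa using Finset.ext_iff.1 hu' v
      have h4 := (h3 u).1 ⟨⟨hu, huS⟩, hzu⟩
      by_cases hvx : v = x
      · exact Or.inl hvx
      by_cases hvy : v = y
      · exact Or.inr (Or.inl hvy)
      · exact Or.inr (Or.inr (((h3 v).1 ⟨⟨hv, hvx, hvy⟩, hzv⟩).trans h4.symm))
    refine hA.not_peel (.three A x y z z u u hx hyA hzA hxy.ne (Ne.symm hzS.1) (Ne.symm hzS.2)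
      (fun v hv h => Or.inl (hxN' v hv h)) (fun v hv h => (hyz v hv h).imp_right Or.inl)
      (fun v hv h => (hzN v hv h).imp_right (Or.imp_right Or.inl)) (hA.peel_sdiff ⟨x, by simp, hx⟩ ?_))
    rintro v hv hvS ⟨s, hs, hvs⟩ hv1
    exfalso
    simp only [Finset.mem_insert, Finset.mem_singleton, not_or] at hs hvS
    have hvu : v = u := by
      rcases hs with rfl | rfl | rfl
      · exact absurd (hxN' v hv hvs.symm) hvS.2.1
      · exact absurd ((hyz v hv hvs.symm).resolve_left hvS.1) hvS.2.2
      · exact ((hzN v hv hvs.symm).resolve_left hvS.1).resolve_left hvS.2.1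
    subst hvu
    have h5 : A \ {x, y, z} = (A \ {x, y}) \ {z} := by
      ext t; simp only [Finset.mem_sdiff, Finset.mem_insert, Finset.mem_singleton]; tauto
    rw [h5] at hv1
    have := degOn_le_add_card (G := G) (A := A \ {x, y}) (S := {z}) (S' := {z}) (x := v)
      (fun s hs _ => hs)
    rw [Finset.card_singleton] at this
    omega
  · refine hA.not_peel (.two A x y z hx hyA hxy.ne hxN' hyz (hA.peel_sdiff ⟨x, by simp, hx⟩ ?_))
    intro v hv hvS hs hv1 u hu huS hvu
    obtain rfl := hnb v hv hvS hs
    by_contra hlt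
    exact hz ⟨hv, hvS, hv1, u, hu, huS, hvu, by omega⟩

lemma two_le_degOn (hA : G.Irreducible A) {x : V} (hx : x ∈ A) : 2 ≤ G.degOn A x := by
  have := hA.degOn_ne_zero hx
  have := hA.degOn_ne_one hx
  omega

end Irreducible

end SimpleGraph

/-! ### Threads -/

namespace SimpleGraph

variable {V : Type*} [DecidableEq V] (G : SimpleGraph V) [DecidableRel G.Adj]

/-- A vertex of degree 2 between `w` and a vertex `z` of degree at least 3. -/
structure Thread1 (A : Finset V) (w a z : V) : Prop where
  mid : G.Mid A w a z
  three_le : 3 ≤ G.degOn A z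

/-- A path with two inner vertices of degree 2 from `w` to a vertex `z` of degree at least 3. -/
structure Thread2 (A : Finset V) (w a b z : V) : Prop where
  mid₁ : G.Mid A w a b
  mid₂ : G.Mid A a b z
  three_le : 3 ≤ G.degOn A z

/-- A path with four inner vertices of degree 2 from `w` to a vertex `z` of degree at least 3. -/
structure Thread4 (A : Finset V) (w a b c d z : V) : Prop where
  mid₁ : G.Mid A w a b
  mid₂ : G.Mid A a b c
  mid₃ : G.Mid A b c d
  mid₄ : G.Mid A c d z
  three_le : 3 ≤ G.degOn A z

/-- A vertex `v` of degree 3 at which there are two threads with one vertex, `b` and `c`, and a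
thread with four vertices. -/
structure Star (A : Finset V) (v b w c y a₁ a₂ a₃ a₄ z : V) : Prop where
  mem : v ∈ A
  thread_b : G.Thread1 A v b w
  thread_c : G.Thread1 A v c y
  thread_a : G.Thread4 A v a₁ a₂ a₃ a₄ z
  ne_bc : b ≠ c
  ne_ba : b ≠ a₁
  ne_ca : c ≠ a₁
  eq_or_eq : ∀ u ∈ A, G.Adj v u → u = b ∨ u = c ∨ u = a₁

/-- The first vertex after `w` on the short reduced walk from `w` to `x`. -/
noncomputable def branch (w x : V) : Option V := ((x :: G.track w x).dropLast).getLast?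

/-- `I` consists of the vertices of a part of `A` that hangs at `w` by its vertex `q`, and all other
neighbors of `I` have degree at least 3. Only the vertices in `E` may have distance 6 from `w`. -/
structure Branch (A : Finset V) (w q : V) (I E : Finset V) : Prop where
  subset : I ⊆ A
  branch_eq : ∀ s ∈ I, G.branch w s = some q
  rooted : ∀ s ∈ I, ∃ l, G.Reduced (s :: l) ∧ (s :: l).getLast? = some w ∧ l.length ≤ 6 ∧
    (s ∉ E → l.length ≤ 5) ∧ ∀ u ∈ l, u = w ∨ u ∈ I
  boundary : ∀ s ∈ I, ∀ v ∈ A, v ∉ I → v ≠ w → G.Adj s v → 3 ≤ G.degOn A v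
  start : q ∈ I ∨ 3 ≤ G.degOn A q

/-- Once `w` is removed, the branch `I` can be peeled off. -/
def EvenBranch (A : Finset V) (w : V) (I : Finset V) : Prop :=
  ∀ B, B ⊆ A → I ⊆ B → w ∉ B → G.Peel (B \ I) → G.Peel B

/-- Once `w` is removed, the branch `I` can be peeled off together with a leaf. -/
def PairBranch (A : Finset V) (w : V) (I : Finset V) : Prop :=
  ∀ B, B ⊆ A → I ⊆ B → w ∉ B → ∀ d ∈ B, d ∉ I → ∀ z, (∀ u ∈ B, G.Adj d u → u = z) →
    G.Peel (B \ (I ∪ {d})) → G.Peel B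

/-- All of the branch `I` except its first vertex `q` can be peeled off. -/
structure CleanBranch (A : Finset V) (w q : V) (I : Finset V) : Prop where
  mem : q ∈ I
  nbr : ∀ u ∈ A, G.Adj q u → u = w ∨ u ∈ I
  peel : ∀ B, B ⊆ A → I ⊆ B → G.Peel (B \ (I \ {q})) → G.Peel B

/-- Once its first vertex `q` of degree 2 is removed, the branch `I` can be peeled off. -/
structure DropBranch (A : Finset V) (w q r : V) (I : Finset V) : Prop where
  mem : q ∈ I
  nbr : ∀ u ∈ A, G.Adj q u → u = w ∨ u = r
  peel : ∀ B, B ⊆ A → I \ {q} ⊆ B → q ∉ B → G.Peel (B \ (I \ {q})) → G.Peel B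

variable {G} {A : Finset V}

lemma branch_self {w : V} (hg : 14 ≤ G.egirth) : G.branch w w = none := by
  have h : G.track w w = [] := track_eq hg (.single w) rfl (by simp)
  rw [branch, h]
  rfl

lemma branch_eq_some {w x q : V} {l : List V} (hg : 14 ≤ G.egirth) (h : G.Reduced (x :: l))
    (hl : (x :: l).getLast? = some w) (hlen : l.length ≤ 6)
    (hq : (x :: l).dropLast.getLast? = some q) : G.branch w x = some q := by
  rw [branch, track_eq hg h hl hlen, hq]

lemma Branch.mono {w q : V} {I E E' : Finset V} (h : G.Branch A w q I E) (hE : E ⊆ E') :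
    G.Branch A w q I E' :=
  ⟨h.subset, h.branch_eq, fun s hs => by
    obtain ⟨l, h1, h2, h3, h4, h5⟩ := h.rooted s hs
    exact ⟨l, h1, h2, h3, fun h6 => h4 fun h7 => h6 (hE h7), h5⟩, h.boundary, h.start⟩

/-- If all branches at `w` are removed together with `w`, the rest can be peeled off. -/
lemma Irreducible.peel_branches (hA : G.Irreducible A) {w : V} (hw : w ∈ A)
    (L : List (V × Finset V)) {E S : Finset V} (hL : ∀ b ∈ L, G.Branch A w b.1 b.2 E)
    (hS : ∀ s, s ∈ S ↔ s = w ∨ ∃ b ∈ L, s ∈ b.2) (hN : ∀ u ∈ A, G.Adj w u → ∃ b ∈ L, b.1 = u)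
    (hE : E.card ≤ 2) (hEE : ∀ e ∈ E, ∀ e' ∈ E, e ≠ e' → ∀ v ∈ A, G.Adj v e → G.Adj v e' →
      4 ≤ G.degOn A v) : G.Peel (A \ S) := by
  have hroot : ∀ s ∈ S, ∃ l, G.Reduced (s :: l) ∧ (s :: l).getLast? = some w ∧ l.length ≤ 6 ∧
      (s ∉ E → l.length ≤ 5) ∧ ∀ u ∈ l, u ∈ S := by
    intro s hs
    rcases (hS s).1 hs with rfl | ⟨b, hb, hs⟩
    · exact ⟨[], .single _, rfl, by simp, by simp, by simp⟩
    · obtain ⟨l, h1, h2, h3, h4, h5⟩ := (hL b hb).rooted s hs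
      exact ⟨l, h1, h2, h3, h4, fun u hu => (hS u).2 ((h5 u hu).imp_right fun h => ⟨b, hb, h⟩)⟩
  refine hA.peel_sdiff ⟨w, (hS w).2 (Or.inl rfl), hw⟩ ?_
  rintro v hv hvS ⟨s, hs, hvs⟩ hv1
  exfalso
  have h3 : 3 ≤ G.degOn A v := by
    rcases (hS s).1 hs with rfl | ⟨b, hb, hs'⟩
    · obtain ⟨b, hb, rfl⟩ := hN v hv hvs.symm
      exact (hL b hb).start.resolve_left fun h => hvS ((hS _).2 (Or.inr ⟨b, hb, h⟩))
    · exact (hL b hb).boundary s hs' v hv (fun h => hvS ((hS _).2 (Or.inr ⟨b, hb, h⟩)))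
        (fun h => hvS ((hS _).2 (Or.inl h))) hvs.symm
  -- The two walks from `v` to `w` list `l.length + l'.length + 3` vertices, so they coincide as
  -- long as the two lengths sum to at most 11. The sum 12 needs both `s` and `s'` in `E`.
  have huniq : ∀ s ∈ S, ∀ s' ∈ S, G.Adj v s → G.Adj v s' → s = s' ∨ (s ∈ E ∧ s' ∈ E) := by
    intro s hs s' hs' hvs hvs'
    by_contra hcon
    push Not at hcon
    obtain ⟨l, h1, h2, h3, h4, h5⟩ := hroot s hs
    obtain ⟨l', h1', h2', h3', h4', h5'⟩ := hroot s' hs'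
    have hsum : l.length + l'.length ≤ 11 := by
      by_cases hsE : s ∈ E
      · have := h4' (hcon.2 hsE); omega
      · have := h4 hsE; omega
    have key := (h1.extend hvs fun h => hvS (h5 v h)).eq_of_ends
      (h1'.extend hvs' fun h => hvS (h5' v h)) (by rw [List.getLast?_cons_cons]; exact h2)
      (by rw [List.getLast?_cons_cons]; exact h2')
      (le_trans (by simp only [List.length_cons]; exact_mod_cast (by omega)) hA.girth)
    exact hcon.1 (List.cons.inj key).1
  -- A vertex next to two exceptional vertices loses at most `E.card ≤ 2` of at least four
  -- neighbors; any other loses at most one of at least three.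
  by_cases hcase : ∃ e ∈ E, ∃ e' ∈ E, e ≠ e' ∧ G.Adj v e ∧ G.Adj v e' ∧ e ∈ S ∧ e' ∈ S
  · obtain ⟨e, he, e', he', hne, hve, hve', heS, heS'⟩ := hcase
    have h4 := hEE e he e' he' hne v hv hve hve'
    have := degOn_le_add_card (G := G) (A := A) (S := S) (S' := E) (x := v) fun t ht hvt => by
      rcases huniq t ht e heS hvt hve with h | h
      · exact h ▸ he
      · exact h.1
    omega
  · push Not at hcase
    have := degOn_le_add_one (G := G) (A := A) (S := S) (x := v) fun s hs s' hs' h h' => by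
      rcases huniq s hs s' hs' h h' with h1 | h1
      · exact h1
      · by_contra hne
        exact hcase s h1.1 s' h1.2 hne h h' hs hs'
    omega

lemma branch_of_three_le {w q : V} (h : 3 ≤ G.degOn A q) : G.Branch A w q ∅ ∅ :=
  ⟨by simp, by simp, by simp, by simp, Or.inr h⟩

lemma evenBranch_empty {w : V} : G.EvenBranch A w ∅ := fun B _ _ _ h => by simpa using h

lemma Mid.reduced {x y z : V} (h : G.Mid A x y z) : G.Reduced [z, y, x] :=
  .cons (.pair h.adj_left) h.adj_right.symm h.ne.symm

lemma Mid.reduced_cons {x y z : V} {l : List V} (h : G.Mid A x y z) (hl : G.Reduced (y :: x :: l)) :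
    G.Reduced (z :: y :: x :: l) := .cons hl h.adj_right.symm h.ne.symm

namespace Thread1

variable {w a z : V} (h : G.Thread1 A w a z)

include h

lemma branch (hg : 14 ≤ G.egirth) : G.Branch A w a {a} ∅ := by
  have r : G.Reduced [a, w] := .pair h.mid.adj_left
  refine ⟨by simpa using h.mid.mem, ?_, ?_, ?_, Or.inl (by simp)⟩
  · simpa using branch_eq_some hg r rfl (by simp) rfl
  · simp only [Finset.mem_singleton]
    rintro s rfl
    exact ⟨_, r, rfl, by simp, by simp, by simp⟩
  · simp only [Finset.mem_singleton]
    rintro s rfl v hv - hvw hsv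
    rcases h.mid.eq_or_eq v hv hsv with rfl | rfl
    · exact absurd rfl hvw
    · exact h.three_le

lemma dropBranch : G.DropBranch A w a z {a} :=
  ⟨by simp, h.mid.eq_or_eq, fun B _ _ _ hB => by simpa using hB⟩

end Thread1

namespace Thread2

variable {w a b z : V} (h : G.Thread2 A w a b z)

include h

lemma nodup (hg : 14 ≤ G.egirth) : [z, b, a, w].Nodup :=
  (h.mid₂.reduced_cons h.mid₁.reduced).nodup (le_trans (by norm_num) hg)

lemma branch (hg : 14 ≤ G.egirth) : G.Branch A w a {a, b} ∅ := by
  have r1 : G.Reduced [a, w] := .pair h.mid₁.adj_left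
  have r2 : G.Reduced [b, a, w] := h.mid₁.reduced
  refine ⟨?_, ?_, ?_, ?_, Or.inl (by simp)⟩
  · simp only [Finset.insert_subset_iff, Finset.singleton_subset_iff]
    exact ⟨h.mid₁.mem, h.mid₂.mem⟩
  · simp only [Finset.mem_insert, Finset.mem_singleton]
    rintro s (rfl | rfl)
    · exact branch_eq_some hg r1 rfl (by simp) rfl
    · exact branch_eq_some hg r2 rfl (by simp) rfl
  · simp only [Finset.mem_insert, Finset.mem_singleton]
    rintro s (rfl | rfl)
    · exact ⟨_, r1, rfl, by simp, by simp, by simp⟩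
    · exact ⟨_, r2, rfl, by simp, by simp, by simp⟩
  · simp only [Finset.mem_insert, Finset.mem_singleton, not_or]
    have e1 := h.mid₁.eq_or_eq
    have e2 := h.mid₂.eq_or_eq
    have := h.three_le
    grind

lemma evenBranch (hg : 14 ≤ G.egirth) : G.EvenBranch A w {a, b} := by
  intro B hBA hB hw hp
  have hn := h.nodup hg
  simp only [List.nodup_cons, List.mem_cons, List.not_mem_nil, or_false, not_or] at hn
  have e1 := h.mid₁.eq_or_eq
  have e2 := h.mid₂.eq_or_eq
  refine .two B a b z ?_ ?_ ?_ ?_ ?_ hp <;> grind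

/-- Without `w` the thread is a batch of two with its third place free; the leaf `d` takes it. -/
lemma pairBranch (hg : 14 ≤ G.egirth) : G.PairBranch A w {a, b} := by
  intro B hBA hB hw d hd hdI y hy hp
  have hn := h.nodup hg
  simp only [List.nodup_cons, List.mem_cons, List.not_mem_nil, or_false, not_or] at hn
  have e1 := h.mid₁.eq_or_eq
  have e2 := h.mid₂.eq_or_eq
  refine .three B a b d z y y ?_ ?_ ?_ ?_ ?_ ?_ ?_ ?_ ?_ ?_ <;> grind

end Thread2

namespace Thread4

variable {w a b c d z : V} (h : G.Thread4 A w a b c d z)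

include h

lemma reduced : G.Reduced [z, d, c, b, a, w] :=
  h.mid₄.reduced_cons (h.mid₃.reduced_cons (h.mid₂.reduced_cons h.mid₁.reduced))

lemma nodup (hg : 14 ≤ G.egirth) : [z, d, c, b, a, w].Nodup :=
  h.reduced.nodup (le_trans (by norm_num) hg)

lemma branch (hg : 14 ≤ G.egirth) : G.Branch A w a {a, b, c, d} ∅ := by
  have r1 : G.Reduced [a, w] := .pair h.mid₁.adj_left
  have r2 : G.Reduced [b, a, w] := h.mid₁.reduced
  have r3 : G.Reduced [c, b, a, w] := h.mid₂.reduced_cons r2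
  have r4 : G.Reduced [d, c, b, a, w] := h.mid₃.reduced_cons r3
  refine ⟨?_, ?_, ?_, ?_, Or.inl (by simp)⟩
  · simp only [Finset.insert_subset_iff, Finset.singleton_subset_iff]
    exact ⟨h.mid₁.mem, h.mid₂.mem, h.mid₃.mem, h.mid₄.mem⟩
  · simp only [Finset.mem_insert, Finset.mem_singleton]
    rintro s (rfl | rfl | rfl | rfl)
    · exact branch_eq_some hg r1 rfl (by simp) rfl
    · exact branch_eq_some hg r2 rfl (by simp) rfl
    · exact branch_eq_some hg r3 rfl (by simp) rfl
    · exact branch_eq_some hg r4 rfl (by simp) rfl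
  · simp only [Finset.mem_insert, Finset.mem_singleton]
    rintro s (rfl | rfl | rfl | rfl)
    · exact ⟨_, r1, rfl, by simp, by simp, by simp⟩
    · exact ⟨_, r2, rfl, by simp, by simp, by simp⟩
    · exact ⟨_, r3, rfl, by simp, by simp, by simp⟩
    · exact ⟨_, r4, rfl, by simp, by simp, by simp⟩
  · simp only [Finset.mem_insert, Finset.mem_singleton, not_or]
    have e1 := h.mid₁.eq_or_eq
    have e2 := h.mid₂.eq_or_eq
    have e3 := h.mid₃.eq_or_eq
    have e4 := h.mid₄.eq_or_eq
    have := h.three_le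
    grind

lemma evenBranch (hg : 14 ≤ G.egirth) : G.EvenBranch A w {a, b, c, d} := by
  intro B hBA hB hw hp
  simp only [Finset.insert_subset_iff, Finset.singleton_subset_iff] at hB
  have hn := h.nodup hg
  simp only [List.nodup_cons, List.mem_cons, List.not_mem_nil, or_false, not_or] at hn
  have e1 := h.mid₁.eq_or_eq
  have e2 := h.mid₂.eq_or_eq
  have e3 := h.mid₃.eq_or_eq
  have e4 := h.mid₄.eq_or_eq
  have hS : B \ {a, b, c, d} = (B \ {a, b}) \ {c, d} := by grind
  rw [hS] at hp
  refine .two B a b c ?_ ?_ ?_ ?_ ?_ (.two _ c d z ?_ ?_ ?_ ?_ ?_ hp) <;> grind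

lemma pairBranch (hg : 14 ≤ G.egirth) : G.PairBranch A w {a, b, c, d} := by
  intro B hBA hB hw x hx hxI y hy hp
  simp only [Finset.insert_subset_iff, Finset.singleton_subset_iff] at hB
  simp only [Finset.mem_insert, Finset.mem_singleton, not_or] at hxI
  have hn := h.nodup hg
  simp only [List.nodup_cons, List.mem_cons, List.not_mem_nil, or_false, not_or] at hn
  have e1 := h.mid₁.eq_or_eq
  have e2 := h.mid₂.eq_or_eq
  have e3 := h.mid₃.eq_or_eq
  have e4 := h.mid₄.eq_or_eq
  have hS : B \ ({a, b, c, d} ∪ {x}) = (B \ {a, b, x}) \ {c, d} := by grind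
  rw [hS] at hp
  refine .three B a b x c y y ?_ ?_ ?_ ?_ ?_ ?_ ?_ ?_ ?_ (.two _ c d z ?_ ?_ ?_ ?_ ?_ hp) <;> grind

/-- The batch opens with `c`, whose neighbors `b` and `d` are both inside; each of these has one
neighbor outside. The vertex `w` may still be present. -/
lemma cleanBranch (hg : 14 ≤ G.egirth) : G.CleanBranch A w a {a, b, c, d} := by
  have hn := h.nodup hg
  simp only [List.nodup_cons, List.mem_cons, List.not_mem_nil, or_false, not_or] at hn
  have e1 := h.mid₁.eq_or_eq
  have e2 := h.mid₂.eq_or_eq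
  have e3 := h.mid₃.eq_or_eq
  have e4 := h.mid₄.eq_or_eq
  refine ⟨by simp, by grind, fun B hBA hB hp => ?_⟩
  simp only [Finset.insert_subset_iff, Finset.singleton_subset_iff] at hB
  have hS : B \ ({a, b, c, d} \ {a}) = B \ {c, b, d} := by grind
  rw [hS] at hp
  refine .three B c b d a z z ?_ ?_ ?_ ?_ ?_ ?_ ?_ ?_ ?_ hp <;> grind

lemma dropBranch (hg : 14 ≤ G.egirth) : G.DropBranch A w a b {a, b, c, d} := by
  have hn := h.nodup hg
  simp only [List.nodup_cons, List.mem_cons, List.not_mem_nil, or_false, not_or] at hn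
  have e1 := h.mid₁.eq_or_eq
  have e2 := h.mid₂.eq_or_eq
  have e3 := h.mid₃.eq_or_eq
  have e4 := h.mid₄.eq_or_eq
  refine ⟨by simp, by grind, fun B hBA hB hq hp => ?_⟩
  have hB' : b ∈ B ∧ c ∈ B ∧ d ∈ B := by grind
  clear hB
  have hS : B \ ({a, b, c, d} \ {a}) = B \ {c, b, d} := by grind
  rw [hS] at hp
  refine .three B c b d a z z ?_ ?_ ?_ ?_ ?_ ?_ ?_ ?_ ?_ hp <;> grind

end Thread4

end SimpleGraph

/-! ### Branches through a vertex with threads of 1, 1 and 4 vertices -/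

namespace SimpleGraph

variable {V : Type*} [DecidableEq V] {G : SimpleGraph V} [DecidableRel G.Adj] {A : Finset V}

namespace Star

variable {v b w c y a₁ a₂ a₃ a₄ z : V} (h : G.Star A v b w c y a₁ a₂ a₃ a₄ z)

include h

lemma reduced : G.Reduced [z, a₄, a₃, a₂, a₁, v, b, w] :=
  h.thread_a.mid₄.reduced_cons (h.thread_a.mid₃.reduced_cons (h.thread_a.mid₂.reduced_cons
    (h.thread_a.mid₁.reduced_cons (.cons h.thread_b.mid.symm.reduced h.thread_a.mid₁.adj_left
      h.ne_ba.symm))))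

lemma reduced_c : G.Reduced [c, v, b, w] :=
  .cons h.thread_b.mid.symm.reduced h.thread_c.mid.adj_left h.ne_bc.symm

lemma nodup (hg : 14 ≤ G.egirth) : [z, a₄, a₃, a₂, a₁, v, b, w].Nodup :=
  h.reduced.nodup (le_trans (by norm_num) hg)

lemma notMem (hg : 14 ≤ G.egirth) : [a₄, a₃, a₂, a₁, v, c].Nodup :=
  (Reduced.nodup (h.thread_a.mid₃.reduced_cons (h.thread_a.mid₂.reduced_cons
    (h.thread_a.mid₁.reduced_cons (.cons (.pair h.thread_c.mid.adj_left.symm)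
      h.thread_a.mid₁.adj_left h.ne_ca.symm)))) (le_trans (by norm_num) hg))

/-- The vertex `a₄` alone needs six steps to `w`; it is the reason for the exceptional set in
`Branch`. -/
lemma branch (hg : 14 ≤ G.egirth) : G.Branch A w b {b, v, c, a₁, a₂, a₃, a₄} {a₄} := by
  have r7 := h.reduced.tail
  have r6 := r7.tail
  have r5 := r6.tail
  have r4 := r5.tail
  have r3 := r4.tail
  have r2 := r3.tail
  have rc := h.reduced_c
  refine ⟨?_, ?_, ?_, ?_, Or.inl (by simp)⟩
  · simp only [Finset.insert_subset_iff, Finset.singleton_subset_iff]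
    exact ⟨h.thread_b.mid.mem, h.mem, h.thread_c.mid.mem, h.thread_a.mid₁.mem,
      h.thread_a.mid₂.mem, h.thread_a.mid₃.mem, h.thread_a.mid₄.mem⟩
  · simp only [Finset.mem_insert, Finset.mem_singleton]
    rintro s (rfl | rfl | rfl | rfl | rfl | rfl | rfl)
    · exact branch_eq_some hg r2 rfl (by simp) rfl
    · exact branch_eq_some hg r3 rfl (by simp) rfl
    · exact branch_eq_some hg rc rfl (by simp) rfl
    · exact branch_eq_some hg r4 rfl (by simp) rfl
    · exact branch_eq_some hg r5 rfl (by simp) rfl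
    · exact branch_eq_some hg r6 rfl (by simp) rfl
    · exact branch_eq_some hg r7 rfl (by simp) rfl
  · simp only [Finset.mem_insert, Finset.mem_singleton]
    rintro s (rfl | rfl | rfl | rfl | rfl | rfl | rfl)
    · exact ⟨_, r2, rfl, by simp, by simp, by simp⟩
    · exact ⟨_, r3, rfl, by simp, by simp, by simp⟩
    · exact ⟨_, rc, rfl, by simp, by simp, by simp⟩
    · exact ⟨_, r4, rfl, by simp, by simp, by simp⟩
    · exact ⟨_, r5, rfl, by simp, by simp, by simp⟩
    · exact ⟨_, r6, rfl, by simp, by simp, by simp⟩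
    · exact ⟨_, r7, rfl, by simp, by simp, by simp⟩
  · simp only [Finset.mem_insert, Finset.mem_singleton, not_or]
    have e1 := h.thread_a.mid₁.eq_or_eq
    have e2 := h.thread_a.mid₂.eq_or_eq
    have e3 := h.thread_a.mid₃.eq_or_eq
    have e4 := h.thread_a.mid₄.eq_or_eq
    have e5 := h.thread_b.mid.eq_or_eq
    have e6 := h.thread_c.mid.eq_or_eq
    have e7 := h.eq_or_eq
    have d1 := h.thread_a.three_le
    have d2 := h.thread_b.three_le
    have d3 := h.thread_c.three_le
    rintro s (rfl | rfl | rfl | rfl | rfl | rfl | rfl) u hu ⟨n1, n2, n3, n4, n5, n6, n7⟩ nw hsu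
    · have := e5 u hu hsu; tauto
    · have := e7 u hu hsu; tauto
    · rcases e6 u hu hsu with rfl | rfl <;> tauto
    · have := e1 u hu hsu; tauto
    · have := e2 u hu hsu; tauto
    · have := e3 u hu hsu; tauto
    · rcases e4 u hu hsu with rfl | rfl <;> tauto

/-- The batches are `a₁, a₂, v` and `a₃, a₄, c`. The center `v` comes last in its batch, with `b`
and `c` outside; afterwards `a₃` has only `a₄` left and `c` only `y`. -/
lemma cleanBranch (hg : 14 ≤ G.egirth) : G.CleanBranch A w b {b, v, c, a₁, a₂, a₃, a₄} := by
  have hn := h.nodup hg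
  have hn' := h.notMem hg
  simp only [List.nodup_cons, List.mem_cons, List.not_mem_nil, or_false, not_or] at hn hn'
  have e1 := h.thread_a.mid₁.eq_or_eq
  have e2 := h.thread_a.mid₂.eq_or_eq
  have e3 := h.thread_a.mid₃.eq_or_eq
  have e4 := h.thread_a.mid₄.eq_or_eq
  have e5 := h.thread_b.mid.eq_or_eq
  have e6 := h.thread_c.mid.eq_or_eq
  have e7 := h.eq_or_eq
  have hbc := h.ne_bc
  refine ⟨by simp, fun u hu hbu => ?_, fun B hBA hB hp => ?_⟩
  · rcases e5 u hu hbu with rfl | rfl <;> simp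
  simp only [Finset.insert_subset_iff, Finset.singleton_subset_iff] at hB
  have hS : B \ ({b, v, c, a₁, a₂, a₃, a₄} \ {b}) = (B \ {a₁, a₂, v}) \ {a₃, a₄, c} := by
    ext u
    simp only [Finset.mem_sdiff, Finset.mem_insert, Finset.mem_singleton]
    grind
  rw [hS] at hp
  clear hS
  refine .three B a₁ a₂ v a₃ b c ?_ ?_ ?_ ?_ ?_ ?_ ?_ ?_ ?_
    (.three _ a₃ a₄ c z y y ?_ ?_ ?_ ?_ ?_ ?_ ?_ ?_ ?_ hp) <;> grind

end Star

end SimpleGraph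

/-! ### Kinds of branches -/

namespace SimpleGraph

variable {V : Type*} [DecidableEq V] {G : SimpleGraph V} [DecidableRel G.Adj] {A : Finset V}

lemma Irreducible.mid_or_three_le (hA : G.Irreducible A) {x y : V} (hx : x ∈ A) (hy : y ∈ A)
    (hxy : G.Adj x y) : (∃ z, G.Mid A x y z) ∨ 3 ≤ G.degOn A y := by
  have := hA.two_le_degOn hy
  by_cases h : G.degOn A y = 2
  · exact Or.inl (exists_mid hx hy hxy h)
  · exact Or.inr (by omega)

/-- Three consecutive vertices of degree 2 can be removed unless this creates a leaf at a vertex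
of degree at least 3. -/
lemma Irreducible.false_of_mid_mid_mid (hA : G.Irreducible A) {p a b c q : V} (ha : G.Mid A p a b)
    (hb : G.Mid A a b c) (hc : G.Mid A b c q)
    (hp : 3 ≤ G.degOn A p ∨ ∃ p', G.Mid A p' p a ∧ G.degOn A p' = 2)
    (hq : 3 ≤ G.degOn A q ∨ ∃ q', G.Mid A c q q' ∧ G.degOn A q' = 2) : False := by
  have hn : [q, c, b, a, p].Nodup :=
    (hc.reduced_cons (hb.reduced_cons ha.reduced)).nodup (le_trans (by norm_num) hA.girth)
  simp only [List.nodup_cons, List.mem_cons, List.not_mem_nil, or_false, not_or] at hn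
  have e1 := ha.eq_or_eq
  have e2 := hb.eq_or_eq
  have e3 := hc.eq_or_eq
  -- An end either keeps degree at least 2, or its only remaining neighbor has degree at most 2,
  -- which tameness permits.
  have hside : ∀ s ∈ ({a, b, c} : Finset V), ∀ v, v ∉ ({a, b, c} : Finset V) →
      (∀ s' ∈ ({a, b, c} : Finset V), G.Adj v s' → s' = s) →
      (3 ≤ G.degOn A v ∨ ∃ v', G.Mid A v' v s ∧ G.degOn A v' = 2) →
      G.degOn (A \ {a, b, c}) v = 1 → ∀ y ∈ A, y ∉ ({a, b, c} : Finset V) → G.Adj v y →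
      G.degOn (A \ {a, b, c}) y ≤ 2 := by
    rintro s hs v hv hvs (h3 | ⟨v', hm, h2⟩) h1 y hy hyS hvy
    · have := degOn_le_add_one (G := G) (A := A) (S := {a, b, c}) (x := v)
        fun t ht t' ht' h h' => (hvs t ht h).trans (hvs t' ht' h').symm
      omega
    · rcases hm.eq_or_eq y hy hvy with rfl | rfl
      · exact (degOn_mono Finset.sdiff_subset _).trans h2.le
      · exact absurd hs hyS
  have m1 := ha.mem
  have m2 := hb.mem
  have m3 := hc.mem
  have m4 := ha.left_mem
  have m5 := hc.right_mem
  refine hA.not_peel (.three A b a c p q q ?_ ?_ ?_ ?_ ?_ ?_ ?_ ?_ ?_ (?_ : G.Peel (A \ {b, a, c})))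
  on_goal 10 =>
    rw [Finset.insert_comm]
    refine hA.peel_sdiff ⟨a, by simp, ha.mem⟩ ?_
    rintro v hv hvS ⟨s, hs, hvs⟩
    have hpq : (v = p ∧ s = a) ∨ (v = q ∧ s = c) := by
      have h := hvs.symm
      simp only [Finset.mem_insert, Finset.mem_singleton, not_or] at hs hvS
      rcases hs with rfl | rfl | rfl
      · have := e1 v hv h; tauto
      · have := e2 v hv h; tauto
      · have := e3 v hv h; tauto
    rcases hpq with ⟨rfl, rfl⟩ | ⟨rfl, rfl⟩
    · refine hside s hs v hvS (fun s' hs' h' => ?_) hp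
      have h := h'.symm
      simp only [Finset.mem_insert, Finset.mem_singleton] at hs'
      grind
    · refine hside s hs v hvS (fun s' hs' h' => ?_) ?_
      · have h := h'.symm
        simp only [Finset.mem_insert, Finset.mem_singleton] at hs'
        grind
      · exact hq.imp_right fun ⟨q', h1, h2⟩ => ⟨q', h1.symm, h2⟩
  all_goals grind

/-- The possible kinds of branches at a vertex of degree at least 3. -/
inductive Kind
  | zero | one | two | star | four

/-- The charge that is sent along a branch. -/
def Kind.charge : Kind → ℕ
  | zero => 0
  | one => 1
  | two => 2
  -- One unit for the vertex of degree 2 on the thread and one for the needy vertex at its end.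
  | star => 2
  | four => 4

/-- The branch at `w` that starts with `a` is of the given kind. -/
def HasKind (G : SimpleGraph V) [DecidableRel G.Adj] (A : Finset V) (w a : V) : Kind → Prop
  | .zero => 3 ≤ G.degOn A a
  | .one => ∃ z, G.Thread1 A w a z
  | .two => ∃ b z, G.Thread2 A w a b z
  | .star => ∃ v c y a₁ a₂ a₃ a₄ z, G.Star A v a w c y a₁ a₂ a₃ a₄ z
  | .four => ∃ b c d z, G.Thread4 A w a b c d z

/-- In a thread with three or with at least five vertices, the first three are removable by
`false_of_mid_mid_mid`. -/
lemma Irreducible.exists_hasKind (hA : G.Irreducible A) {w a : V} (hw : w ∈ A) (ha : a ∈ A)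
    (hwa : G.Adj w a) (h3 : 3 ≤ G.degOn A w) : ∃ k, k ≠ .star ∧ G.HasKind A w a k := by
  rcases hA.mid_or_three_le hw ha hwa with ⟨b, m1⟩ | h
  swap
  · exact ⟨.zero, by simp, h⟩
  rcases hA.mid_or_three_le m1.mem m1.right_mem m1.adj_right with ⟨c, m2⟩ | h
  swap
  · exact ⟨.one, by simp, b, m1, h⟩
  rcases hA.mid_or_three_le m2.mem m2.right_mem m2.adj_right with ⟨d, m3⟩ | h
  swap
  · exact ⟨.two, by simp, b, c, m1, m2, h⟩
  rcases hA.mid_or_three_le m3.mem m3.right_mem m3.adj_right with ⟨z, m4⟩ | h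
  swap
  · exact (hA.false_of_mid_mid_mid m1 m2 m3 (Or.inl h3) (Or.inl h)).elim
  rcases hA.mid_or_three_le m4.mem m4.right_mem m4.adj_right with ⟨_, m5⟩ | h
  swap
  · exact ⟨.four, by simp, b, c, d, z, m1, m2, m3, m4, h⟩
  exact (hA.false_of_mid_mid_mid m1 m2 m3 (Or.inl h3) (Or.inr ⟨z, m4, m5.degOn_eq⟩)).elim

lemma Star.thread1 {v b w c y a₁ a₂ a₃ a₄ z : V} (h : G.Star A v b w c y a₁ a₂ a₃ a₄ z) :
    G.Thread1 A w b v := by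
  refine ⟨h.thread_b.mid.symm, ?_⟩
  rw [degOn, ← Finset.card_eq_three.2 ⟨b, c, a₁, h.ne_bc, h.ne_ba, h.ne_ca, rfl⟩]
  refine Finset.card_le_card fun u hu => ?_
  simp only [Finset.mem_insert, Finset.mem_singleton] at hu
  rw [Finset.mem_filter]
  rcases hu with rfl | rfl | rfl
  · exact ⟨h.thread_b.mid.mem, h.thread_b.mid.adj_left.symm⟩
  · exact ⟨h.thread_c.mid.mem, h.thread_c.mid.adj_left.symm⟩
  · exact ⟨h.thread_a.mid₁.mem, h.thread_a.mid₁.adj_left.symm⟩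

namespace HasKind

variable {w a : V}

lemma even {k : Kind} (hk : k = .zero ∨ k = .two ∨ k = .four) (h : G.HasKind A w a k)
    (hg : 14 ≤ G.egirth) : ∃ I, G.Branch A w a I ∅ ∧ G.EvenBranch A w I := by
  rcases hk with rfl | rfl | rfl
  · exact ⟨∅, branch_of_three_le h, evenBranch_empty⟩
  · obtain ⟨b, z, h⟩ := h
    exact ⟨_, h.branch hg, h.evenBranch hg⟩
  · obtain ⟨b, c, d, z, h⟩ := h
    exact ⟨_, h.branch hg, h.evenBranch hg⟩

lemma pair {k : Kind} (hk : k = .two ∨ k = .four) (h : G.HasKind A w a k)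
    (hg : 14 ≤ G.egirth) : ∃ I, G.Branch A w a I ∅ ∧ G.PairBranch A w I := by
  rcases hk with rfl | rfl
  · obtain ⟨b, z, h⟩ := h
    exact ⟨_, h.branch hg, h.pairBranch hg⟩
  · obtain ⟨b, c, d, z, h⟩ := h
    exact ⟨_, h.branch hg, h.pairBranch hg⟩

/-- A star is also a plain 1-thread once the part beyond its degree-3 vertex is ignored. -/
lemma leaf {k : Kind} (hk : k = .one ∨ k = .star) (h : G.HasKind A w a k) :
    ∃ z, G.Thread1 A w a z := by
  rcases hk with rfl | rfl
  · exact h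
  · obtain ⟨v, c, y, a₁, a₂, a₃, a₄, z, h⟩ := h
    exact ⟨v, h.thread1⟩

lemma drop {k : Kind} (hk : k = .one ∨ k = .star ∨ k = .four) (h : G.HasKind A w a k)
    (hg : 14 ≤ G.egirth) : ∃ r I, G.Branch A w a I ∅ ∧ G.DropBranch A w a r I := by
  rcases hk with hk | hk | rfl
  · obtain ⟨z, h⟩ := h.leaf (Or.inl hk)
    exact ⟨_, _, h.branch hg, h.dropBranch⟩
  · obtain ⟨z, h⟩ := h.leaf (Or.inr hk)
    exact ⟨_, _, h.branch hg, h.dropBranch⟩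
  · obtain ⟨b, c, d, z, h⟩ := h
    exact ⟨_, _, h.branch hg, h.dropBranch hg⟩

lemma clean {k : Kind} (hk : k = .star ∨ k = .four) (h : G.HasKind A w a k)
    (hg : 14 ≤ G.egirth) :
    ∃ I E, G.Branch A w a I E ∧ E.card ≤ 1 ∧ G.CleanBranch A w a I := by
  rcases hk with rfl | rfl
  · obtain ⟨v, c, y, a₁, a₂, a₃, a₄, z, h⟩ := h
    exact ⟨_, _, h.branch hg, by simp, h.cleanBranch hg⟩
  · obtain ⟨b, c, d, z, h⟩ := h
    exact ⟨_, _, h.branch hg, by simp, h.cleanBranch hg⟩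

end HasKind

/-- Once `W` is removed, `J` can be peeled off. -/
def PeelableOff (G : SimpleGraph V) (A W J : Finset V) : Prop :=
  ∀ B, B ⊆ A → (∀ u ∈ W, u ∉ B) → J ⊆ B → G.Peel (B \ J) → G.Peel B

lemma PeelableOff.mono {W W' J : Finset V} (h : G.PeelableOff A W J) (hW : W ⊆ W') :
    G.PeelableOff A W' J := fun B hB hWB => h B hB fun u hu => hWB u (hW hu)

lemma PeelableOff.union {W I J : Finset V} (h : G.PeelableOff A W I) (h' : G.PeelableOff A W J)
    (hd : ∀ u ∈ I, u ∉ J) : G.PeelableOff A W (I ∪ J) := by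
  intro B hB hW hJ hp
  rw [Finset.union_subset_iff] at hJ
  refine h B hB hW hJ.1 (h' _ (Finset.sdiff_subset.trans hB) (fun u hu hu' =>
    hW u hu (Finset.sdiff_subset hu')) ?_ ?_)
  · intro u hu
    exact Finset.mem_sdiff.2 ⟨hJ.2 hu, fun h => hd u h hu⟩
  · rwa [sdiff_sdiff, Finset.sup_eq_union]

lemma EvenBranch.peelableOff {w : V} {I W : Finset V} (h : G.EvenBranch A w I) (hw : w ∈ W) :
    G.PeelableOff A W I := fun B hB hW hI => h B hB hI (hW w hw)

lemma PairBranch.peelableOff {w d z : V} {I W : Finset V} (h : G.PairBranch A w I) (hw : w ∈ W)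
    (hd : d ∉ I) (hz : ∀ u ∈ A, u ∉ W → G.Adj d u → u = z) : G.PeelableOff A W (I ∪ {d}) :=
  fun B hB hW hI => h B hB (Finset.union_subset_left hI) (hW w hw) d (hI (by simp)) hd z
    fun u hu => hz u (hB hu) fun h => hW u h hu

/-- Each of the two leaves completes one half of the thread to a batch of three. -/
lemma Thread4.peelableOff {w a b c d z x x' y y' : V} {W : Finset V}
    (h : G.Thread4 A w a b c d z) (hg : 14 ≤ G.egirth) (hw : w ∈ W)
    (hx : x ∉ ({a, b, c, d} : Finset V)) (hy : y ∉ ({a, b, c, d} : Finset V)) (hxy : x ≠ y)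
    (hx' : ∀ u ∈ A, u ∉ W → G.Adj x u → u = x') (hy' : ∀ u ∈ A, u ∉ W → G.Adj y u → u = y') :
    G.PeelableOff A W ({a, b, c, d} ∪ {x, y}) := by
  intro B hBA hW hB hp
  have hwB := hW w hw
  have h1 : ∀ u ∈ B, G.Adj x u → u = x' := fun u hu => hx' u (hBA hu) fun h => hW u h hu
  have h2 : ∀ u ∈ B, G.Adj y u → u = y' := fun u hu => hy' u (hBA hu) fun h => hW u h hu
  clear hW hx' hy' hw
  simp only [Finset.mem_insert, Finset.mem_singleton, not_or] at hx hy
  simp only [Finset.union_subset_iff, Finset.insert_subset_iff, Finset.singleton_subset_iff] at hB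
  have hn := h.nodup hg
  simp only [List.nodup_cons, List.mem_cons, List.not_mem_nil, or_false, not_or] at hn
  have e1 := h.mid₁.eq_or_eq
  have e2 := h.mid₂.eq_or_eq
  have e3 := h.mid₃.eq_or_eq
  have e4 := h.mid₄.eq_or_eq
  have hS : B \ ({a, b, c, d} ∪ {x, y}) = (B \ {a, b, x}) \ {c, d, y} := by
    ext u
    simp only [Finset.mem_sdiff, Finset.mem_insert, Finset.mem_singleton, Finset.mem_union]
    tauto
  rw [hS] at hp
  clear hS
  refine .three B a b x c x' x' ?_ ?_ ?_ ?_ ?_ ?_ ?_ ?_ ?_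
    (.three _ c d y z y' y' ?_ ?_ ?_ ?_ ?_ ?_ ?_ ?_ ?_ hp) <;> grind

end SimpleGraph

/-! ### Reducible vertices -/

namespace SimpleGraph

variable {V : Type*} [DecidableEq V] {G : SimpleGraph V} [DecidableRel G.Adj] {A : Finset V}

namespace Irreducible

/-- After the removal of `T`, the branches `p` and `r` at `w` are removed together with `w`. -/
lemma false_of_clean_drop (hA : G.Irreducible A) {w p r r' q₁ q₂ : V} {Ip Ir J T : Finset V}
    (hw : w ∈ A) (hN : ∀ u ∈ A, u ∉ T → G.Adj w u → u = p ∨ u = r ∨ u = q₁ ∨ u = q₂)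
    (hpr : p ≠ r) (hIp : Ip ⊆ A) (hIr : Ir ⊆ A) (hJ : J ⊆ A)
    (bp : ∀ s ∈ Ip, G.branch w s = some p) (br : ∀ s ∈ Ir, G.branch w s = some r)
    (bT : ∀ s ∈ T ∪ J, ∃ x, G.branch w s = some x ∧ x ≠ p ∧ x ≠ r) (hTJ : ∀ s ∈ T, s ∉ J)
    (cp : G.CleanBranch A w p Ip) (cr : G.DropBranch A w r r' Ir)
    (hT : G.Peel (A \ T) → G.Peel A) (cJ : G.PeelableOff A (insert w T) J)
    (key : G.Peel (A \ (T ∪ insert w (Ip ∪ Ir ∪ J)))) : False := by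
  -- The function `branch w` tells the parts apart and has no value at `w`; this provides the
  -- disjointness used below.
  have hww := branch_self (w := w) hA.girth
  have cp1 := cp.mem
  have cp2 := cp.nbr
  have cr1 := cr.mem
  have cr2 := cr.nbr
  have hpp := G.irrefl (v := p)
  have bT' : ∀ s, s ∈ T ∨ s ∈ J → G.branch w s ≠ none ∧ G.branch w s ≠ some p ∧
      G.branch w s ≠ some r := by
    intro s hs
    obtain ⟨x, hx, h1, h2⟩ := bT s (Finset.mem_union.2 hs)
    rw [hx]
    simp [h1, h2]
  -- The order of removal is `T`, the clean branch except `p`, the batch `p, r, w`, the rest of the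
  -- branch at `r`, then `J`. In the batch `p` has only the neighbor `w`, `r` has at most `r'`
  -- outside, and `w` at most `q₁` and `q₂`.
  have hS : A \ (T ∪ insert w (Ip ∪ Ir ∪ J)) =
      ((((A \ T) \ (Ip \ {p})) \ {p, r, w}) \ (Ir \ {r})) \ J := by
    ext u
    simp only [Finset.mem_sdiff, Finset.mem_insert, Finset.mem_singleton, Finset.mem_union]
    grind
  rw [hS] at key
  clear hS bT
  refine hA.not_peel (hT (cp.peel _ ?_ ?_ (.three _ p r w r' q₁ q₂ ?_ ?_ ?_ ?_ ?_ ?_ ?_ ?_ ?_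
    (cr.peel _ ?_ ?_ ?_ (cJ _ ?_ ?_ ?_ key))))) <;> grind

/-- A 2-thread at `w` is removed together with `w`. -/
lemma false_of_two (hA : G.Irreducible A) {w q q' z p r : V} {J : Finset V} (hw : w ∈ A)
    (hN : ∀ u ∈ A, G.Adj w u → u = q ∨ u = p ∨ u = r) (h : G.Thread2 A w q q' z) (hJ : J ⊆ A)
    (bJ : ∀ s ∈ J, ∃ x, G.branch w s = some x ∧ x ≠ q) (cJ : G.PeelableOff A {w} J)
    (key : G.Peel (A \ insert w ({q, q'} ∪ J))) : False := by
  have hww := branch_self (w := w) hA.girth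
  have bq := (h.branch hA.girth).branch_eq
  have hn := h.nodup hA.girth
  simp only [List.nodup_cons, List.mem_cons, List.not_mem_nil, or_false, not_or] at hn
  have e1 := h.mid₁.eq_or_eq
  have e2 := h.mid₂.eq_or_eq
  have m1 := h.mid₁.mem
  have m2 := h.mid₂.mem
  have bJ' : ∀ s ∈ J, G.branch w s ≠ none ∧ G.branch w s ≠ some q := by
    intro s hs
    obtain ⟨x, hx, h1⟩ := bJ s hs
    rw [hx]
    simp [h1]
  have hS : A \ insert w ({q, q'} ∪ J) = (A \ {q, q', w}) \ J := by
    ext u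
    simp only [Finset.mem_sdiff, Finset.mem_insert, Finset.mem_singleton, Finset.mem_union]
    grind
  rw [hS] at key
  clear hS bJ
  -- The vertex `w` completes the thread to a batch of three and comes last, with `p` and `r`
  -- outside.
  refine hA.not_peel (.three _ q q' w z p r ?_ ?_ ?_ ?_ ?_ ?_ ?_ ?_ ?_ (cJ _ ?_ ?_ ?_ key)) <;> grind

end Irreducible

/-- Two branches at `w` that can be peeled off together once `w` is removed. -/
def PeelablePair (G : SimpleGraph V) [DecidableRel G.Adj] (A : Finset V) (w c d : V) : Prop :=
  ∃ I J, G.Branch A w c I ∅ ∧ G.Branch A w d J ∅ ∧ G.PeelableOff A {w} (I ∪ J)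

lemma Branch.disjoint {w c d : V} {I J E F : Finset V} (h : G.Branch A w c I E)
    (h' : G.Branch A w d J F) (hcd : c ≠ d) : ∀ u ∈ I, u ∉ J := fun u hu hu' => by
  have := h.branch_eq u hu
  rw [h'.branch_eq u hu'] at this
  exact hcd (Option.some.inj this).symm

lemma PeelablePair.symm {w c d : V} (h : G.PeelablePair A w c d) : G.PeelablePair A w d c := by
  obtain ⟨I, J, h1, h2, h3⟩ := h
  exact ⟨J, I, h2, h1, by rwa [Finset.union_comm]⟩

lemma peelablePair_even_even {w c d : V} {k l : Kind} (hg : 14 ≤ G.egirth) (hcd : c ≠ d)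
    (hc : G.HasKind A w c k) (hd : G.HasKind A w d l)
    (hk : k = .zero ∨ k = .two ∨ k = .four) (hl : l = .zero ∨ l = .two ∨ l = .four) :
    G.PeelablePair A w c d := by
  obtain ⟨I, bI, eI⟩ := hc.even hk hg
  obtain ⟨J, bJ, eJ⟩ := hd.even hl hg
  exact ⟨I, J, bI, bJ, (eI.peelableOff (by simp)).union (eJ.peelableOff (by simp))
    (bI.disjoint bJ hcd)⟩

lemma peelablePair_pair_leaf {w c d : V} {k l : Kind} (hg : 14 ≤ G.egirth) (hcd : c ≠ d)
    (hc : G.HasKind A w c k) (hd : G.HasKind A w d l)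
    (hk : k = .two ∨ k = .four) (hl : l = .one ∨ l = .star) :
    G.PeelablePair A w c d := by
  obtain ⟨I, bI, pI⟩ := hc.pair hk hg
  obtain ⟨z, hz⟩ := hd.leaf hl
  refine ⟨I, {d}, bI, hz.branch hg, pI.peelableOff (by simp) (z := z) ?_ ?_⟩
  · exact fun h => bI.disjoint (hz.branch hg) hcd d h (by simp)
  · intro u hu huw hdu
    exact (hz.mid.eq_or_eq u hu hdu).resolve_left (by simpa using huw)

lemma Thread4.symm {w a b c d z : V} (h : G.Thread4 A w a b c d z) (hw : 3 ≤ G.degOn A w) :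
    G.Thread4 A z d c b a w :=
  ⟨h.mid₄.symm, h.mid₃.symm, h.mid₂.symm, h.mid₁.symm, hw⟩

namespace Irreducible

lemma false_of_two_peelablePair (hA : G.Irreducible A) {w q p r : V} (hw : w ∈ A)
    (hN : ∀ u ∈ A, G.Adj w u → u = q ∨ u = p ∨ u = r) (hqp : q ≠ p) (hqr : q ≠ r)
    (h : G.HasKind A w q .two) (hpr : G.PeelablePair A w p r) : False := by
  obtain ⟨q', z, h⟩ := h
  obtain ⟨I, J, bI, bJ, hIJ⟩ := hpr
  refine hA.false_of_two hw hN h (Finset.union_subset bI.subset bJ.subset) ?_ hIJ ?_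
  · intro s hs
    rcases Finset.mem_union.1 hs with hs | hs
    · exact ⟨p, bI.branch_eq s hs, hqp.symm⟩
    · exact ⟨r, bJ.branch_eq s hs, hqr.symm⟩
  · refine hA.peel_branches hw [(q, {q, q'}), (p, I), (r, J)] (E := ∅) ?_ ?_ ?_ (by simp) (by simp)
    · simp only [List.mem_cons, List.not_mem_nil, or_false]
      rintro b (rfl | rfl | rfl)
      exacts [h.branch hA.girth, bI, bJ]
    · simp [or_assoc]
    · simpa [eq_comm] using hN

/-- Four is the largest degree that the batch `p, r, w` of `false_of_clean_drop` can handle: two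
neighbors go with `w`, and two stay outside. -/
lemma false_of_clean_drop_peelablePair (hA : G.Irreducible A) {w a b c d : V} {k l : Kind}
    (hw : w ∈ A) (hN : ∀ u ∈ A, G.Adj w u → u = a ∨ u = b ∨ u = c ∨ u = d)
    (hab : a ≠ b) (hac : a ≠ c) (had : a ≠ d) (hbc : b ≠ c) (hbd : b ≠ d)
    (ha : G.HasKind A w a k) (hb : G.HasKind A w b l) (hk : k = .star ∨ k = .four)
    (hl : l = .one ∨ l = .star ∨ l = .four) (hcd : G.PeelablePair A w c d) : False := by
  have hg := hA.girth
  obtain ⟨Ia, E, ba, hE, ca⟩ := ha.clean hk hg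
  obtain ⟨b', Ib, bb, cb⟩ := hb.drop hl hg
  obtain ⟨I, J, bI, bJ, hIJ⟩ := hcd
  refine hA.false_of_clean_drop (T := ∅) (J := I ∪ J) hw (fun u hu _ => hN u hu) hab ba.subset
    bb.subset (Finset.union_subset bI.subset bJ.subset) ba.branch_eq bb.branch_eq ?_ (by simp)
    ca cb (by simp) (hIJ.mono (by simp)) ?_
  · intro s hs
    simp only [Finset.mem_union, Finset.notMem_empty, false_or] at hs
    rcases hs with hs | hs
    · exact ⟨c, bI.branch_eq s hs, hac.symm, hbc.symm⟩
    · exact ⟨d, bJ.branch_eq s hs, had.symm, hbd.symm⟩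
  · refine hA.peel_branches hw [(a, Ia), (b, Ib), (c, I), (d, J)] (E := E) ?_ ?_ ?_ (by omega)
      (fun e he e' he' hne => absurd (Finset.card_le_one.1 hE e he e' he') hne)
    · simp only [List.mem_cons, List.not_mem_nil, or_false]
      rintro b (rfl | rfl | rfl | rfl)
      exacts [ba, bb.mono (by simp), bI.mono (by simp), bJ.mono (by simp)]
    · simp
    · simpa [eq_comm] using hN

lemma false_of_clean_drop_even (hA : G.Irreducible A) {w p q r : V} {k l m : Kind}
    (hw : w ∈ A) (hN : ∀ u ∈ A, G.Adj w u → u = p ∨ u = q ∨ u = r)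
    (hpq : p ≠ q) (hpr : p ≠ r) (hqr : q ≠ r) (hp : G.HasKind A w p k) (hq : G.HasKind A w q l)
    (hr : G.HasKind A w r m) (hk : k = .star ∨ k = .four)
    (hl : l = .one ∨ l = .star ∨ l = .four) (hm : m = .zero ∨ m = .two ∨ m = .four) : False := by
  have hg := hA.girth
  obtain ⟨Ip, E, bp, hE, cp⟩ := hp.clean hk hg
  obtain ⟨q', Iq, bq, cq⟩ := hq.drop hl hg
  obtain ⟨Ir, br, er⟩ := hr.even hm hg
  refine hA.false_of_clean_drop (T := ∅) (J := Ir) (q₁ := r) (q₂ := r) hw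
    (fun u hu _ h => by have := hN u hu h; tauto) hpq bp.subset
    bq.subset br.subset bp.branch_eq bq.branch_eq ?_ (by simp)
    cp cq (by simp) (er.peelableOff (by simp)) ?_
  · intro s hs
    simp only [Finset.mem_union, Finset.notMem_empty, false_or] at hs
    exact ⟨r, br.branch_eq s hs, hpr.symm, hqr.symm⟩
  · refine hA.peel_branches hw [(p, Ip), (q, Iq), (r, Ir)] (E := E) ?_ ?_ ?_ (by omega)
      (fun e he e' he' hne => absurd (Finset.card_le_one.1 hE e he e' he') hne)
    · simp only [List.mem_cons, List.not_mem_nil, or_false]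
      rintro b (rfl | rfl | rfl)
      exacts [bp, bq.mono (by simp), br.mono (by simp)]
    · simp
    · simpa [eq_comm] using hN

/-- A vertex of degree 3 at which there are two 4-threads. -/
lemma false_of_four_four (hA : G.Irreducible A) {w p q : V} (hw : w ∈ A) (h : G.degOn A w = 3)
    (hpq : p ≠ q) (hwp : G.Adj w p) (hwq : G.Adj w q) (hpA : p ∈ A) (hqA : q ∈ A)
    (hp : G.HasKind A w p .four) (hq : G.HasKind A w q .four) : False := by
  obtain ⟨r, hr⟩ := Finset.card_eq_one.1
    (show (((A.filter (G.Adj w)).erase p).erase q).card = 1 by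
      rw [Finset.card_erase_of_mem (by simp [hqA, hwq, hpq.symm]),
        Finset.card_erase_of_mem (by simp [hpA, hwp])]
      unfold degOn at h
      omega)
  have hr' : ∀ u, (u ≠ q ∧ u ≠ p ∧ u ∈ A ∧ G.Adj w u) ↔ u = r := fun u => by
    simpa using Finset.ext_iff.1 hr u
  obtain ⟨hrq, hrp, hrA, hwr⟩ := (hr' r).2 rfl
  have hN : ∀ u ∈ A, G.Adj w u → u = p ∨ u = q ∨ u = r := fun u hu hwu => by
    have := hr' u
    tauto
  obtain ⟨k, hk, hkr⟩ := hA.exists_hasKind hw hrA hwr (by omega)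
  -- A third branch with one vertex becomes the dropped branch, and one of the 4-threads serves as
  -- the even one; any other third branch is itself even.
  by_cases hk' : k = .one
  · exact hA.false_of_clean_drop_even (p := p) (q := r) (r := q) hw
      (fun u hu hwu => by have := hN u hu hwu; tauto) hrp.symm hpq hrq hp hkr hq
      (by simp) (by simp [hk']) (by simp)
  · refine hA.false_of_clean_drop_even (p := p) (q := q) (r := r) hw hN hpq hrp.symm hrq.symm
      hp hq hkr (by simp) (by simp) ?_
    cases k <;> simp_all

end Irreducible

/-- Without `w` and the rest of its branch, `q` is isolated. -/
lemma CleanBranch.peelableOff {w q : V} {I : Finset V} (h : G.CleanBranch A w q I) :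
    G.PeelableOff A (insert w (I \ {q})) {q} := by
  intro B hB hW hq hp
  refine .one B q (by simpa using hq) (fun u hu hqu => ?_) hp
  have hu' : u ∉ insert w (I \ {q}) := fun h => hW u h hu
  simp only [Finset.mem_insert, Finset.mem_sdiff, Finset.mem_singleton, not_or, not_and,
    not_not] at hu'
  rcases h.nbr u (hB hu) hqu with rfl | h1
  · exact hu'.1 rfl
  · exact hqu.ne (hu'.2 h1).symm

lemma CleanBranch.peelableOff_leaf {w q d z : V} {I : Finset V} (h : G.CleanBranch A w q I)
    (hd : G.Thread1 A w d z) (hqd : q ≠ d) :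
    G.PeelableOff A (insert w (I \ {q})) {q, d} := by
  intro B hB hW hq hp
  refine .two B q d z (hq (by simp)) (hq (by simp)) hqd (fun u hu hqu => ?_) (fun u hu hdu => ?_) hp
  all_goals
    have hu' : u ∉ insert w (I \ {q}) := fun h => hW u h hu
    simp only [Finset.mem_insert, Finset.mem_sdiff, Finset.mem_singleton, not_or, not_and,
      not_not] at hu'
  · rcases h.nbr u (hB hu) hqu with rfl | h1
    · exact absurd rfl hu'.1
    · exact absurd (hu'.2 h1).symm hqu.ne
  · exact Or.inr ((hd.mid.eq_or_eq u (hB hu) hdu).resolve_left hu'.1)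

namespace Irreducible

/-- A vertex of degree 3 at which there are three 1-threads, two of which end at stars. -/
lemma false_of_star_star (hA : G.Irreducible A) {w p q r : V} {k : Kind} (hw : w ∈ A)
    (hN : ∀ u ∈ A, G.Adj w u → u = p ∨ u = q ∨ u = r)
    (hpq : p ≠ q) (hpr : p ≠ r) (hqr : q ≠ r) (hp : G.HasKind A w p .star)
    (hq : G.HasKind A w q .star) (hr : G.HasKind A w r k) (hk : k = .one ∨ k = .star) :
    False := by
  have hg := hA.girth
  obtain ⟨s, hs⟩ := hr.leaf hk
  obtain ⟨v, c, y, a₁, a₂, a₃, a₄, z, sp⟩ := hp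
  obtain ⟨v', c', y', a₁', a₂', a₃', a₄', z', sq⟩ := hq
  have bp := sp.branch hg
  have bq := sq.branch hg
  have cp := sp.cleanBranch hg
  have cq := sq.cleanBranch hg
  have tp := sp.thread_a
  have tq := sq.thread_a
  have hv := sp.thread1.three_le
  have hv' := sq.thread1.three_le
  have h3 : a₃ ≠ a₃' := fun h => bp.disjoint bq hpq a₃ (by simp) (by simp [h])
  have h4 : a₄ ≠ a₄' := fun h => bp.disjoint bq hpq a₄ (by simp) (by simp [h])
  clear sp sq
  generalize ({p, v, c, a₁, a₂, a₃, a₄} : Finset V) = Ip at *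
  generalize ({q, v', c', a₁', a₂', a₃', a₄'} : Finset V) = Iq at *
  have hqI := cq.mem
  have hIq : Iq \ {q} ∪ {q} = Iq := by
    rw [Finset.sdiff_union_of_subset]; simpa using hqI
  -- The star at `p` is the clean branch and the 1-thread at `r` the dropped one. The star at `q` is
  -- peeled off beforehand except for `q`, which goes last.
  refine hA.false_of_clean_drop (T := Iq \ {q}) (J := {q}) (q₁ := q) (q₂ := q) hw
    (fun u hu _ h => by have := hN u hu h; tauto) hpr bp.subset (hs.branch hg).subset
    (by simpa using bq.subset hqI) bp.branch_eq (hs.branch hg).branch_eq ?_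
    (fun s hs => (Finset.mem_sdiff.1 hs).2) cp hs.dropBranch
    (cq.peel A subset_rfl bq.subset) cq.peelableOff ?_
  · intro s hs
    rw [hIq] at hs
    exact ⟨q, bq.branch_eq s hs, hpq.symm, hqr⟩
  · refine hA.peel_branches hw [(p, Ip), (q, Iq), (r, {r})] (E := {a₄, a₄'}) ?_ ?_ ?_
      Finset.card_le_two ?_
    · simp only [List.mem_cons, List.not_mem_nil, or_false]
      rintro b (rfl | rfl | rfl)
      exacts [bp.mono (by simp), bq.mono (by simp), (hs.branch hg).mono (by simp)]
    · intro u
      rw [← hIq]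
      simp only [Finset.mem_union, Finset.mem_insert, Finset.mem_sdiff, Finset.mem_singleton,
        List.mem_cons, List.not_mem_nil, or_false, exists_eq_or_imp, exists_eq_left]
      tauto
    · simpa [eq_comm] using hN
    -- The vertices `a₄` and `a₄'` could lie on a 14-cycle with `w`. Their common neighbor is then
    -- the far end of both 4-threads, and `false_of_four_four` excludes degree 3.
    · have key : ∀ u ∈ A, G.Adj u a₄ → G.Adj u a₄' → 4 ≤ G.degOn A u := by
        intro u hu h1 h2
        have d1 := tp.mid₃.degOn_eq
        have d2 := tq.mid₃.degOn_eq
        have l1 := tp.three_le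
        have l2 := tq.three_le
        have hz : u = z ∧ u = z' := by
          rcases tp.mid₄.eq_or_eq u hu h1.symm with rfl | rfl <;>
            rcases tq.mid₄.eq_or_eq _ hu h2.symm with rfl | rfl
          · exact absurd rfl h3
          · omega
          · omega
          · exact ⟨rfl, rfl⟩
        obtain ⟨rfl, rfl⟩ := hz
        by_contra hlt
        exact hA.false_of_four_four hu (by omega) h4 h1 h2 tp.mid₄.mem tq.mid₄.mem
          ⟨_, _, _, _, tp.symm hv⟩ ⟨_, _, _, _, tq.symm hv'⟩
      simp only [Finset.mem_insert, Finset.mem_singleton]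
      rintro e (rfl | rfl) e' (rfl | rfl) hne u hu h1 h2
      · exact absurd rfl hne
      · exact key u hu h1 h2
      · exact key u hu h2 h1
      · exact absurd rfl hne

/-- A vertex of degree 4 at which there are two 4-threads, a 1-thread that ends at a star, and
another 1-thread. -/
lemma false_of_four_four_star (hA : G.Irreducible A) {w a b c d : V} {k : Kind} (hw : w ∈ A)
    (hN : ∀ u ∈ A, G.Adj w u → u = a ∨ u = b ∨ u = c ∨ u = d)
    (hab : a ≠ b) (hac : a ≠ c) (had : a ≠ d) (hbc : b ≠ c) (hbd : b ≠ d) (hcd : c ≠ d)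
    (ha : G.HasKind A w a .four) (hb : G.HasKind A w b .four) (hc : G.HasKind A w c .star)
    (hd : G.HasKind A w d k) (hk : k = .one ∨ k = .star) : False := by
  have hg := hA.girth
  obtain ⟨Ia, ba, ca⟩ : ∃ I, G.Branch A w a I ∅ ∧ G.CleanBranch A w a I := by
    obtain ⟨a₂, a₃, a₄, a₅, ha⟩ := ha
    exact ⟨_, ha.branch hg, ha.cleanBranch hg⟩
  obtain ⟨b', Ib, bb, cb⟩ := hb.drop (by simp) hg
  obtain ⟨I, E, bI, hE, cI⟩ := hc.clean (by simp) hg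
  obtain ⟨z, hz⟩ := hd.leaf hk
  have hI : I \ {c} ∪ {c, d} = I ∪ {d} := by
    ext u
    have := cI.mem
    simp only [Finset.mem_union, Finset.mem_insert, Finset.mem_sdiff, Finset.mem_singleton]
    grind
  have hdI : d ∉ I := fun h => bI.disjoint (hz.branch hg) hcd d h (by simp)
  -- The star at `c` is peeled off first except for `c`. At the end `c` is isolated and `d` is a
  -- leaf, which makes a batch of two.
  refine hA.false_of_clean_drop (T := I \ {c}) (J := {c, d}) (q₁ := c) (q₂ := d) hw
    (fun u hu _ h => hN u hu h) hab ba.subset bb.subset ?_ ba.branch_eq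
    bb.branch_eq ?_ ?_ ca cb (cI.peel A subset_rfl bI.subset)
    (cI.peelableOff_leaf hz hcd) ?_
  · simp only [Finset.insert_subset_iff, Finset.singleton_subset_iff]
    exact ⟨bI.subset cI.mem, hz.mid.mem⟩
  · intro s hs
    rw [hI, Finset.mem_union, Finset.mem_singleton] at hs
    rcases hs with hs | rfl
    · exact ⟨c, bI.branch_eq s hs, hac.symm, hbc.symm⟩
    · exact ⟨s, (hz.branch hg).branch_eq s (by simp), had.symm, hbd.symm⟩
  · simp only [Finset.mem_insert, Finset.mem_sdiff, Finset.mem_singleton]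
    grind
  · refine hA.peel_branches hw [(a, Ia), (b, Ib), (c, I), (d, {d})] (E := E) ?_ ?_ ?_
      (by omega) (fun e he e' he' hne => absurd (Finset.card_le_one.1 hE e he e' he') hne)
    · simp only [List.mem_cons, List.not_mem_nil, or_false]
      rintro b (rfl | rfl | rfl | rfl)
      exacts [ba.mono (by simp), bb.mono (by simp), bI, (hz.branch hg).mono (by simp)]
    · intro u
      have := Finset.ext_iff.1 hI u
      simp only [Finset.mem_union, List.mem_cons, List.not_mem_nil, or_false, exists_eq_or_imp,
        exists_eq_left] at this ⊢
      rw [Finset.mem_insert, Finset.mem_union, Finset.mem_union]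
      clear * - this
      tauto
    · simpa [eq_comm] using hN

end Irreducible

/-- The batch around the middle vertex `b` frees `w` of the neighbor `a`, at the price of a leaf `d`
to be absorbed later. -/
lemma Thread4.peel_of_sdiff {w a b c d z : V} {B : Finset V} (h : G.Thread4 A w a b c d z)
    (hg : 14 ≤ G.egirth) (hBA : B ⊆ A) (hB : {a, b, c} ⊆ B) (hp : G.Peel (B \ {a, b, c})) :
    G.Peel B := by
  have hn := h.nodup hg
  simp only [List.nodup_cons, List.mem_cons, List.not_mem_nil, or_false, not_or] at hn
  simp only [Finset.insert_subset_iff, Finset.singleton_subset_iff] at hB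
  have e1 := h.mid₁.eq_or_eq
  have e2 := h.mid₂.eq_or_eq
  have e3 := h.mid₃.eq_or_eq
  rw [Finset.insert_comm] at hp
  refine .three B b a c w d d ?_ ?_ ?_ ?_ ?_ ?_ ?_ ?_ ?_ hp <;> grind

namespace Irreducible

/-- A vertex of degree 5 at which there are three 4-threads, such that the last vertex of one of
them can be peeled off together with the other two branches. -/
lemma false_of_degree_five (hA : G.Irreducible A) {w a a₂ a₃ a₄ z b c d e : V} {I J : Finset V}
    (hw : w ∈ A) (hN : ∀ u ∈ A, G.Adj w u → u = a ∨ u = b ∨ u = c ∨ u = d ∨ u = e)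
    (hab : a ≠ b) (hac : a ≠ c) (hbc : b ≠ c) (hbd : b ≠ d) (hbe : b ≠ e)
    (hcd : c ≠ d) (hce : c ≠ e) (had : a ≠ d) (hae : a ≠ e)
    (ha : G.Thread4 A w a a₂ a₃ a₄ z) (hb : G.HasKind A w b .four) (hc : G.HasKind A w c .four)
    (bI : G.Branch A w d I ∅) (bJ : G.Branch A w e J ∅)
    (hIJ : G.PeelableOff A {w, a, a₂, a₃} (I ∪ {a₄} ∪ J)) : False := by
  have hg := hA.girth
  obtain ⟨Ib, E, bb, hE, cb⟩ := hb.clean (by simp) hg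
  obtain ⟨c', Ic, bc, cc⟩ := hc.drop (by simp) hg
  have ba := ha.branch hg
  have hd1 := ba.disjoint bI had
  have hd2 := ba.disjoint bJ hae
  have hn := ha.nodup hg
  simp only [List.nodup_cons, List.mem_cons, List.not_mem_nil, or_false, not_or] at hn
  simp only [Finset.mem_insert, Finset.mem_singleton, forall_eq_or_imp, forall_eq] at hd1 hd2
  have hsub := ba.subset
  simp only [Finset.insert_subset_iff, Finset.singleton_subset_iff] at hsub
  -- Five neighbors are one too many for the batch at `w`; opening the thread at `a` first leaves
  -- four, and `hIJ` disposes of the leaf `a₄`.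
  refine hA.false_of_clean_drop (T := {a, a₂, a₃}) (J := I ∪ {a₄} ∪ J) (q₁ := d) (q₂ := e) hw
    (fun u hu hT h => ?_) hbc bb.subset bc.subset ?_ bb.branch_eq bc.branch_eq ?_ ?_
    cb cc (ha.peel_of_sdiff hg subset_rfl ?_) hIJ ?_
  · have := hN u hu h
    simp only [Finset.mem_insert, Finset.mem_singleton, not_or] at hT
    tauto
  · simp only [Finset.union_subset_iff, Finset.singleton_subset_iff]
    exact ⟨⟨bI.subset, hsub.2.2.2⟩, bJ.subset⟩
  · intro s hs
    have : s ∈ ({a, a₂, a₃, a₄} : Finset V) ∨ s ∈ I ∨ s ∈ J := by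
      simp only [Finset.mem_union, Finset.mem_insert, Finset.mem_singleton] at hs ⊢
      clear * - hs
      tauto
    rcases this with hs | hs | hs
    · exact ⟨a, ba.branch_eq s hs, hab, hac⟩
    · exact ⟨d, bI.branch_eq s hs, hbd.symm, hcd.symm⟩
    · exact ⟨e, bJ.branch_eq s hs, hbe.symm, hce.symm⟩
  · simp only [Finset.mem_insert, Finset.mem_singleton, Finset.mem_union, not_or]
    clear * - hd1 hd2 hn
    rintro s (rfl | rfl | rfl) <;> tauto
  · simp only [Finset.insert_subset_iff, Finset.singleton_subset_iff]
    exact ⟨hsub.1, hsub.2.1, hsub.2.2.1⟩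
  · refine hA.peel_branches hw [(a, {a, a₂, a₃, a₄}), (b, Ib), (c, Ic), (d, I), (e, J)] (E := E)
      ?_ ?_ ?_
      (by omega) (fun e he e' he' hne => absurd (Finset.card_le_one.1 hE e he e' he') hne)
    · simp only [List.mem_cons, List.not_mem_nil, or_false]
      rintro b (rfl | rfl | rfl | rfl | rfl)
      exacts [ba.mono (by simp), bb, bc.mono (by simp), bI.mono (by simp), bJ.mono (by simp)]
    · intro u
      simp only [Finset.mem_union, List.mem_cons, List.not_mem_nil, or_false, exists_eq_or_imp,
        exists_eq_left, Finset.mem_insert, Finset.mem_singleton]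
      clear * -
      tauto
    · simpa [eq_comm] using hN

/-- A vertex of degree 5 at which there are four 4-threads. -/
lemma false_of_four_four_four_four (hA : G.Irreducible A) {w a b c d e : V} {k : Kind}
    (hw : w ∈ A) (hN : ∀ u ∈ A, G.Adj w u → u = a ∨ u = b ∨ u = c ∨ u = d ∨ u = e)
    (hab : a ≠ b) (hac : a ≠ c) (hbc : b ≠ c) (hbd : b ≠ d) (hbe : b ≠ e)
    (hcd : c ≠ d) (hce : c ≠ e) (had : a ≠ d) (hae : a ≠ e) (hde : d ≠ e)
    (ha : G.HasKind A w a .four) (hb : G.HasKind A w b .four) (hc : G.HasKind A w c .four)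
    (hd : G.HasKind A w d .four) (he : G.HasKind A w e k) : False := by
  have hg := hA.girth
  obtain ⟨a₂, a₃, a₄, z, ha⟩ := ha
  obtain ⟨d₂, d₃, d₄, y, hd⟩ := hd
  have had4 : a₄ ∉ ({d, d₂, d₃, d₄} : Finset V) :=
    (ha.branch hg).disjoint (hd.branch hg) had a₄ (by simp)
  have ha4 : ∀ u ∈ A, u ∉ ({w, a, a₂, a₃} : Finset V) → G.Adj a₄ u → u = z := by
    intro u hu h h'
    rcases ha.mid₄.eq_or_eq u hu h' with rfl | rfl
    · simp at h
    · rfl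
  -- The leaf `a₄` goes with the 4-thread at `d`. An even branch at `e` goes alone; otherwise `e` is
  -- a second leaf, and the same 4-thread absorbs both.
  by_cases hk : k = .zero ∨ k = .two ∨ k = .four
  · obtain ⟨J, bJ, eJ⟩ := he.even hk hg
    refine hA.false_of_degree_five hw hN hab hac hbc hbd hbe hcd hce had hae ha hb hc
      (hd.branch hg) bJ (((hd.pairBranch hg).peelableOff (by simp) had4 ha4).union
      (eJ.peelableOff (by simp)) ?_)
    intro u hu
    rw [Finset.mem_union, Finset.mem_singleton] at hu
    rcases hu with hu | rfl
    · exact (hd.branch hg).disjoint bJ hde u hu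
    · exact (ha.branch hg).disjoint bJ hae u (by simp)
  · obtain ⟨x, hx⟩ := he.leaf (by cases k <;> simp_all)
    refine hA.false_of_degree_five hw hN hab hac hbc hbd hbe hcd hce had hae ha hb hc
      (hd.branch hg) (hx.branch hg) ?_
    rw [Finset.union_assoc, show ({a₄} ∪ {e} : Finset V) = {a₄, e} from rfl]
    refine hd.peelableOff hg (by simp) had4 ?_ ?_ ha4 (y' := x) ?_
    · exact (hx.branch hg).disjoint (hd.branch hg) hde.symm e (by simp)
    · rintro rfl
      exact (ha.branch hg).disjoint (hx.branch hg) hae a₄ (by simp) (by simp)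
    · intro u hu h h'
      refine (hx.mid.eq_or_eq u hu h').resolve_left ?_
      rintro rfl
      simp at h

/-- A vertex of degree 6 at which there are six 4-threads. -/
lemma false_of_degree_six (hA : G.Irreducible A) {w a b c d e f : V} (hw : w ∈ A)
    (hN : ∀ u ∈ A, G.Adj w u → u = a ∨ u = b ∨ u = c ∨ u = d ∨ u = e ∨ u = f)
    (hn : [a, b, c, d, e, f].Nodup)
    (ha : G.HasKind A w a .four) (hb : G.HasKind A w b .four) (hc : G.HasKind A w c .four)
    (hd : G.HasKind A w d .four) (he : G.HasKind A w e .four) (hf : G.HasKind A w f .four) :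
    False := by
  have hg := hA.girth
  simp only [List.nodup_cons, List.mem_cons, List.not_mem_nil, or_false, not_or] at hn
  obtain ⟨⟨hab, hac, had, hae, haf⟩, ⟨hbc, hbd, hbe, hbf⟩, ⟨hcd, hce, hcf⟩, ⟨hde, hdf⟩, hef, -⟩ := hn
  obtain ⟨a₂, a₃, a₄, z, ha⟩ := ha
  obtain ⟨b₂, b₃, b₄, y, hb⟩ := hb
  obtain ⟨Ic, E, bc, hE, cc⟩ := hc.clean (by simp) hg
  obtain ⟨d', Id, bd, cd⟩ := hd.drop (by simp) hg
  obtain ⟨Ie, be, pe⟩ := he.pair (by simp) hg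
  obtain ⟨If, bf, pf⟩ := hf.pair (by simp) hg
  have ba := ha.branch hg
  have bb := hb.branch hg
  have ha4 : ∀ u ∈ A, u ∉ insert w ({a, a₂, a₃} ∪ {b, b₂, b₃} : Finset V) → G.Adj a₄ u →
      u = z := by
    intro u hu h h'
    rcases ha.mid₄.eq_or_eq u hu h' with rfl | rfl
    · simp at h
    · rfl
  have hb4 : ∀ u ∈ A, u ∉ insert w ({a, a₂, a₃} ∪ {b, b₂, b₃} : Finset V) → G.Adj b₄ u →
      u = y := by
    intro u hu h h'
    rcases hb.mid₄.eq_or_eq u hu h' with rfl | rfl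
    · simp at h
    · rfl
  have hd1 := ba.disjoint be hae
  have hd2 := ba.disjoint bf haf
  have hd3 := bb.disjoint be hbe
  have hd4 := bb.disjoint bf hbf
  have hd5 := ba.disjoint bb hab
  have hd6 := be.disjoint bf hef
  have hna := ha.nodup hg
  have hnb := hb.nodup hg
  simp only [List.nodup_cons, List.mem_cons, List.not_mem_nil, or_false, not_or] at hna hnb
  have hsa := ba.subset
  have hsb := bb.subset
  have hba := ba.branch_eq
  have hbb := bb.branch_eq
  simp only [Finset.insert_subset_iff, Finset.singleton_subset_iff] at hsa hsb
  -- Two threads are opened first, which leaves `w` with four neighbors. The leaf `a₄` is absorbed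
  -- by the branch at `e`, and `b₄` by the one at `f`.
  refine hA.false_of_clean_drop (T := {a, a₂, a₃} ∪ {b, b₂, b₃}) (J := Ie ∪ {a₄} ∪ (If ∪ {b₄}))
    (q₁ := e) (q₂ := f) hw
    (fun u hu hT h => ?_) hcd bc.subset bd.subset ?_ bc.branch_eq bd.branch_eq ?_ ?_
    cc cd (fun h => ha.peel_of_sdiff hg subset_rfl ?_
      (hb.peel_of_sdiff hg Finset.sdiff_subset ?_ ?_))
    ((pe.peelableOff (by simp) ?_ ha4).union (pf.peelableOff (by simp) ?_ hb4) ?_) ?_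
  · have := hN u hu h
    simp only [Finset.mem_union, Finset.mem_insert, Finset.mem_singleton, not_or] at hT
    tauto
  · simp only [Finset.union_subset_iff, Finset.singleton_subset_iff]
    exact ⟨⟨be.subset, hsa.2.2.2⟩, bf.subset, hsb.2.2.2⟩
  · intro s hs
    have : s ∈ ({a, a₂, a₃, a₄} : Finset V) ∨ s ∈ ({b, b₂, b₃, b₄} : Finset V) ∨
        s ∈ Ie ∨ s ∈ If := by
      simp only [Finset.mem_union, Finset.mem_insert, Finset.mem_singleton] at hs ⊢
      clear * - hs
      tauto
    rcases this with hs | hs | hs | hs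
    · exact ⟨a, hba s hs, hac, had⟩
    · exact ⟨b, hbb s hs, hbc, hbd⟩
    · exact ⟨e, be.branch_eq s hs, Ne.symm hce, Ne.symm hde⟩
    · exact ⟨f, bf.branch_eq s hs, Ne.symm hcf, Ne.symm hdf⟩
  · simp only [Finset.mem_insert, Finset.mem_singleton, Finset.mem_union, not_or, forall_eq_or_imp,
      forall_eq] at hd1 hd2 hd3 hd4 hd5 ⊢
    clear * - hd1 hd2 hd3 hd4 hd5 hna hnb
    rintro s ((rfl | rfl | rfl) | (rfl | rfl | rfl)) <;> grind
  · simp only [Finset.insert_subset_iff, Finset.singleton_subset_iff]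
    exact ⟨hsa.1, hsa.2.1, hsa.2.2.1⟩
  · simp only [Finset.mem_insert, Finset.mem_singleton, forall_eq_or_imp, not_or,
      forall_eq] at hd5
    simp only [Finset.insert_subset_iff, Finset.singleton_subset_iff, Finset.mem_sdiff,
      Finset.mem_insert, Finset.mem_singleton]
    clear * - hd5 hsb
    grind
  · rwa [sdiff_sdiff, Finset.sup_eq_union]
  · exact hd1 a₄ (by simp)
  · exact hd4 b₄ (by simp)
  · intro u hu
    simp only [Finset.mem_union, Finset.mem_singleton, not_or] at hu ⊢
    rcases hu with hu | rfl
    · exact ⟨hd6 u hu, fun h => hd3 b₄ (by simp) (h ▸ hu)⟩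
    · exact ⟨hd2 _ (by simp), fun h => hd5 u (by simp) (by simp [h])⟩
  · refine hA.peel_branches hw [(a, {a, a₂, a₃, a₄}), (b, {b, b₂, b₃, b₄}), (c, Ic), (d, Id),
      (e, Ie), (f, If)] (E := E) ?_ ?_ ?_
      (by omega) (fun e he e' he' hne => absurd (Finset.card_le_one.1 hE e he e' he') hne)
    · simp only [List.mem_cons, List.not_mem_nil, or_false]
      rintro b (rfl | rfl | rfl | rfl | rfl | rfl)
      exacts [ba.mono (by simp), bb.mono (by simp), bc, bd.mono (by simp), be.mono (by simp),
        bf.mono (by simp)]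
    · intro u
      simp only [Finset.mem_union, List.mem_cons, List.not_mem_nil, or_false, exists_eq_or_imp,
        exists_eq_left, Finset.mem_insert, Finset.mem_singleton]
      clear * -
      grind
    · simpa [eq_comm] using hN

end Irreducible

end SimpleGraph

/-! ### The charge of a vertex -/

namespace SimpleGraph

variable {V : Type*} [DecidableEq V] {G : SimpleGraph V} [DecidableRel G.Adj] {A : Finset V}

/-- The kinds of branches at a vertex of degree 3, in a suitable order, that do not occur. -/
def Kind.Reducible (x y z : Kind) : Prop :=
  ((x = .star ∨ x = .four) ∧ (y = .one ∨ y = .star ∨ y = .four) ∧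
      (z = .zero ∨ z = .two ∨ z = .four)) ∨
    (x = .two ∧ (y = .zero ∨ y = .two ∨ y = .four) ∧ (z = .zero ∨ z = .two ∨ z = .four)) ∨
    (x = .two ∧ (y = .two ∨ y = .four) ∧ (z = .one ∨ z = .star)) ∨
    (x = .star ∧ y = .star ∧ (z = .one ∨ z = .star))

/-- The budget of degree 3 is `6 * 3 - 14 = 4`. Of the triples above it, only two 1-threads with a
4-thread evade the reductions. -/
lemma Kind.reducible_or (x y z : Kind) (h : 5 ≤ x.charge + y.charge + z.charge) :
    (Reducible x y z ∨ Reducible x z y ∨ Reducible y x z ∨ Reducible y z x ∨ Reducible z x y ∨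
      Reducible z y x) ∨
    (x = .four ∧ y = .one ∧ z = .one) ∨ (x = .one ∧ y = .four ∧ z = .one) ∨
      (x = .one ∧ y = .one ∧ z = .four) := by
  cases x <;> cases y <;> cases z <;> simp [charge] at h <;> simp [Reducible]

/-- A vertex of degree 3 at which there are two threads with one vertex and a thread with four
vertices. -/
def Bad (G : SimpleGraph V) [DecidableRel G.Adj] (A : Finset V) (v : V) : Prop :=
  ∃ b w c y a₁ a₂ a₃ a₄ z, G.Star A v b w c y a₁ a₂ a₃ a₄ z

namespace Irreducible

lemma false_of_reducible (hA : G.Irreducible A) {w p q r : V} {k l m : Kind}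
    (hw : w ∈ A) (hN : ∀ u ∈ A, G.Adj w u → u = p ∨ u = q ∨ u = r)
    (hpq : p ≠ q) (hpr : p ≠ r) (hqr : q ≠ r) (hp : G.HasKind A w p k) (hq : G.HasKind A w q l)
    (hr : G.HasKind A w r m) (h : Kind.Reducible k l m) : False := by
  rcases h with ⟨hk, hl, hm⟩ | ⟨rfl, hl, hm⟩ | ⟨rfl, hl, hm⟩ | ⟨rfl, rfl, hm⟩
  · exact hA.false_of_clean_drop_even hw hN hpq hpr hqr hp hq hr hk hl hm
  · exact hA.false_of_two_peelablePair hw hN hpq hpr hp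
      (peelablePair_even_even hA.girth hqr hq hr hl hm)
  · exact hA.false_of_two_peelablePair hw hN hpq hpr hp
      (peelablePair_pair_leaf hA.girth hqr hq hr hl hm)
  · exact hA.false_of_star_star hw hN hpq hpr hqr hp hq hr hm

lemma bad_of_hasKind {w p q r : V} (hw : w ∈ A)
    (hN : ∀ u ∈ A, G.Adj w u → u = p ∨ u = q ∨ u = r)
    (hpq : p ≠ q) (hpr : p ≠ r) (hqr : q ≠ r) (hp : G.HasKind A w p .one)
    (hq : G.HasKind A w q .one) (hr : G.HasKind A w r .four) : G.Bad A w := by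
  obtain ⟨x, hp⟩ := hp
  obtain ⟨y, hq⟩ := hq
  obtain ⟨b, c, d, z, hr⟩ := hr
  exact ⟨p, x, q, y, r, b, c, d, z, hw, hp, hq, hr, hpq, hpr, hqr, hN⟩

lemma charge_of_three (hA : G.Irreducible A) {w : V} (hw : w ∈ A) (h3 : G.degOn A w = 3)
    {κ : V → Kind} (hκ : ∀ u ∈ A, G.Adj w u → G.HasKind A w u (κ u)) :
    ∑ u ∈ A.filter (G.Adj w), (κ u).charge ≤ 4 ∨
      (G.Bad A w ∧ ∑ u ∈ A.filter (G.Adj w), (κ u).charge = 6) := by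
  obtain ⟨p, q, r, hpq, hpr, hqr, h⟩ := Finset.card_eq_three.1 h3
  have hmem : ∀ u, (u ∈ A ∧ G.Adj w u) ↔ u = p ∨ u = q ∨ u = r := fun u => by
    rw [← Finset.mem_filter, h]
    simp
  have hN : ∀ u ∈ A, G.Adj w u → u = p ∨ u = q ∨ u = r := fun u h1 h2 => (hmem u).1 ⟨h1, h2⟩
  have hκ' : ∀ u, u = p ∨ u = q ∨ u = r → G.HasKind A w u (κ u) := fun u hu =>
    hκ u ((hmem u).2 hu).1 ((hmem u).2 hu).2
  have hp := hκ' p (by simp)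
  have hq := hκ' q (by simp)
  have hr := hκ' r (by simp)
  rw [h, Finset.sum_insert (by simp [hpq, hpr]), Finset.sum_pair hqr]
  by_cases hlt : (κ p).charge + ((κ q).charge + (κ r).charge) ≤ 4
  · exact Or.inl hlt
  right
  rcases Kind.reducible_or (κ p) (κ q) (κ r) (by omega) with h | h
  · exfalso
    rcases h with h | h | h | h | h | h
    · exact hA.false_of_reducible hw hN hpq hpr hqr hp hq hr h
    · exact hA.false_of_reducible hw (fun u h h' => by have := hN u h h'; tauto)
        hpr hpq hqr.symm hp hr hq h
    · exact hA.false_of_reducible hw (fun u h h' => by have := hN u h h'; tauto)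
        hpq.symm hqr hpr hq hp hr h
    · exact hA.false_of_reducible hw (fun u h h' => by have := hN u h h'; tauto)
        hqr hpq.symm hpr.symm hq hr hp h
    · exact hA.false_of_reducible hw (fun u h h' => by have := hN u h h'; tauto)
        hpr.symm hqr.symm hpq hr hp hq h
    · exact hA.false_of_reducible hw (fun u h h' => by have := hN u h h'; tauto)
        hqr.symm hpr.symm hpq.symm hr hq hp h
  · rcases h with ⟨h1, h2, h3⟩ | ⟨h1, h2, h3⟩ | ⟨h1, h2, h3⟩ <;> rw [h1] at hp ⊢ <;>
      rw [h2] at hq ⊢ <;> rw [h3] at hr ⊢ <;> refine ⟨?_, rfl⟩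
    · exact bad_of_hasKind hw (fun u h h' => by have := hN u h h'; tauto)
        hqr hpq.symm hpr.symm hq hr hp
    · exact bad_of_hasKind hw (fun u h h' => by have := hN u h h'; tauto)
        hpr hpq hqr.symm hp hr hq
    · exact bad_of_hasKind hw hN hpq hpr hqr hp hq hr

/-- The budget of degree 4 is 10, of which the two 4-threads take 8. A remainder above 2 is a
peelable pair or a star together with another leaf. -/
lemma charge_of_four_four (hA : G.Irreducible A) {w a b c d : V} (hw : w ∈ A)
    (hN : ∀ u ∈ A, G.Adj w u → u = a ∨ u = b ∨ u = c ∨ u = d) {k l : Kind}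
    (hab : a ≠ b) (hac : a ≠ c) (had : a ≠ d) (hbc : b ≠ c) (hbd : b ≠ d) (hcd : c ≠ d)
    (ha : G.HasKind A w a .four) (hb : G.HasKind A w b .four) (hc : G.HasKind A w c k)
    (hd : G.HasKind A w d l) : k.charge + l.charge ≤ 2 := by
  by_contra hlt
  have h : ((k = .zero ∨ k = .two ∨ k = .four) ∧ (l = .zero ∨ l = .two ∨ l = .four)) ∨
      ((k = .two ∨ k = .four) ∧ (l = .one ∨ l = .star)) ∨
      ((l = .two ∨ l = .four) ∧ (k = .one ∨ k = .star)) ∨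
      (k = .star ∧ (l = .one ∨ l = .star)) ∨ (l = .star ∧ (k = .one ∨ k = .star)) := by
    cases k <;> cases l <;> simp [Kind.charge] at hlt <;> simp
  have key : ¬ G.PeelablePair A w c d := fun h => hA.false_of_clean_drop_peelablePair hw hN hab hac
    had hbc hbd ha hb (by simp) (by simp) h
  have hg := hA.girth
  rcases h with ⟨h1, h2⟩ | ⟨h1, h2⟩ | ⟨h1, h2⟩ | ⟨rfl, h2⟩ | ⟨rfl, h2⟩
  · exact key (peelablePair_even_even hg hcd hc hd h1 h2)
  · exact key (peelablePair_pair_leaf hg hcd hc hd h1 h2)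
  · exact key (peelablePair_pair_leaf hg hcd.symm hd hc h1 h2).symm
  · exact hA.false_of_four_four_star hw hN hab hac had hbc hbd hcd ha hb hc hd h2
  · exact hA.false_of_four_four_star hw (fun u h h' => by have := hN u h h'; tauto)
      hab had hac hbd hbc hcd.symm ha hb hd hc h2

/-- Only 4-threads carry more than 2, so exceeding `6 * d - 14` takes at least two of them for `d =
4`, four for `d = 5` and six for `d = 6`. For `d ≥ 7` even `4 * d` is within the budget. -/
lemma charge_of_four_le (hA : G.Irreducible A) {w : V} (hw : w ∈ A) (h4 : 4 ≤ G.degOn A w)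
    {κ : V → Kind} (hκ : ∀ u ∈ A, G.Adj w u → G.HasKind A w u (κ u)) :
    ∑ u ∈ A.filter (G.Adj w), (κ u).charge + 14 ≤ 6 * G.degOn A w := by
  classical
  by_contra hlt
  set N := A.filter (G.Adj w) with hNdef
  have hd : G.degOn A w = N.card := rfl
  rw [hd] at h4 hlt
  have hκ' : ∀ u ∈ N, G.HasKind A w u (κ u) := fun u hu =>
    hκ u (Finset.mem_filter.1 hu).1 (Finset.mem_filter.1 hu).2
  have hmem : ∀ u ∈ A, G.Adj w u → u ∈ N := fun u h h' => Finset.mem_filter.2 ⟨h, h'⟩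
  set F := N.filter fun u => κ u = .four with hF
  have hFsub : F ⊆ N := Finset.filter_subset _ _
  have hle : ∑ u ∈ N, (κ u).charge ≤ 2 * N.card + 2 * F.card := by
    refine (Finset.sum_le_sum (g := fun u => 2 + if κ u = .four then 2 else 0)
      fun u _ => ?_).trans_eq ?_
    · cases h : κ u <;> simp [Kind.charge]
    · rw [Finset.sum_add_distrib, Finset.sum_const, ← Finset.sum_filter, ← hF, Finset.sum_const,
        smul_eq_mul, smul_eq_mul, mul_comm, mul_comm 2 F.card]
  have hF4 : ∀ u ∈ F, G.HasKind A w u .four := fun u hu => by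
    have := hκ' u (hFsub hu)
    rwa [(Finset.mem_filter.1 hu).2] at this
  have hFN := Finset.card_le_card hFsub
  have hcase : N.card = 4 ∨ N.card = 5 ∨ N.card = 6 := by omega
  rcases hcase with h | h | h
  · obtain ⟨F', hF', hc⟩ := Finset.exists_subset_card_eq (show 2 ≤ F.card by omega)
    have hc' : (N \ F').card = 2 := by
      rw [Finset.card_sdiff_of_subset (hF'.trans hFsub)]; omega
    obtain ⟨a, b, hab, rfl⟩ := Finset.card_eq_two.1 hc
    obtain ⟨c, d, hcd, hcd'⟩ := Finset.card_eq_two.1 hc'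
    have hu : ∀ u, (u ∈ N ∧ u ≠ a ∧ u ≠ b) ↔ u = c ∨ u = d := fun u => by
      simpa using Finset.ext_iff.1 hcd' u
    have hc1 := (hu c).2 (by simp)
    have hd1 := (hu d).2 (by simp)
    have ha := hF4 a (hF' (by simp))
    have hb := hF4 b (hF' (by simp))
    have key := hA.charge_of_four_four hw (fun u h h' => by
      have := hu u; have := hmem u h h'; tauto) hab hc1.2.1.symm hd1.2.1.symm hc1.2.2.symm
      hd1.2.2.symm hcd ha hb (hκ' c hc1.1) (hκ' d hd1.1)
    rw [← Finset.sum_sdiff (hF'.trans hFsub), hcd', Finset.sum_pair hcd, Finset.sum_pair hab,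
      (Finset.mem_filter.1 (hF' (Finset.mem_insert_self a {b}))).2,
      (Finset.mem_filter.1 (hF' (Finset.mem_insert_of_mem (Finset.mem_singleton_self b)))).2] at hlt
    simp only [Kind.charge] at hlt key
    omega
  · obtain ⟨F', hF', hc⟩ := Finset.exists_subset_card_eq (show 4 ≤ F.card by omega)
    have hc' : (N \ F').card = 1 := by
      rw [Finset.card_sdiff_of_subset (hF'.trans hFsub)]; omega
    obtain ⟨e, he⟩ := Finset.card_eq_one.1 hc'
    obtain ⟨F'', hF'', hc''⟩ := Finset.exists_subset_card_eq (show 2 ≤ F'.card by omega)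
    have hc3 : (F' \ F'').card = 2 := by
      rw [Finset.card_sdiff_of_subset hF'']; omega
    obtain ⟨a, b, hab, rfl⟩ := Finset.card_eq_two.1 hc''
    obtain ⟨c, d, hcd, hcd'⟩ := Finset.card_eq_two.1 hc3
    have hu : ∀ u, (u ∈ N ∧ u ∉ F') ↔ u = e := fun u => by
      simpa using Finset.ext_iff.1 he u
    have hu' : ∀ u, (u ∈ F' ∧ u ≠ a ∧ u ≠ b) ↔ u = c ∨ u = d := fun u => by
      simpa using Finset.ext_iff.1 hcd' u
    have he1 := (hu e).2 rfl
    have hc1 := (hu' c).2 (by simp)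
    have hd1 := (hu' d).2 (by simp)
    have ha1 : a ∈ F' := hF'' (by simp)
    have hb1 : b ∈ F' := hF'' (by simp)
    have hne : ∀ u ∈ F', u ≠ e := fun u hu h => he1.2 (h ▸ hu)
    exact hA.false_of_four_four_four_four hw (fun u h h' => by
      have := hu u; have := hu' u; have := hmem u h h'; tauto)
      hab hc1.2.1.symm hc1.2.2.symm hd1.2.2.symm (hne b hb1) hcd (hne c hc1.1) hd1.2.1.symm
      (hne a ha1) (hne d hd1.1) (hF4 a (hF' ha1)) (hF4 b (hF' hb1)) (hF4 c (hF' hc1.1))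
      (hF4 d (hF' hd1.1)) (hκ' e he1.1)
  · have hFN' : F = N := Finset.eq_of_subset_of_card_le hFsub (by omega)
    rw [hFN'] at hF4
    have hlen := N.length_toList
    have hnd := N.nodup_toList
    have hl : ∀ u, u ∈ N.toList ↔ u ∈ N := fun u => Finset.mem_toList
    rw [h] at hlen
    match hlist : N.toList, hlen with
    | [a, b, c, d, e, f], _ =>
      rw [hlist] at hnd hl
      refine hA.false_of_degree_six hw (fun u h h' => ?_) hnd (hF4 a ?_) (hF4 b ?_) (hF4 c ?_)
        (hF4 d ?_) (hF4 e ?_) (hF4 f ?_)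
      · simpa using (hl u).2 (hmem u h h')
      all_goals exact (hl _).1 (by simp)

end Irreducible

end SimpleGraph

/-! ### Discharging -/

namespace SimpleGraph

variable {V : Type*} [DecidableEq V] (G : SimpleGraph V) [DecidableRel G.Adj] (A : Finset V)

/-- The number of consecutive vertices of degree 2 on the way from `x` via `y`, up to `k`. -/
def threadLength : ℕ → V → V → ℕ
  | 0, _, _ => 0
  | k + 1, x, y => if G.degOn A y = 2 then
      1 + ∑ z ∈ (A.filter (G.Adj y)).erase x, threadLength k y z else 0

variable {G A}

lemma threadLength_of_ne {y : V} (h : G.degOn A y ≠ 2) (k : ℕ) (x : V) :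
    G.threadLength A k x y = 0 := by
  cases k <;> simp [threadLength, h]

lemma Mid.filter_eq {x y z : V} (h : G.Mid A x y z) : A.filter (G.Adj y) = {x, z} := by
  ext u
  simp only [Finset.mem_filter, Finset.mem_insert, Finset.mem_singleton]
  refine ⟨fun hu => h.eq_or_eq u hu.1 hu.2, ?_⟩
  rintro (rfl | rfl)
  · exact ⟨h.left_mem, h.adj_left⟩
  · exact ⟨h.right_mem, h.adj_right⟩

lemma Mid.threadLength_succ {x y z : V} (h : G.Mid A x y z) (k : ℕ) :
    G.threadLength A (k + 1) x y = 1 + G.threadLength A k y z := by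
  rw [threadLength, if_pos h.degOn_eq, h.filter_eq, Finset.erase_insert (by simpa using h.ne),
    Finset.sum_singleton]

lemma HasKind.threadLength_eq {w a : V} {k : Kind} (h : G.HasKind A w a k) (hk : k ≠ .star) :
    G.threadLength A 6 w a = k.charge := by
  cases k with
  | zero => exact threadLength_of_ne (ne_of_gt h) _ _
  | one =>
    obtain ⟨z, h⟩ := h
    rw [h.mid.threadLength_succ, threadLength_of_ne (ne_of_gt h.three_le)]
    rfl
  | two =>
    obtain ⟨b, z, h⟩ := h
    rw [h.mid₁.threadLength_succ, h.mid₂.threadLength_succ,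
      threadLength_of_ne (ne_of_gt h.three_le)]
    rfl
  | star => exact absurd rfl hk
  | four =>
    obtain ⟨b, c, d, z, h⟩ := h
    rw [h.mid₁.threadLength_succ, h.mid₂.threadLength_succ, h.mid₃.threadLength_succ,
      h.mid₄.threadLength_succ, threadLength_of_ne (ne_of_gt h.three_le)]
    rfl

lemma Star.symm {v b w c y a₁ a₂ a₃ a₄ z : V} (h : G.Star A v b w c y a₁ a₂ a₃ a₄ z) :
    G.Star A v c y b w a₁ a₂ a₃ a₄ z :=
  ⟨h.mem, h.thread_c, h.thread_b, h.thread_a, h.ne_bc.symm, h.ne_ca, h.ne_ba,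
    fun u hu hvu => by have := h.eq_or_eq u hu hvu; tauto⟩

lemma hasKind_star {w u v : V} (h3 : 3 ≤ G.degOn A w) (h : G.Mid A w u v) (hv : G.Bad A v) :
    G.HasKind A w u .star := by
  have aux : ∀ {b w' c y a₁ a₂ a₃ a₄ z}, G.Star A v b w' c y a₁ a₂ a₃ a₄ z → u = b →
      G.HasKind A w u .star := by
    rintro b w' c y a₁ a₂ a₃ a₄ z hs rfl
    have : w = w' := (hs.thread_b.mid.eq_or_eq w h.left_mem h.adj_left).resolve_left h.ne
    subst this
    exact ⟨_, _, _, _, _, _, _, _, hs⟩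
  obtain ⟨b, w', c, y, a₁, a₂, a₃, a₄, z, hs⟩ := hv
  rcases hs.eq_or_eq u h.mem h.adj_right.symm with hu | hu | rfl
  · exact aux hs hu
  · exact aux hs.symm hu
  · have : w = a₂ := (hs.thread_a.mid₁.eq_or_eq w h.left_mem h.adj_left).resolve_left h.ne
    subst this
    have := hs.thread_a.mid₂.degOn_eq
    omega

namespace Irreducible

/-- Of seven consecutive vertices of degree 2 the middle three are removable, so counting beyond six
changes nothing. -/
lemma threadLength_stable (hA : G.Irreducible A) {x y : V} (hx : x ∈ A) (hy : y ∈ A)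
    (hxy : G.Adj x y) : G.threadLength A 7 x y = G.threadLength A 6 x y := by
  have aux : ∀ {u v : V} {k : ℕ}, 3 ≤ G.degOn A v →
      G.threadLength A (k + 1) u v = G.threadLength A k u v := fun h => by
    rw [threadLength_of_ne (by omega), threadLength_of_ne (by omega)]
  rcases hA.mid_or_three_le hx hy hxy with ⟨y₂, m₁⟩ | h
  swap
  · exact aux h
  rw [m₁.threadLength_succ, m₁.threadLength_succ, Nat.add_left_cancel_iff]
  rcases hA.mid_or_three_le m₁.mem m₁.right_mem m₁.adj_right with ⟨y₃, m₂⟩ | h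
  swap
  · exact aux h
  rw [m₂.threadLength_succ, m₂.threadLength_succ, Nat.add_left_cancel_iff]
  rcases hA.mid_or_three_le m₂.mem m₂.right_mem m₂.adj_right with ⟨y₄, m₃⟩ | h
  swap
  · exact aux h
  rw [m₃.threadLength_succ, m₃.threadLength_succ, Nat.add_left_cancel_iff]
  rcases hA.mid_or_three_le m₃.mem m₃.right_mem m₃.adj_right with ⟨y₅, m₄⟩ | h
  swap
  · exact aux h
  rw [m₄.threadLength_succ, m₄.threadLength_succ, Nat.add_left_cancel_iff]
  rcases hA.mid_or_three_le m₄.mem m₄.right_mem m₄.adj_right with ⟨y₆, m₅⟩ | h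
  swap
  · exact aux h
  rw [m₅.threadLength_succ, m₅.threadLength_succ, Nat.add_left_cancel_iff]
  rcases hA.mid_or_three_le m₅.mem m₅.right_mem m₅.adj_right with ⟨y₇, m₆⟩ | h
  swap
  · exact aux h
  rw [m₆.threadLength_succ, m₆.threadLength_succ, Nat.add_left_cancel_iff]
  rcases hA.mid_or_three_le m₆.mem m₆.right_mem m₆.adj_right with ⟨y₈, m₇⟩ | h
  swap
  · exact aux h
  exact (hA.false_of_mid_mid_mid m₃ m₄ m₅ (Or.inr ⟨_, m₂, m₁.degOn_eq⟩)
    (Or.inr ⟨_, m₆, m₇.degOn_eq⟩)).elim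

open Classical in
lemma exists_kind (hA : G.Irreducible A) {w u : V} (hw : w ∈ A) (hu : u ∈ A) (hwu : G.Adj w u)
    (h3 : 3 ≤ G.degOn A w) : ∃ k, G.HasKind A w u k ∧ k.charge =
      G.threadLength A 6 w u + if ∃ v, G.Mid A w u v ∧ G.Bad A v then 1 else 0 := by
  by_cases h : ∃ v, G.Mid A w u v ∧ G.Bad A v
  · obtain ⟨v, hm, hv⟩ := h
    have hk := hasKind_star h3 hm hv
    refine ⟨.star, hk, ?_⟩
    obtain ⟨z, h1⟩ := hk.leaf (Or.inr rfl)
    have h2 : G.HasKind A w u .one := ⟨z, h1⟩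
    rw [if_pos ⟨v, hm, hv⟩, h2.threadLength_eq (by simp)]
    rfl
  · obtain ⟨k, hk, h1⟩ := hA.exists_hasKind hw hu hwu h3
    exact ⟨k, h1, by rw [if_neg h, h1.threadLength_eq hk, add_zero]⟩

-- This says that the final charge is nonnegative: `w` owns `6 deg - 14`, pays for the vertices on
-- its threads and for the bad ends of its 1-threads, and is repaid 2 if it is bad.
open Classical in
lemma charge_le (hA : G.Irreducible A) {w : V} (hw : w ∈ A) (h3 : 3 ≤ G.degOn A w) :
    (∑ u ∈ A.filter (G.Adj w), G.threadLength A 6 w u) +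
      ((A.filter (G.Adj w)).filter fun u => ∃ v, G.Mid A w u v ∧ G.Bad A v).card + 14 ≤
      6 * G.degOn A w + 2 * if G.Bad A w then 1 else 0 := by
  have hex : ∀ u, ∃ k, u ∈ A → G.Adj w u → G.HasKind A w u k ∧ k.charge =
      G.threadLength A 6 w u + if ∃ v, G.Mid A w u v ∧ G.Bad A v then 1 else 0 := fun u => by
    by_cases h : u ∈ A ∧ G.Adj w u
    · obtain ⟨k, hk⟩ := hA.exists_kind hw h.1 h.2 h3
      exact ⟨k, fun _ _ => hk⟩
    · exact ⟨.zero, fun h1 h2 => absurd ⟨h1, h2⟩ h⟩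
  choose κ hκ using hex
  have hsum : ∑ u ∈ A.filter (G.Adj w), (κ u).charge =
      (∑ u ∈ A.filter (G.Adj w), G.threadLength A 6 w u) +
      ((A.filter (G.Adj w)).filter fun u => ∃ v, G.Mid A w u v ∧ G.Bad A v).card := by
    rw [Finset.card_filter, ← Finset.sum_add_distrib]
    refine Finset.sum_congr rfl fun u hu => ?_
    exact (hκ u (Finset.mem_filter.1 hu).1 (Finset.mem_filter.1 hu).2).2
  rw [← hsum]
  by_cases h4 : 4 ≤ G.degOn A w
  · have := hA.charge_of_four_le hw h4 fun u h1 h2 => (hκ u h1 h2).1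
    omega
  · have h3' : G.degOn A w = 3 := by omega
    rcases hA.charge_of_three hw h3' fun u h1 h2 => (hκ u h1 h2).1 with h | ⟨hb, h⟩
    · omega
    · rw [if_pos hb]
      omega

-- A bad vertex is repaid along each of its two 1-threads. A pair of far end and thread vertex
-- determines the bad vertex, so no payment counts twice.
open Classical in
lemma card_bad_le : 2 * (A.filter fun v => G.Bad A v).card ≤
    ∑ w ∈ A.filter (fun w => 3 ≤ G.degOn A w),
      ((A.filter (G.Adj w)).filter fun u => ∃ v, G.Mid A w u v ∧ G.Bad A v).card := by
  rw [← Finset.card_sigma]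
  let Q : V → Finset (Σ _ : V, V) := fun v =>
    ((A.filter fun w => 3 ≤ G.degOn A w).sigma fun w => A.filter (G.Adj w)).filter
      fun p => G.Mid A p.1 p.2 v
  have hQ : ∀ v w u, (⟨w, u⟩ : Σ _ : V, V) ∈ Q v ↔ 3 ≤ G.degOn A w ∧ G.Mid A w u v := by
    intro v w u
    simp only [Q, Finset.mem_filter, Finset.mem_sigma]
    exact ⟨fun h => ⟨h.1.1.2, h.2⟩, fun h =>
      ⟨⟨⟨h.2.left_mem, h.1⟩, h.2.mem, h.2.adj_left.symm⟩, h.2⟩⟩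
  have hdisj : Set.PairwiseDisjoint (A.filter fun v => G.Bad A v : Finset V) Q := by
    intro v _ v' _ hne
    rw [Function.onFun, Finset.disjoint_left]
    rintro ⟨w, u⟩ h h'
    rw [hQ] at h h'
    rcases h.2.eq_or_eq v' h'.2.right_mem h'.2.adj_right with h1 | h1
    · exact h'.2.ne h1.symm
    · exact hne h1.symm
  have hcard : ∀ v ∈ A.filter (fun v => G.Bad A v), 2 ≤ (Q v).card := by
    intro v hv
    obtain ⟨b, w, c, y, a₁, a₂, a₃, a₄, z, hs⟩ := (Finset.mem_filter.1 hv).2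
    refine Finset.one_lt_card.2 ⟨⟨w, b⟩, (hQ _ _ _).2 ⟨hs.thread_b.three_le, hs.thread_b.mid.symm⟩,
      ⟨y, c⟩, (hQ _ _ _).2 ⟨hs.thread_c.three_le, hs.thread_c.mid.symm⟩, fun h => hs.ne_bc ?_⟩
    simpa using (Sigma.mk.inj_iff.1 h).2
  calc 2 * (A.filter fun v => G.Bad A v).card
      = ∑ v ∈ A.filter (fun v => G.Bad A v), 2 := by rw [Finset.sum_const, smul_eq_mul, mul_comm]
    _ ≤ ∑ v ∈ A.filter (fun v => G.Bad A v), (Q v).card := Finset.sum_le_sum hcard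
    _ = ((A.filter fun v => G.Bad A v).biUnion Q).card := (Finset.card_biUnion hdisj).symm
    _ ≤ _ := by
      refine Finset.card_le_card fun p hp => ?_
      obtain ⟨v, hv, hp⟩ := Finset.mem_biUnion.1 hp
      obtain ⟨w, u⟩ := p
      rw [hQ] at hp
      simp only [Finset.mem_sigma, Finset.mem_filter]
      exact ⟨⟨hp.2.left_mem, hp.1⟩, ⟨hp.2.mem, hp.2.adj_left.symm⟩, v, hp.2,
        (Finset.mem_filter.1 hv).2⟩

/-- One step of the recursion, from 7 to 6, moves a dart into a degree-2 vertex to the dart that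
continues it. Cancelling the darts that leave degree-2 vertices shows that vertices of degree at
least 3 pay exactly 2 per degree-2 vertex. -/
lemma sum_threadLength (hA : G.Irreducible A) :
    ∑ x ∈ A, ∑ y ∈ A.filter (G.Adj x), G.threadLength A 6 x y =
      ∑ y ∈ A.filter (fun y => G.degOn A y = 2),
        (2 + ∑ z ∈ A.filter (G.Adj y), G.threadLength A 6 y z) := by
  calc _ = ∑ x ∈ A, ∑ y ∈ A.filter (G.Adj x), G.threadLength A 7 x y :=
        Finset.sum_congr rfl fun x hx => Finset.sum_congr rfl fun y hy =>
          (hA.threadLength_stable hx (Finset.mem_filter.1 hy).1 (Finset.mem_filter.1 hy).2).symm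
    _ = ∑ y ∈ A, ∑ x ∈ A.filter (G.Adj y), G.threadLength A 7 x y :=
        Finset.sum_comm' fun x y => by
          simp only [Finset.mem_filter, G.adj_comm x y]
          tauto
    _ = _ := by
      rw [Finset.sum_filter]
      refine Finset.sum_congr rfl fun y hy => ?_
      split_ifs with h
      · obtain ⟨p, q, hpq, hN⟩ := Finset.card_eq_two.1 h
        rw [hN, Finset.sum_pair hpq, Finset.sum_pair hpq, threadLength, threadLength, if_pos h,
          if_pos h, hN, Finset.erase_insert (by simpa using hpq), Finset.sum_singleton,
          Finset.pair_comm, Finset.erase_insert (by simpa using hpq.symm), Finset.sum_singleton]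
        ring
      · exact Finset.sum_eq_zero fun x _ => threadLength_of_ne h _ _

/-- An irreducible set of vertices has average degree at least `7 / 3`. -/
lemma card_le (hA : G.Irreducible A) : 14 * A.card ≤ 6 * ∑ x ∈ A, G.degOn A x := by
  classical
  have hsplit : ∀ f : V → ℕ, ∑ x ∈ A, f x = ∑ x ∈ A.filter (fun y => G.degOn A y = 2), f x +
      ∑ x ∈ A.filter (fun y => 3 ≤ G.degOn A y), f x := fun f => by
    rw [← Finset.sum_filter_add_sum_filter_not A (fun y => G.degOn A y = 2)]
    congr 2
    refine Finset.filter_congr fun x hx => ?_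
    have := hA.two_le_degOn hx
    omega
  have h1 := hA.sum_threadLength
  rw [hsplit, Finset.sum_add_distrib, Finset.sum_const, smul_eq_mul] at h1
  have h2 := card_bad_le (G := G) (A := A)
  have h3 := Finset.sum_le_sum fun w (hw : w ∈ A.filter (fun y => 3 ≤ G.degOn A y)) =>
    hA.charge_le (Finset.mem_filter.1 hw).1 (Finset.mem_filter.1 hw).2
  rw [Finset.sum_add_distrib, Finset.sum_add_distrib, Finset.sum_add_distrib, Finset.sum_const,
    smul_eq_mul, ← Finset.mul_sum, ← Finset.mul_sum, ← Finset.card_filter] at h3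
  have h4 : ((A.filter (fun y => 3 ≤ G.degOn A y)).filter fun v => G.Bad A v).card ≤
      (A.filter fun v => G.Bad A v).card :=
    Finset.card_le_card (Finset.filter_subset_filter _ (Finset.filter_subset _ _))
  have h5 : ∑ x ∈ A.filter (fun y => G.degOn A y = 2), G.degOn A x =
      (A.filter (fun y => G.degOn A y = 2)).card * 2 := by
    rw [← smul_eq_mul, ← Finset.sum_const]
    exact Finset.sum_congr rfl fun x hx => (Finset.mem_filter.1 hx).2
  have h6 := hsplit fun _ => 1
  have h7 := hsplit (G.degOn A)
  simp only [Finset.sum_const, smul_eq_mul, mul_one] at h6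
  omega

end Irreducible

end SimpleGraph

/-! ### Peeling off planar graphs -/

/-- A drawing restricts to induced subgraphs. -/
def PlaneDrawing.comap {V W : Type*} {G : SimpleGraph V} (D : PlaneDrawing G) (f : W ↪ V) :
    PlaneDrawing (G.comap f) where
  point := D.point ∘ f
  arc e := D.arc (e.map f)
  point_injective := D.point_injective.comp f.injective
  isPolygonalArc_arc u v h := D.isPolygonalArc_arc (f u) (f v) h
  mem_of_point_mem_arc e he w hw := by
    induction e with
    | _ u v =>
    have := D.mem_of_point_mem_arc s(f u, f v) he (f w) hw
    simpa using this
  arc_inter_arc e he e' he' hne x hx hx' := by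
    have hne' : e.map f ≠ e'.map f := fun h => hne (Sym2.map.injective f.injective h)
    induction e with
    | _ u v =>
    induction e' with
    | _ u' v' =>
    obtain ⟨w, hw, hw', rfl⟩ := D.arc_inter_arc s(f u, f v) he s(f u', f v') he' hne' x hx hx'
    rw [Sym2.mem_iff] at hw hw'
    rcases hw with rfl | rfl
    · exact ⟨u, by simp, by simpa using hw', rfl⟩
    · exact ⟨v, by simp, by simpa using hw', rfl⟩

namespace SimpleGraph

variable {V : Type*} [DecidableEq V] {G : SimpleGraph V} [DecidableRel G.Adj] {A : Finset V}

lemma degree_comap_subtype [Fintype ↥A] (x : A)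
    [Fintype ((G.comap (Function.Embedding.subtype (· ∈ A))).neighborSet x)] :
    (G.comap (Function.Embedding.subtype (· ∈ A))).degree x = G.degOn A x := by
  rw [← card_neighborFinset_eq_degree, degOn,
    ← Finset.card_map (Function.Embedding.subtype (· ∈ A))]
  congr 1
  ext u
  simp only [Finset.mem_map, mem_neighborFinset, comap_adj, Finset.mem_filter,
    Function.Embedding.subtype_apply]
  constructor
  · rintro ⟨v, hv, rfl⟩
    exact ⟨v.2, hv⟩
  · exact fun h => ⟨⟨u, h.1⟩, h.2, rfl⟩

/-- Irreducible sets of vertices do not occur in planar graphs. -/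
lemma Irreducible.false_of_planeDrawing (hA : G.Irreducible A) (D : PlaneDrawing G) : False := by
  classical
  have hne : A.Nonempty := by
    rw [Finset.nonempty_iff_ne_empty]
    rintro rfl
    exact hA.not_peel .empty
  have : Nonempty A := hne.to_subtype
  have hg : (14 : ℕ∞) ≤ (G.comap (Function.Embedding.subtype (· ∈ A))).egirth :=
    hA.girth.trans (IsContained.egirth_le ⟨(Embedding.comap _ G).toCopy⟩)
  have hdeg : ∀ u v, (G.comap (Function.Embedding.subtype (· ∈ A))).Adj u v →
      ∃ w, (G.comap (Function.Embedding.subtype (· ∈ A))).Adj v w ∧ w ≠ u := by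
    intro u v huv
    obtain ⟨w, hw, hne⟩ := Finset.exists_mem_ne (s := A.filter (G.Adj v))
      (hA.two_le_degOn v.2) u
    rw [Finset.mem_filter] at hw
    exact ⟨⟨w, hw.1⟩, hw.2, fun h => hne (congrArg Subtype.val h)⟩
  have key : 14 * ((G.comap (Function.Embedding.subtype (· ∈ A))).edgeFinset.card + 1) ≤
      2 * (G.comap (Function.Embedding.subtype (· ∈ A))).edgeFinset.card + 14 * A.card := by
    have := (D.comap (Function.Embedding.subtype (· ∈ A))).girth_mul_le hdeg (g := 14)
      (by exact_mod_cast hg)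
    rw [Fintype.card_coe] at this
    convert this
  have hsum := (G.comap (Function.Embedding.subtype (· ∈ A))).sum_degrees_eq_twice_card_edges
  simp only [degree_comap_subtype] at hsum
  rw [Finset.sum_coe_sort A (G.degOn A)] at hsum
  -- Planarity gives `12 |E| + 14 ≤ 14 |A|`, and discharging gives `14 |A| ≤ 12 |E|`.
  have := hA.card_le
  omega

/-- Every tame set of vertices of a planar graph of girth at least 14 can be peeled off. -/
lemma Tame.peel (D : PlaneDrawing G) (hg : 14 ≤ G.egirth) {A : Finset V} (hA : G.Tame A) :
    G.Peel A := by
  induction A using Finset.strongInduction with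
  | H A ih =>
    by_contra h
    exact Irreducible.false_of_planeDrawing ⟨hg, hA, h, ih⟩ D

end SimpleGraph

theorem theorem3 {V : Type*} [Fintype V] (G : SimpleGraph V) [DecidableRel G.Adj]
    (hplanar : IsPlanar G) (hdeg : 2 ≤ G.minDegree) (hgirth : 14 ≤ G.egirth) :
    equitableChromaticThreshold G ≤ 3 := by
  classical
  obtain ⟨D⟩ := hplanar
  -- Vacuous: minimum degree 2 leaves no vertex of degree 1.
  have htame : G.Tame Finset.univ := by
    intro x _ h
    have h2 := hdeg.trans (G.minDegree_le_degree x)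
    have h3 : G.degOn Finset.univ x = G.degree x := by
      rw [← SimpleGraph.card_neighborFinset_eq_degree, SimpleGraph.degOn]
      congr 1
      ext u
      simp
    omega
  exact iInf₂_le 3 fun n hn => (htame.peel D hgirth).equitablyColorable hn
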